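/- Let $k$ be a field and let $R$ be a cochain differential graded (DG) algebra over $k$ of the form $\cdots\to 0\to k\to 0\to R^2\to R^3\to\cdots$ (that is, $R^i=0$ for $i<0$, $R^0=k$, $R^1=0$) with $\dim_k \mathrm{H}^i(R)<\infty$ for each $i$. Let $\mathsf{D}(R)$ be the derived category of DG left $R$-modules, and view $k$ as a DG $R$-module (left and right) concentrated in degree $0$ via the augmentation $R\to R^0=k$. A DG left $R$-module is called compact if it is finitely built from $R$ in $\mathsf{D}(R)$ using distinguished triangles, (de)suspensions, finite direct sums, and direct summands. For a complex or DG module $M$ put $$\sup M=\sup\{\,j\in\mathbb{Z}\mid \mathrm{H}^j(M)\neq 0\,\}\in\mathbb{Z}\cup\{\pm\infty\},\qquad \sup\varnothing=-\infty,$$ and for a DG left $R$-module $M$ let the projective codimension of $M$ be $$\operatorname{pcd} M=\sup\bigl(k\stackrel{\mathrm{L}}{\otimes}_R M\bigr)=\sup\{\,j\in\mathbb{Z}\mid \mathrm{H}^j(k\stackrel{\mathrm{L}}{\otimes}_R M)\neq 0\,\}.$$ Let $M$ be a compact DG left $R$-module. (i) If $\sup R<\infty$, then $\operatorname{pcd}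 M=\sup M-\sup R$. (ii) If $\sup M<\infty$ and $k$ is compact as a DG left $R$-module, then $\operatorname{pcd} M=\sup M+\operatorname{pcd} k$. (Here $-\infty$ plus or minus an integer is $-\infty$.) -/

import Mathlib

open CategoryTheory TensorProduct

universe u

noncomputable section

/-! ### Cohomology of a graded vector space with a differential -/

/-- `H^j = {x ∈ V^j | d x = 0} / d (V^{j-1})`, for a `k`-vector space `V` with a family `gr` of
subspaces (the homogeneous pieces) and an endomorphism `d` (the differential). -/
abbrev GradedCohomology {k V : Type u} [Field k] [AddCommGroup V] [Module k V]
    (gr : ℤ → Submodule k V) (d : V →ₗ[k] V) (j : ℤ) : Type u :=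
  ↥(LinearMap.ker d ⊓ gr j) ⧸ ((gr (j - 1)).map d).comap (LinearMap.ker d ⊓ gr j).subtype

/-- The supremum in `ℤ ∪ {±∞}` (inside the extended reals) of a set of integers; `sup ∅ = -∞`. -/
def intSup (S : Set ℤ) : EReal := ⨆ j ∈ S, ((j : ℝ) : EReal)

/-! ### Differential graded algebras -/

/-- A differential graded algebra over the field `k`, in cohomological grading: a `ℤ`-graded
associative unital `k`-algebra with a `k`-linear differential of degree `+1` which satisfies
the graded Leibniz rule.  The algebra `R` is the direct sum of its homogeneous pieces. -/
class DGAlgebra (k R : Type u) [Field k] [Ring R] [Algebra k R] where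
  gr : ℤ → Submodule k R
  gradedAlgebra : GradedAlgebra gr
  d : R →ₗ[k] R
  d_mem : ∀ (i : ℤ) (r : R), r ∈ gr i → d r ∈ gr (i + 1)
  d_d : ∀ r : R, d (d r) = 0
  leibniz : ∀ (i : ℤ) (r s : R), r ∈ gr i → d (r * s) = d r * s + i.negOnePow • (r * d s)

attribute [instance] DGAlgebra.gradedAlgebra

/-- The DG algebra `R` over `k` has the form `⋯ → 0 → k → 0 → R² → R³ → ⋯`
(with `k` in degree `0`), and each `H^i(R)` is finite dimensional over `k`. -/
class IsSimplyConnectedCochain (k R : Type u) [Field k] [Ring R] [Algebra k R]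
    [DGAlgebra k R] : Prop where
  gr_neg : ∀ i : ℤ, i < 0 → DGAlgebra.gr (k := k) (R := R) i = ⊥
  gr_zero : ∀ r ∈ DGAlgebra.gr (k := k) (R := R) 0, ∃! c : k, algebraMap k R c = r
  gr_one : DGAlgebra.gr (k := k) (R := R) 1 = ⊥
  finite_cohomology : ∀ i : ℤ, Module.Finite k
    (GradedCohomology (DGAlgebra.gr (k := k) (R := R)) (DGAlgebra.d (k := k) (R := R)) i)

/-! ### Differential graded left modules -/

/-- A DG left `R`-module: a graded left `R`-module (the direct sum of its homogeneous pieces)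
with a differential of degree `+1` which satisfies the graded Leibniz rule. -/
structure DGMod (k R : Type u) [Field k] [Ring R] [Algebra k R] [DGAlgebra k R] where
  carrier : Type u
  [addCommGroup : AddCommGroup carrier]
  [moduleBase : Module k carrier]
  [module : Module R carrier]
  [isScalarTower : IsScalarTower k R carrier]
  gr : ℤ → Submodule k carrier
  isInternal : DirectSum.IsInternal gr
  smul_mem : ∀ (i j : ℤ) (r : R) (m : carrier),
    r ∈ DGAlgebra.gr (k := k) i → m ∈ gr j → r • m ∈ gr (i + j)
  d : carrier →ₗ[k] carrier
  d_mem : ∀ (i : ℤ) (m : carrier), m ∈ gr i → d m ∈ gr (i + 1)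
  d_d : ∀ m : carrier, d (d m) = 0
  leibniz : ∀ (i : ℤ) (r : R) (m : carrier), r ∈ DGAlgebra.gr (k := k) i →
    d (r • m) = DGAlgebra.d (k := k) r • m + i.negOnePow • (r • d m)

namespace DGMod

attribute [instance] DGMod.addCommGroup DGMod.moduleBase DGMod.module DGMod.isScalarTower

variable {k R : Type u} [Field k] [Ring R] [Algebra k R] [DGAlgebra k R]

instance : CoeSort (DGMod k R) (Type u) := ⟨DGMod.carrier⟩

/-- A morphism of DG modules: an `R`-linear map of degree `0` commuting with the
differentials. -/
@[ext]
structure Hom (M N : DGMod k R) where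
  toLin : M →ₗ[R] N
  map_mem : ∀ (i : ℤ) (m : M), m ∈ M.gr i → toLin m ∈ N.gr i
  map_d : ∀ m : M, toLin (M.d m) = N.d (toLin m)

instance : Category (DGMod k R) where
  Hom M N := Hom M N
  id M := ⟨LinearMap.id, fun _ _ h => h, fun _ => rfl⟩
  comp f g := ⟨g.toLin.comp f.toLin, fun i m h => g.map_mem i _ (f.map_mem i m h), fun m => by
    simp [f.map_d, g.map_d]⟩

/-- The underlying `R`-linear map of a morphism of DG modules. -/
def lin {M N : DGMod k R} (f : M ⟶ N) : M →ₗ[R] N := Hom.toLin f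

/-- The cohomology `H^j(M)` of a DG module. -/
abbrev cohomology (M : DGMod k R) (j : ℤ) : Type u := GradedCohomology M.gr M.d j

/-- The map induced by a morphism of DG modules on homogeneous cocycles of degree `j`. -/
def cocyclesMap {M N : DGMod k R} (f : M ⟶ N) (j : ℤ) :
    ↥(LinearMap.ker M.d ⊓ M.gr j) →ₗ[k] ↥(LinearMap.ker N.d ⊓ N.gr j) :=
  ((lin f).restrictScalars k).restrict (fun x hx => by
    refine ⟨?_, Hom.map_mem f j x hx.2⟩
    have h := Hom.map_d f x
    rw [LinearMap.mem_ker.1 hx.1, map_zero] at h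
    exact LinearMap.mem_ker.2 h.symm)

/-- The map `H^j(f) : H^j(M) → H^j(N)`. -/
def cohomologyMap {M N : DGMod k R} (f : M ⟶ N) (j : ℤ) :
    M.cohomology j →ₗ[k] N.cohomology j :=
  Submodule.mapQ _ _ (cocyclesMap f j) (by
    rintro ⟨x, hx⟩ ⟨y, hy, hyx⟩
    refine ⟨lin f y, Hom.map_mem f _ y hy, ?_⟩
    change M.d y = x at hyx
    subst hyx
    exact (Hom.map_d f y).symm)

/-- The class of quasi-isomorphisms of DG modules. -/
def quasiIso (k R : Type u) [Field k] [Ring R] [Algebra k R] [DGAlgebra k R] :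
    MorphismProperty (DGMod k R) :=
  fun _ _ f => ∀ j : ℤ, Function.Bijective (cohomologyMap f j)

/-- The derived category `D(R)` of DG left `R`-modules: the localization of the category of DG
modules at the quasi-isomorphisms. -/
abbrev Derived (k R : Type u) [Field k] [Ring R] [Algebra k R] [DGAlgebra k R] :=
  (quasiIso k R).Localization

/-- A DG module, as an object of the derived category. -/
abbrev toDerived (M : DGMod k R) : Derived k R := (quasiIso k R).Q.obj M

/-- `sup M = sup {j | H^j(M) ≠ 0}`. -/
def sup (M : DGMod k R) : EReal := intSup {j | Nontrivial (M.cohomology j)}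

/-- `R` as a DG left module over itself. -/
abbrev self (k R : Type u) [Field k] [Ring R] [Algebra k R] [DGAlgebra k R] : DGMod k R where
  carrier := R
  gr := DGAlgebra.gr
  isInternal := DirectSum.Decomposition.isInternal _
  smul_mem _ _ _ _ hr hm := SetLike.mul_mem_graded hr hm
  d := DGAlgebra.d
  d_mem := DGAlgebra.d_mem
  d_d := DGAlgebra.d_d
  leibniz := DGAlgebra.leibniz

/-- The `n`-fold (de)suspension `Σⁿ M`, with `(Σⁿ M)^i = M^{i+n}`.  The differential and the
action of `R` are those of `M`; the involution `m ↦ (-1)^{n|m|} m` is an isomorphism to the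
version in which the differential is multiplied by `(-1)ⁿ` and the action of `r` by
`(-1)^{n|r|}`. -/
abbrev shift (M : DGMod k R) (n : ℤ) : DGMod k R where
  carrier := M
  gr i := M.gr (i + n)
  isInternal := by
    have h := (DirectSum.isInternal_submodule_iff_iSupIndep_and_iSup_eq_top _).1 M.isInternal
    refine (DirectSum.isInternal_submodule_iff_iSupIndep_and_iSup_eq_top _).2 ⟨?_, ?_⟩
    · exact h.1.comp (add_left_injective n)
    · rw [← h.2]
      exact (Equiv.addRight n).iSup_comp (g := M.gr)
  smul_mem i j r m hr hm := by
    rw [add_assoc]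
    exact M.smul_mem i (j + n) r m hr hm
  d := M.d
  d_mem i m hm := by
    rw [add_right_comm]
    exact M.d_mem _ m hm
  d_d := M.d_d
  leibniz := M.leibniz

/-- Compact DG modules: those finitely built from `R` in `D(R)` using distinguished triangles,
(de)suspensions, finite direct sums and direct summands.

Up to isomorphism in `D(R)`, the distinguished triangles are those `A → B → C → Σ A` which come
from short exact sequences `0 → A → B → C → 0` of DG modules, so closure under triangles is
expressed by the two-out-of-three property for short exact sequences.  Closure under isomorphism
in `D(R)` is the special case of `retract` where the retraction is an isomorphism, and finite
direct sums are covered by the short exact sequences `0 → A → A ⊕ C → C → 0` and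
`0 → A → A → 0 → 0`. -/
inductive IsCompact : DGMod k R → Prop
  | self : IsCompact (DGMod.self k R)
  | shift (M : DGMod k R) (n : ℤ) : IsCompact M → IsCompact (M.shift n)
  | left {A B C : DGMod k R} (f : A ⟶ B) (g : B ⟶ C) (hf : Function.Injective (lin f))
      (hfg : Function.Exact (lin f) (lin g)) (hg : Function.Surjective (lin g)) :
      IsCompact B → IsCompact C → IsCompact A
  | middle {A B C : DGMod k R} (f : A ⟶ B) (g : B ⟶ C) (hf : Function.Injective (lin f))
      (hfg : Function.Exact (lin f) (lin g)) (hg : Function.Surjective (lin g)) :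
      IsCompact A → IsCompact C → IsCompact B
  | right {A B C : DGMod k R} (f : A ⟶ B) (g : B ⟶ C) (hf : Function.Injective (lin f))
      (hfg : Function.Exact (lin f) (lin g)) (hg : Function.Surjective (lin g)) :
      IsCompact A → IsCompact B → IsCompact C
  | retract {M N : DGMod k R} (r : Retract M.toDerived N.toDerived) : IsCompact N → IsCompact M

/-- A DG module is semi-free if it has a semi-basis: a homogeneous basis over `R` (forgetting
differentials), the disjoint union of subsets `E₀, E₁, …`, such that the differential maps each
`Eₙ` to the `R`-span of `E₀ ∪ ⋯ ∪ Eₙ₋₁`. -/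
def IsSemifree (F : DGMod k R) : Prop :=
  ∃ (ι : Type u) (b : Module.Basis ι R F) (deg : ι → ℤ) (lvl : ι → ℕ),
    (∀ i, b i ∈ F.gr (deg i)) ∧
    ∀ i, F.d (b i) ∈ Submodule.span R (b '' {j | lvl j < lvl i})

/-! ### The augmentation and the DG module `k` -/

section Augmentation

variable [IsSimplyConnectedCochain k R]

variable (k R) in
/-- The identification `k ≅ R⁰`. -/
def baseEquiv : k ≃ₗ[k] DGAlgebra.gr (k := k) (R := R) 0 :=
  LinearEquiv.ofBijective
    ((Algebra.linearMap k R).codRestrict (DGAlgebra.gr (k := k) (R := R) 0) (fun c => by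
      rw [Algebra.linearMap_apply, Algebra.algebraMap_eq_smul_one]
      exact Submodule.smul_mem _ _ (SetLike.GradedOne.one_mem)))
    ⟨fun a b h => by
      have h' : algebraMap k R a = algebraMap k R b := congrArg Subtype.val h
      obtain ⟨c, -, hc⟩ := IsSimplyConnectedCochain.gr_zero (k := k) (algebraMap k R b) (by
        rw [Algebra.algebraMap_eq_smul_one]
        exact Submodule.smul_mem _ _ (SetLike.GradedOne.one_mem))
      rw [hc a h', hc b rfl],
    fun x => by
      obtain ⟨c, hc, -⟩ := IsSimplyConnectedCochain.gr_zero (k := k) x.1 x.2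
      exact ⟨c, Subtype.ext hc⟩⟩

variable (k R) in
/-- The projection of `R` onto `R⁰ = k`, as a linear map. -/
def augLin : R →ₗ[k] k :=
  (baseEquiv k R).symm.toLinearMap ∘ₗ DirectSum.component k ℤ _ 0 ∘ₗ
    (DirectSum.decomposeLinearEquiv (DGAlgebra.gr (k := k) (R := R))).toLinearMap

theorem augLin_of_ne {i : ℤ} (hi : i ≠ 0) {r : R} (hr : r ∈ DGAlgebra.gr (k := k) i) :
    augLin k R r = 0 := by
  have : (DirectSum.decompose (DGAlgebra.gr (k := k) (R := R)) r) 0 = 0 :=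
    Subtype.ext (DirectSum.decompose_of_mem_ne _ hr hi)
  change (baseEquiv k R).symm ((DirectSum.decompose (DGAlgebra.gr (k := k) (R := R)) r) 0) = 0
  rw [this, map_zero]

theorem augLin_algebraMap (c : k) : augLin k R (algebraMap k R c) = c := by
  have hc : algebraMap k R c ∈ DGAlgebra.gr (k := k) (R := R) 0 := (baseEquiv k R c).2
  have : (DirectSum.decompose (DGAlgebra.gr (k := k) (R := R)) (algebraMap k R c)) 0 =
      baseEquiv k R c := Subtype.ext (DirectSum.decompose_of_mem_same _ hc)
  change (baseEquiv k R).symm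
    ((DirectSum.decompose (DGAlgebra.gr (k := k) (R := R)) (algebraMap k R c)) 0) = c
  rw [this, LinearEquiv.symm_apply_apply]

theorem augLin_mul (r s : R) : augLin k R (r * s) = augLin k R r * augLin k R s := by
  induction r using DirectSum.Decomposition.inductionOn (DGAlgebra.gr (k := k) (R := R)) with
  | zero => simp
  | add a b ha hb => simp [add_mul, ha, hb]
  | @homogeneous i a =>
  induction s using DirectSum.Decomposition.inductionOn (DGAlgebra.gr (k := k) (R := R)) with
  | zero => simp
  | add a b ha hb => simp [mul_add, ha, hb]
  | @homogeneous j b =>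
  obtain ⟨a, ha⟩ := a
  obtain ⟨b, hb⟩ := b
  change augLin k R (a * b) = augLin k R a * augLin k R b
  by_cases hi : i = 0
  · subst hi
    obtain ⟨c, rfl, -⟩ := IsSimplyConnectedCochain.gr_zero (k := k) a ha
    rw [← Algebra.smul_def, map_smul, augLin_algebraMap, smul_eq_mul]
  · rw [augLin_of_ne hi ha, zero_mul]
    by_cases hij : i + j = 0
    · rcases lt_or_gt_of_ne hi with h | h
      · rw [IsSimplyConnectedCochain.gr_neg i h, Submodule.mem_bot] at ha
        simp [ha]
      · rw [IsSimplyConnectedCochain.gr_neg j (by omega), Submodule.mem_bot] at hb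
        simp [hb]
    · exact augLin_of_ne hij (SetLike.mul_mem_graded ha hb)

variable (k R) in
/-- The augmentation `R → k`, which is the identity on `R⁰ = k` and zero on `Rⁱ` for `i ≠ 0`. -/
def aug : R →ₐ[k] k :=
  AlgHom.ofLinearMap (augLin k R) (by simpa using augLin_algebraMap (R := R) (1 : k)) augLin_mul

theorem aug_of_ne {i : ℤ} (hi : i ≠ 0) {r : R} (hr : r ∈ DGAlgebra.gr (k := k) i) :
    aug k R r = 0 := augLin_of_ne hi hr

theorem aug_d {i : ℤ} {r : R} (hr : r ∈ DGAlgebra.gr (k := k) i) :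
    aug k R (DGAlgebra.d (k := k) r) = 0 := by
  by_cases hi : i + 1 = 0
  · rw [IsSimplyConnectedCochain.gr_neg i (by omega), Submodule.mem_bot] at hr
    simp [hr]
  · exact aug_of_ne hi (DGAlgebra.d_mem i r hr)

theorem negOnePow_aug {i : ℤ} {r : R} (hr : r ∈ DGAlgebra.gr (k := k) i) :
    i.negOnePow • aug k R r = aug k R r := by
  by_cases hi : i = 0
  · simp [hi]
  · simp [aug_of_ne hi hr]

variable (k R) in
/-- The field `k` as a DG left `R`-module concentrated in degree `0`, where `R` acts through the
augmentation. -/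
abbrev residue : DGMod k R where
  carrier := k
  module := Module.compHom k (aug k R).toRingHom
  isScalarTower := by
    let _ : Module R k := Module.compHom k (aug k R).toRingHom
    refine ⟨fun a r m => ?_⟩
    change aug k R (a • r) * m = a * (aug k R r * m)
    rw [map_smul, smul_eq_mul, mul_assoc]
  gr i := if i = 0 then ⊤ else ⊥
  isInternal := by
    refine (DirectSum.isInternal_submodule_iff_iSupIndep_and_iSup_eq_top _).2 ⟨?_, ?_⟩
    · intro i
      by_cases hi : i = 0
      · have : (⨆ j, ⨆ (_ : j ≠ i), if j = 0 then (⊤ : Submodule k k) else ⊥) = ⊥ := by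
          simp only [iSup_eq_bot]
          intro j hj
          rw [if_neg (by omega)]
        rw [this]
        exact disjoint_bot_right
      · simp [hi]
    · exact eq_top_iff.2 (le_iSup_of_le 0 (by simp))
  smul_mem i j r m hr hm := by
    change aug k R r * m ∈ _
    by_cases hi : i = 0
    · by_cases hj : j = 0
      · simp [hi, hj]
      · rw [if_neg hj, Submodule.mem_bot] at hm
        simp [hm]
    · simp [aug_of_ne hi hr]
  d := 0
  d_mem _ _ _ := Submodule.zero_mem _
  d_d _ := rfl
  leibniz i r m hr := by
    change (0 : k) = aug k R (DGAlgebra.d (k := k) r) * m + i.negOnePow • (aug k R r * 0)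
    simp [aug_d hr]

/-! ### The complex `k ⊗_R M` and the projective codimension -/

/-- The relations `c r ⊗ m = c ⊗ r m` in `k ⊗_k M`, where `r ∈ R` acts on `c ∈ k` from the right
through the augmentation. -/
def tensorRel (M : DGMod k R) : Submodule k (k ⊗[k] M) :=
  Submodule.span k {x | ∃ (c : k) (r : R) (m : M), x = (c * aug k R r) ⊗ₜ[k] m - c ⊗ₜ[k] (r • m)}

/-- The vector space underlying the tensor product `k ⊗_R M`, where `k` is the right `R`-module
given by the augmentation. -/
abbrev ResidueTensor (M : DGMod k R) : Type u := (k ⊗[k] M) ⧸ tensorRel M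

/-- The grading of `k ⊗_R M`: since `k` sits in degree `0`, the piece of degree `n` consists of
the elements `1 ⊗ m` with `m ∈ Mⁿ`. -/
def residueTensorGr (M : DGMod k R) (n : ℤ) : Submodule k (ResidueTensor M) :=
  (M.gr n).map ((tensorRel M).mkQ ∘ₗ TensorProduct.mk k k M 1)

/-- The differential of `k ⊗_R M`, which is `c ⊗ m ↦ c ⊗ d m` since `k` sits in degree `0` and
has differential zero. -/
def residueTensorD (M : DGMod k R) : ResidueTensor M →ₗ[k] ResidueTensor M :=
  Submodule.mapQ _ _ (LinearMap.lTensor k M.d) (by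
    refine Submodule.span_le.2 ?_
    rintro _ ⟨c, r, m, rfl⟩
    change _ ∈ tensorRel M
    rw [map_sub, LinearMap.lTensor_tmul, LinearMap.lTensor_tmul]
    have key (c : k) (r : R) (m : M) :
        (c * aug k R r) ⊗ₜ[k] m - c ⊗ₜ[k] (r • m) ∈ tensorRel M :=
      Submodule.subset_span ⟨c, r, m, rfl⟩
    induction r using DirectSum.Decomposition.inductionOn (DGAlgebra.gr (k := k) (R := R)) with
    | zero => simp
    | add a b ha hb =>
      have := Submodule.add_mem _ ha hb
      convert this using 1
      rw [map_add, mul_add, add_smul, map_add, add_tmul, tmul_add]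
      abel
    | @homogeneous i a =>
      obtain ⟨a, ha⟩ := a
      change (c * aug k R a) ⊗ₜ[k] M.d m - c ⊗ₜ[k] M.d (a • m) ∈ _
      have h1 := key c (DGAlgebra.d (k := k) a) m
      rw [aug_d ha, mul_zero, zero_tmul] at h1
      have h2 := key (i.negOnePow • c) a (M.d m)
      have h3 := Submodule.add_mem _ h1 h2
      convert h3 using 1
      rw [M.leibniz i a m ha, tmul_add, smul_mul_assoc, ← mul_smul_comm, negOnePow_aug ha]
      have : (i.negOnePow • c) ⊗ₜ[k] (a • M.d m) = c ⊗ₜ[k] (i.negOnePow • a • M.d m) := by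
        rcases Int.even_or_odd i with h | h
        · simp [Int.negOnePow_even i h]
        · simp [Int.negOnePow_odd i h, neg_tmul, tmul_neg]
      rw [this]
      abel)

/-- `H^j(k ⊗_R M)`, for the underived tensor product. -/
abbrev residueTensorCohomology (M : DGMod k R) (j : ℤ) : Type u :=
  GradedCohomology (residueTensorGr M) (residueTensorD M) j

/-- `H^j(k ⊗ᴸ_R M) ≠ 0`.  The derived tensor product is `k ⊗_R F` for a semi-free resolution
`F → M`; such a resolution always exists and the cohomology of `k ⊗_R F` does not depend on it
up to isomorphism. -/
def TorNonzero (M : DGMod k R) (j : ℤ) : Prop :=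
  ∃ (F : DGMod k R) (q : F ⟶ M), F.IsSemifree ∧ quasiIso k R q ∧
    Nontrivial (residueTensorCohomology F j)

/-- The projective codimension `pcd M = sup {j | H^j(k ⊗ᴸ_R M) ≠ 0}`. -/
def pcd (M : DGMod k R) : EReal := intSup {j | TorNonzero M j}

end Augmentation

end DGMod

end

noncomputable section

/-! ### Graded vector spaces with a differential -/

section Graded

variable {k V : Type u} [Field k] [AddCommGroup V] [Module k V]

/-! Write Tor^j(M) for H^j(k ⊗ᴸ_R M). Compactness enters only through `IsCompact.isBounded`: H(M) is
bounded below and finite dimensional in each degree, and Tor(M) is bounded above. After that both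
formulas are dévissage, by copies of R from the bottom for (i) and by copies of k from the top for
(ii).

The link between H and Tor is `torNonzero_of_lowest`: the lowest cohomology of M survives in Tor.
Indeed M may be replaced by a DG module that vanishes below that degree n, and a linear form on H^n
then gives a morphism to k[-n] that detects the class. Hence M is acyclic if Tor(M) vanishes from
its lower bound upward (`acyclic_of_tor`).

For (i), let p = pcd M and s = sup R. A nonzero class in the lowest degree i gives R[-i] → M, whose
cone has smaller H^i (because H^1(R) = 0) and nothing new below i (because R^0 = k). Only degrees i
≤ p have to be treated; past p the module is acyclic. Each copy of R[-i] contributes cohomology up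
to degree i + s ≤ p + s, and the copies with i = p are responsible for H^{p+s}(M) ≠ 0. This is
`cohomology_of_tor`.

For (ii), let m = sup M and q = pcd k. A class in the highest degree m is carried by a DG submodule
quasi-isomorphic to k[-m] (`exists_cut_quasiIso`), and dividing it out lowers dim H^m. Induction
bounds Tor(M) by m + q (`not_torNonzero_of_lt`). For nonvanishing, take the DG submodule D of M that
carries only H^{m-1} and H^m. As R^1 = 0, a linear form on M^m that kills boundaries is R-linear on
D, so k[-m] is a retract of D and Tor^{m+q}(D) ≠ 0. The quotient M/D has cohomology only up to m -
2, hence no Tor in degree m + q - 1 that could kill this class (`torNonzero_of_highest`).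

The homological algebra behind this is built from the definitions. Semi-free resolutions exist by
attaching all formal cells at once (`resolveMap_quasiIso`). Homotopy classes of maps out of a
semi-free module invert quasi-isomorphisms, so retracts in D(R) lift to homotopy retracts of
resolutions and Tor is well defined (`TorNonzero.of_retract`, `torNonzero_iff`). Short exact
sequences lift to short exact sequences of resolutions (`exists_resolution`), which gives the long
exact sequence of Tor. -/

theorem gradedCohomology_nontrivial_iff {gr : ℤ → Submodule k V} {d : V →ₗ[k] V} {i j : ℤ}
    (h : i + 1 = j) : Nontrivial (GradedCohomology gr d j) ↔
      ∃ x ∈ gr j, d x = 0 ∧ ∀ y ∈ gr i, d y ≠ x := by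
  obtain rfl : i = j - 1 := by omega
  rw [Submodule.Quotient.nontrivial_iff, Ne, Submodule.eq_top_iff']
  push Not
  constructor
  · rintro ⟨⟨x, hx⟩, hx'⟩
    exact ⟨x, hx.2, hx.1, fun y hy hyx => hx' ⟨y, hy, hyx⟩⟩
  · rintro ⟨x, hx, hdx, hx'⟩
    exact ⟨⟨x, hdx, hx⟩, fun ⟨y, hy, hyx⟩ => hx' y hy hyx⟩

theorem not_nontrivial_gradedCohomology_iff {gr : ℤ → Submodule k V} {d : V →ₗ[k] V} {i j : ℤ}
    (h : i + 1 = j) : ¬ Nontrivial (GradedCohomology gr d j) ↔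
      ∀ x ∈ gr j, d x = 0 → ∃ y ∈ gr i, d y = x := by
  rw [gradedCohomology_nontrivial_iff h]
  push Not
  rfl

/-- A criterion for a grading, in terms of projections onto the homogeneous pieces. -/
theorem isInternal_of_proj (gr : ℤ → Submodule k V) (p : ℤ → V →ₗ[k] V)
    (hp : ∀ i, ∀ v ∈ gr i, p i v = v) (hp' : ∀ i j, i ≠ j → ∀ v ∈ gr i, p j v = 0)
    (htop : ⨆ i, gr i = ⊤) : DirectSum.IsInternal gr := by
  refine (DirectSum.isInternal_submodule_iff_iSupIndep_and_iSup_eq_top _).2 ⟨?_, htop⟩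
  intro i
  rw [Submodule.disjoint_def]
  intro v hv hv'
  have h : (⨆ j, ⨆ (_ : j ≠ i), gr j) ≤ LinearMap.ker (p i) :=
    iSup₂_le fun j hj v hv => hp' j i hj v hv
  rw [← hp i v hv]
  exact h hv'

end Graded

namespace DGMod

variable {k R : Type u} [Field k] [Ring R] [Algebra k R] [DGAlgebra k R]

/-! ### Projections onto homogeneous pieces and the sign involution -/

section Basic

variable (M : DGMod k R)

/-- The decomposition of a DG module into its homogeneous pieces. -/
def decomp : (DirectSum ℤ fun i => M.gr i) ≃ₗ[k] M :=
  LinearEquiv.ofBijective (DirectSum.coeLinearMap M.gr) M.isInternal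

/-- The projection of a DG module onto its piece of degree `n`. -/
def proj (n : ℤ) : M →ₗ[k] M :=
  (M.gr n).subtype ∘ₗ DirectSum.component k ℤ _ n ∘ₗ M.decomp.symm.toLinearMap

/-- The involution `m ↦ (-1)^{|m|} m`. -/
def sgn : M →ₗ[k] M :=
  DirectSum.toModule k ℤ M (fun i => i.negOnePow • (M.gr i).subtype) ∘ₗ
    M.decomp.symm.toLinearMap

variable {M}

theorem decomp_symm_of_mem {n : ℤ} {m : M} (hm : m ∈ M.gr n) :
    M.decomp.symm m = DirectSum.lof k ℤ (fun i => M.gr i) n ⟨m, hm⟩ := by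
  rw [LinearEquiv.symm_apply_eq]
  exact (DirectSum.coeLinearMap_lof M.gr n ⟨m, hm⟩).symm

theorem proj_mem (n : ℤ) (m : M) : M.proj n m ∈ M.gr n := Subtype.property _

theorem proj_of_mem {n : ℤ} {m : M} (hm : m ∈ M.gr n) : M.proj n m = m := by
  simp [proj, decomp_symm_of_mem hm, DirectSum.component.lof_self]

theorem proj_of_mem_ne {n j : ℤ} {m : M} (hm : m ∈ M.gr n) (h : n ≠ j) : M.proj j m = 0 := by
  simp only [proj, LinearMap.comp_apply, LinearEquiv.coe_coe, decomp_symm_of_mem hm,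
    DirectSum.component.of, Submodule.subtype_apply]
  rw [dif_neg h]
  rfl

theorem sgn_of_mem {n : ℤ} {m : M} (hm : m ∈ M.gr n) : M.sgn m = n.negOnePow • m := by
  simp [sgn, decomp_symm_of_mem hm]

variable (M) in
theorem iSup_gr : ⨆ i, M.gr i = ⊤ :=
  ((DirectSum.isInternal_submodule_iff_iSupIndep_and_iSup_eq_top _).1 M.isInternal).2

/-- Linear predicates may be checked on homogeneous elements. -/
theorem mem_of_homogeneous (N : Submodule k M) (h : ∀ n, ∀ m ∈ M.gr n, m ∈ N) (m : M) : m ∈ N := by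
  have : (⊤ : Submodule k M) ≤ N := M.iSup_gr ▸ iSup_le h
  exact this trivial

theorem linearMap_ext {V : Type*} [AddCommGroup V] [Module k V] {f g : M →ₗ[k] V}
    (h : ∀ n, ∀ m ∈ M.gr n, f m = g m) : f = g := by
  ext m
  exact mem_of_homogeneous (LinearMap.eqLocus f g) h m

theorem eq_of_proj_eq {x y : M} (h : ∀ n, M.proj n x = M.proj n y) : x = y := by
  apply M.decomp.symm.injective
  ext n
  exact h n

theorem proj_proj (n : ℤ) (m : M) : M.proj n (M.proj n m) = M.proj n m :=
  proj_of_mem (proj_mem n m)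

theorem mem_gr_iff {n : ℤ} {m : M} : m ∈ M.gr n ↔ M.proj n m = m :=
  ⟨proj_of_mem, fun h => h ▸ proj_mem n m⟩

/-- A homogeneous linear map commutes with projections. -/
theorem proj_map {N : DGMod k R} (f : M →ₗ[k] N) (c : ℤ)
    (hf : ∀ n, ∀ m ∈ M.gr n, f m ∈ N.gr (n + c)) (n : ℤ) (m : M) :
    N.proj (n + c) (f m) = f (M.proj n m) := by
  have : N.proj (n + c) ∘ₗ f = f ∘ₗ M.proj n := by
    refine linearMap_ext fun j m hm => ?_
    by_cases h : j = n
    · subst h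
      simp [proj_of_mem hm, proj_of_mem (hf _ _ hm)]
    · simp [proj_of_mem_ne hm h, proj_of_mem_ne (hf _ _ hm) (show j + c ≠ n + c by omega)]
  exact LinearMap.congr_fun this m

theorem proj_smul {a : ℤ} {r : R} (hr : r ∈ DGAlgebra.gr (k := k) a) (n : ℤ) (m : M) :
    M.proj n (r • m) = r • M.proj (n - a) m := by
  have := proj_map (N := M) (DistribSMul.toLinearMap k M r) a
    (fun j m hm => by rw [add_comm]; exact M.smul_mem a j r m hr hm) (n - a) m
  simpa using this

theorem proj_d (n : ℤ) (m : M) : M.proj (n + 1) (M.d m) = M.d (M.proj n m) :=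
  proj_map M.d 1 M.d_mem n m

theorem sgn_mem {n : ℤ} {m : M} (hm : m ∈ M.gr n) : M.sgn m ∈ M.gr n := by
  rw [sgn_of_mem hm]
  rcases Int.even_or_odd n with h | h
  · simpa [Int.negOnePow_even n h] using hm
  · simpa [Int.negOnePow_odd n h] using hm

theorem units_smul_units_smul (n : ℤ) {A : Type*} [AddCommGroup A] (m : A) :
    n.negOnePow • n.negOnePow • m = m := by
  rw [smul_smul, Int.units_mul_self, one_smul]

theorem sgn_sgn (m : M) : M.sgn (M.sgn m) = m := by
  have : M.sgn ∘ₗ M.sgn = LinearMap.id := linearMap_ext fun n m hm => by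
    rw [LinearMap.comp_apply, sgn_of_mem (sgn_mem hm), sgn_of_mem hm, units_smul_units_smul,
      LinearMap.id_apply]
  exact LinearMap.congr_fun this m

/-- This anticommutation replaces the sign that the differential of a suspension usually carries:
`shift` leaves the differential alone, and cones get `d ∘ d = 0` from here. -/
theorem d_sgn (m : M) : M.d (M.sgn m) = - M.sgn (M.d m) := by
  have : M.d ∘ₗ M.sgn = - (M.sgn ∘ₗ M.d) := linearMap_ext fun n m hm => by
    simp [sgn_of_mem (M.d_mem n m hm), sgn_of_mem hm, Int.negOnePow_succ, Units.smul_def]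
  exact LinearMap.congr_fun this m

theorem map_sgn {N : DGMod k R} (f : M →ₗ[k] N) (hf : ∀ n, ∀ m ∈ M.gr n, f m ∈ N.gr n) (m : M) :
    f (M.sgn m) = N.sgn (f m) := by
  have : f ∘ₗ M.sgn = N.sgn ∘ₗ f := linearMap_ext fun n m hm => by
    simp [sgn_of_mem hm, sgn_of_mem (hf n m hm), Units.smul_def]
  exact LinearMap.congr_fun this m

variable (k) in
/-- The sign involution of the DG algebra. -/
abbrev sg : R →ₗ[k] R := (self k R).sgn

theorem smul_decomp_induction {P : R → Prop} (hadd : ∀ r s, P r → P s → P (r + s))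
    (h : ∀ n, ∀ r ∈ DGAlgebra.gr (k := k) (R := R) n, P r) (r : R) : P r := by
  induction r using DirectSum.Decomposition.inductionOn (DGAlgebra.gr (k := k) (R := R)) with
  | zero => exact h 0 0 (Submodule.zero_mem _)
  | add a b ha hb => exact hadd a b ha hb
  | homogeneous a => exact h _ a a.2

/-- For an honestly `R`-linear `h` of degree -1, the map `d ∘ h - h ∘ d` is semilinear with respect
to `sg k`. The composite of a morphism with `sgn` is semilinear in the same way, so homotopies can
be kept `R`-linear. -/
theorem sgn_smul (r : R) (m : M) : M.sgn (r • m) = sg k r • M.sgn m := by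
  revert r
  refine smul_decomp_induction (k := k) (fun r s hr hs => by simp [add_smul, hr, hs]) ?_
  intro a r hr
  have : M.sgn ∘ₗ (DistribSMul.toLinearMap k M r) =
      (DistribSMul.toLinearMap k M (sg k r)) ∘ₗ M.sgn := linearMap_ext fun n m hm => by
    simp only [LinearMap.comp_apply, DistribSMul.toLinearMap_apply]
    rw [sgn_of_mem (M.smul_mem a n r m hr hm), sgn_of_mem hm, sg,
      sgn_of_mem (M := self k R) hr, Int.negOnePow_add, mul_smul]
    simp only [Units.smul_def, smul_assoc, smul_comm r]
  exact LinearMap.congr_fun this m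

/-- The Leibniz rule for elements which need not be homogeneous. -/
theorem d_smul (r : R) (m : M) :
    M.d (r • m) = DGAlgebra.d (k := k) r • m + sg k r • M.d m := by
  revert r
  refine smul_decomp_induction (k := k) (fun r s hr hs => ?_) ?_
  · simp only [add_smul, map_add, hr, hs]; abel
  · intro a r hr
    rw [M.leibniz a r m hr, sg, sgn_of_mem (M := self k R) hr]
    simp only [Units.smul_def, smul_assoc]

end Basic

/-! ### Elementwise criteria -/

theorem comp_apply {M N P : DGMod k R} (f : M ⟶ N) (g : N ⟶ P) (m : M) :
    lin (f ≫ g) m = lin g (lin f m) := rfl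

theorem lin_d {M N : DGMod k R} (f : M ⟶ N) (m : M) : lin f (M.d m) = N.d (lin f m) :=
  Hom.map_d f m

theorem lin_mem {M N : DGMod k R} (f : M ⟶ N) {n : ℤ} {m : M} (hm : m ∈ M.gr n) :
    lin f m ∈ N.gr n := Hom.map_mem f n m hm

@[ext]
theorem hom_ext {M N : DGMod k R} {f g : M ⟶ N} (h : ∀ m, lin f m = lin g m) : f = g :=
  Hom.ext (LinearMap.ext h)

theorem proj_lin {M N : DGMod k R} (f : M ⟶ N) (n : ℤ) (m : M) :
    N.proj n (lin f m) = lin f (M.proj n m) := by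
  have := proj_map ((lin f).restrictScalars k) 0
    (fun n m hm => by rw [add_zero]; exact lin_mem f hm) n m
  rw [add_zero] at this
  exact this

theorem sgn_lin {M N : DGMod k R} (f : M ⟶ N) (m : M) :
    N.sgn (lin f m) = lin f (M.sgn m) :=
  (map_sgn ((lin f).restrictScalars k) (fun _ _ hm => lin_mem f hm) m).symm

theorem cohomologyMap_mk {M N : DGMod k R} (f : M ⟶ N) (j : ℤ)
    (x : ↥(LinearMap.ker M.d ⊓ M.gr j)) :
    cohomologyMap f j (Submodule.Quotient.mk x) = Submodule.Quotient.mk (cocyclesMap f j x) := rfl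

theorem cohomologyMap_surjective_iff {M N : DGMod k R} (f : M ⟶ N) {i j : ℤ} (h : i + 1 = j) :
    Function.Surjective (cohomologyMap f j) ↔
      ∀ x ∈ N.gr j, N.d x = 0 → ∃ y ∈ M.gr j, M.d y = 0 ∧ ∃ z ∈ N.gr i, N.d z = lin f y - x := by
  obtain rfl : i = j - 1 := by omega
  constructor
  · intro H x hx hdx
    obtain ⟨y, hy⟩ := H (Submodule.Quotient.mk ⟨x, hdx, hx⟩)
    obtain ⟨⟨y, hyd, hyj⟩, rfl⟩ := Submodule.Quotient.mk_surjective _ y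
    rw [cohomologyMap_mk, Submodule.Quotient.eq] at hy
    obtain ⟨z, hz, hz'⟩ := hy
    exact ⟨y, hyj, hyd, z, hz, hz'⟩
  · intro H x
    obtain ⟨⟨x, hxd, hxj⟩, rfl⟩ := Submodule.Quotient.mk_surjective _ x
    obtain ⟨y, hyj, hyd, z, hz, hz'⟩ := H x hxj hxd
    refine ⟨Submodule.Quotient.mk ⟨y, hyd, hyj⟩, ?_⟩
    rw [cohomologyMap_mk, Submodule.Quotient.eq]
    exact ⟨z, hz, hz'⟩

theorem cohomologyMap_injective_iff {M N : DGMod k R} (f : M ⟶ N) {i j : ℤ} (h : i + 1 = j) :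
    Function.Injective (cohomologyMap f j) ↔
      ∀ y ∈ M.gr j, M.d y = 0 → ∀ z ∈ N.gr i, N.d z = lin f y → ∃ w ∈ M.gr i, M.d w = y := by
  obtain rfl : i = j - 1 := by omega
  rw [injective_iff_map_eq_zero]
  constructor
  · intro H y hy hdy z hz hzy
    have := H (Submodule.Quotient.mk ⟨y, hdy, hy⟩) (by
      rw [cohomologyMap_mk, Submodule.Quotient.mk_eq_zero]
      exact ⟨z, hz, hzy⟩)
    rw [Submodule.Quotient.mk_eq_zero] at this
    exact this
  · intro H y hy
    obtain ⟨⟨y, hyd, hyj⟩, rfl⟩ := Submodule.Quotient.mk_surjective _ y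
    rw [cohomologyMap_mk, Submodule.Quotient.mk_eq_zero] at hy
    obtain ⟨z, hz, hz'⟩ := hy
    rw [Submodule.Quotient.mk_eq_zero]
    exact H y hyj hyd z hz hz'

/-- A criterion for quasi-isomorphisms. -/
theorem quasiIso_of {M N : DGMod k R} (f : M ⟶ N)
    (hs : ∀ i, ∀ x ∈ N.gr (i + 1), N.d x = 0 →
      ∃ y ∈ M.gr (i + 1), M.d y = 0 ∧ ∃ z ∈ N.gr i, N.d z = lin f y - x)
    (hi : ∀ i, ∀ y ∈ M.gr (i + 1), M.d y = 0 → ∀ z ∈ N.gr i, N.d z = lin f y →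
      ∃ w ∈ M.gr i, M.d w = y) : quasiIso k R f := fun j => by
  have h : j - 1 + 1 = j := by omega
  refine ⟨(cohomologyMap_injective_iff f h).2 ?_, (cohomologyMap_surjective_iff f h).2 ?_⟩
  · have := hi (j - 1); rwa [h] at this
  · have := hs (j - 1); rwa [h] at this

/-! ### Cohomology as a functor on the derived category -/

theorem cohomologyMap_id (M : DGMod k R) (j : ℤ) : cohomologyMap (𝟙 M) j = LinearMap.id := by
  ext x; rfl

theorem cohomologyMap_comp {M N P : DGMod k R} (f : M ⟶ N) (g : N ⟶ P) (j : ℤ) :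
    cohomologyMap (f ≫ g) j = cohomologyMap g j ∘ₗ cohomologyMap f j := by
  ext x; rfl

/-- The functor `H^j`. -/
def cohomologyFunctor (k R : Type u) [Field k] [Ring R] [Algebra k R] [DGAlgebra k R] (j : ℤ) :
    DGMod k R ⥤ ModuleCat.{u} k where
  obj M := ModuleCat.of k (M.cohomology j)
  map f := ModuleCat.ofHom (cohomologyMap f j)
  map_id M := by rw [cohomologyMap_id]; rfl
  map_comp f g := by rw [cohomologyMap_comp]; rfl

theorem cohomologyFunctor_inverts (j : ℤ) :
    (quasiIso k R).IsInvertedBy (cohomologyFunctor k R j) := fun _ _ _ hf =>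
  (LinearEquiv.ofBijective _ (hf j)).toModuleIso.isIso_hom

/-- A retract in the derived category induces retracts of the images under every functor which
inverts quasi-isomorphisms. -/
def retractMap {C : Type*} [Category* C] (G : DGMod k R ⥤ C) (hG : (quasiIso k R).IsInvertedBy G)
    {M N : DGMod k R} (r : Retract M.toDerived N.toDerived) : Retract (G.obj M) (G.obj N) :=
  (Retract.ofIso ((Localization.fac G hG (quasiIso k R).Q).app M).symm).trans
    ((r.map (Localization.lift G hG (quasiIso k R).Q)).trans
      (Retract.ofIso ((Localization.fac G hG (quasiIso k R).Q).app N)))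

theorem exists_surjective_of_retract {M N : DGMod k R} (r : Retract M.toDerived N.toDerived)
    (j : ℤ) : ∃ f : N.cohomology j →ₗ[k] M.cohomology j, Function.Surjective f := by
  let s := retractMap (cohomologyFunctor k R j) (cohomologyFunctor_inverts j) r
  refine ⟨s.r.hom, fun x => ⟨s.i.hom x, ?_⟩⟩
  have := s.retract
  exact LinearMap.congr_fun (congrArg ModuleCat.Hom.hom this) x

/-- A quasi-isomorphism becomes an isomorphism in the derived category. -/
def derivedIso {M N : DGMod k R} (f : M ⟶ N) (hf : quasiIso k R f) :
    M.toDerived ≅ N.toDerived :=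
  Localization.isoOfHom (quasiIso k R).Q (quasiIso k R) f hf

end DGMod

/-! ### Long exact sequences -/

/-- A graded vector space with a differential. -/
structure GradedComplex (k : Type u) [Field k] where
  V : Type u
  [addCommGroup : AddCommGroup V]
  [module : Module k V]
  gr : ℤ → Submodule k V
  d : V →ₗ[k] V
  d_mem : ∀ (i : ℤ) (v : V), v ∈ gr i → d v ∈ gr (i + 1)
  d_d : ∀ v : V, d (d v) = 0

namespace GradedComplex

attribute [instance] GradedComplex.addCommGroup GradedComplex.module

variable {k : Type u} [Field k]

/-- The cohomology of a graded vector space with a differential. -/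
abbrev H (A : GradedComplex k) (j : ℤ) : Type u := GradedCohomology A.gr A.d j

/-- The associated cochain complex. -/
def toComplex (A : GradedComplex k) : CochainComplex (ModuleCat.{u} k) ℤ where
  X i := ModuleCat.of k (A.gr i)
  d i j := if h : i + 1 = j then
      ModuleCat.ofHom (A.d.restrict (fun v hv => h ▸ A.d_mem i v hv)) else 0
  shape i j h := dif_neg h
  d_comp_d' i j l (hij : i + 1 = j) (hjl : j + 1 = l) := by
    rw [dif_pos hij, dif_pos hjl]
    ext v
    exact A.d_d v.1

theorem toComplex_d (A : GradedComplex k) {i j : ℤ} (h : i + 1 = j) (v : A.gr i) :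
    ((A.toComplex.d i j).hom v : A.gr j) = ⟨A.d v.1, h ▸ A.d_mem i v.1 v.2⟩ := by
  simp only [toComplex, dif_pos h]
  rfl

/-- A linear map of degree zero which commutes with the differentials. -/
structure Map (A B : GradedComplex k) where
  f : A.V →ₗ[k] B.V
  map_mem : ∀ (i : ℤ) (v : A.V), v ∈ A.gr i → f v ∈ B.gr i
  map_d : ∀ v : A.V, f (A.d v) = B.d (f v)

/-- The associated morphism of cochain complexes. -/
def Map.toHom {A B : GradedComplex k} (φ : Map A B) : A.toComplex ⟶ B.toComplex where
  f i := ModuleCat.ofHom (φ.f.restrict (φ.map_mem i))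
  comm' i j (h : i + 1 = j) := by
    ext v
    change ((B.toComplex.d i j).hom (φ.f.restrict (φ.map_mem i) v) : B.gr j) =
      φ.f.restrict (φ.map_mem j) ((A.toComplex.d i j).hom v)
    refine (toComplex_d B h _).trans (Eq.trans ?_
      (congrArg (φ.f.restrict (φ.map_mem j)) (toComplex_d A h v).symm))
    exact Subtype.ext (φ.map_d v.1).symm

/-- The short complex `A^{j-1} → A^j → A^{j+1}`. -/
abbrev sc (A : GradedComplex k) (j : ℤ) : ShortComplex (ModuleCat.{u} k) :=
  A.toComplex.sc' (j - 1) j (j + 1)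

/-- The inclusion of the cocycles. -/
def cyc (A : GradedComplex k) (j : ℤ) : ↥(LinearMap.ker A.d ⊓ A.gr j) →ₗ[k] A.gr j :=
  Submodule.inclusion inf_le_right

/-- The cohomology, as a left homology datum. -/
def homologyData (A : GradedComplex k) (j : ℤ) : (A.sc j).LeftHomologyData := by
  have wi : ModuleCat.ofHom (A.cyc j) ≫ (A.sc j).g = 0 := by
    ext v
    exact (toComplex_d A rfl _).trans (Subtype.ext v.2.1)
  have : Mono (ModuleCat.ofHom (A.cyc j)) :=
    (ModuleCat.mono_iff_injective _).2 (Submodule.inclusion_injective inf_le_right)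
  -- A monomorphism that is exact at its target is a kernel; dually below, an epimorphism that is
  -- exact at its source is a cokernel.
  have hex : (ShortComplex.mk _ _ wi).Exact := by
    rw [ShortComplex.moduleCat_exact_iff]
    intro v hv
    have hv' := (toComplex_d A rfl _).symm.trans hv
    exact ⟨⟨v.1, congrArg Subtype.val hv', v.2⟩, rfl⟩
  let hi : Limits.IsLimit (Limits.KernelFork.ofι _ wi) := hex.fIsKernel
  have hlift (v : A.gr (j - 1)) :
      ((hi.lift (Limits.KernelFork.ofι _ (A.sc j).zero)).hom v).1 = A.d v.1 := by
    have h := hi.fac (Limits.KernelFork.ofι _ (A.sc j).zero) Limits.WalkingParallelPair.zero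
    have h' := LinearMap.congr_fun (congrArg ModuleCat.Hom.hom h) v
    exact (congrArg Subtype.val h').trans
      (congrArg Subtype.val (toComplex_d A (show j - 1 + 1 = j by omega) v))
  have wπ : hi.lift (Limits.KernelFork.ofι _ (A.sc j).zero) ≫
      ModuleCat.ofHom (((A.gr (j - 1)).map A.d).comap
        (LinearMap.ker A.d ⊓ A.gr j).subtype).mkQ = 0 := by
    ext v
    exact (Submodule.Quotient.mk_eq_zero _).2 ⟨v.1, v.2, (hlift v).symm⟩
  have : Epi (ModuleCat.ofHom (((A.gr (j - 1)).map A.d).comap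
        (LinearMap.ker A.d ⊓ A.gr j).subtype).mkQ) :=
    (ModuleCat.epi_iff_surjective _).2 (Submodule.mkQ_surjective _)
  have hex' : (ShortComplex.mk _ _ wπ).Exact := by
    rw [ShortComplex.moduleCat_exact_iff]
    intro v hv
    obtain ⟨w, hw, hwv⟩ := (Submodule.Quotient.mk_eq_zero _).1 hv
    exact ⟨⟨w, hw⟩, Subtype.ext ((hlift ⟨w, hw⟩).trans hwv)⟩
  exact
  { K := ModuleCat.of k ↥(LinearMap.ker A.d ⊓ A.gr j)
    H := ModuleCat.of k (A.H j)
    i := ModuleCat.ofHom (A.cyc j)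
    π := ModuleCat.ofHom (((A.gr (j - 1)).map A.d).comap
        (LinearMap.ker A.d ⊓ A.gr j).subtype).mkQ
    wi := wi
    hi := hi
    wπ := wπ
    hπ := hex'.gIsCokernel }

/-- The cohomology agrees with the homology of the associated complex. -/
def homologyIso (A : GradedComplex k) (j : ℤ) :
    A.toComplex.homology j ≅ ModuleCat.of k (A.H j) :=
  (ShortComplex.homologyMapIso ((HomologicalComplex.natIsoSc' _ _ (j - 1) j (j + 1)
    (by simp) (by simp)).app A.toComplex)) ≪≫ (A.homologyData j).homologyIso

/-- The map on cocycles. -/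
def Map.cyc {A B : GradedComplex k} (φ : Map A B) (j : ℤ) :
    ↥(LinearMap.ker A.d ⊓ A.gr j) →ₗ[k] ↥(LinearMap.ker B.d ⊓ B.gr j) :=
  φ.f.restrict (fun x hx => ⟨by
    have h := φ.map_d x
    rw [LinearMap.mem_ker.1 hx.1, map_zero] at h
    exact LinearMap.mem_ker.2 h.symm, φ.map_mem j x hx.2⟩)

/-- The map on cohomology. -/
def Map.H {A B : GradedComplex k} (φ : Map A B) (j : ℤ) : A.H j →ₗ[k] B.H j :=
  Submodule.mapQ _ _ (φ.cyc j) (by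
    rintro ⟨x, hx⟩ ⟨y, hy, hyx⟩
    refine ⟨φ.f y, φ.map_mem _ y hy, ?_⟩
    change A.d y = x at hyx
    subst hyx
    exact (φ.map_d y).symm)

/-- The left homology data of `homologyData` are functorial through the map on cocycles, so the
elementwise map on cohomology computes the abstract one. This makes the five lemma for cochain
complexes available. -/
theorem Map.quasiIsoAt_iff {A B : GradedComplex k} (φ : Map A B) (j : ℤ) :
    QuasiIsoAt φ.toHom j ↔ Function.Bijective (φ.H j) := by
  rw [quasiIsoAt_iff' φ.toHom (j - 1) j (j + 1) (by simp) (by simp)]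
  let Φ := (HomologicalComplex.shortComplexFunctor' (ModuleCat.{u} k) (ComplexShape.up ℤ)
    (j - 1) j (j + 1)).map φ.toHom
  let c : (A.homologyData j).K ⟶ (B.homologyData j).K := ModuleCat.ofHom (φ.cyc j)
  have hc : c ≫ (B.homologyData j).i = (A.homologyData j).i ≫ Φ.τ₂ := rfl
  have hc' : (A.homologyData j).f' ≫ c = Φ.τ₁ ≫ (B.homologyData j).f' := by
    rw [← cancel_mono (B.homologyData j).i, Category.assoc, hc, Category.assoc,
      ShortComplex.LeftHomologyData.f'_i, ShortComplex.LeftHomologyData.f'_i_assoc]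
    exact Φ.comm₁₂.symm
  let γ : ShortComplex.LeftHomologyMapData Φ (A.homologyData j) (B.homologyData j) :=
    { φK := c
      φH := ModuleCat.ofHom (φ.H j)
      commi := hc
      commf' := hc'
      commπ := rfl }
  rw [γ.quasiIso_iff]
  exact (ConcreteCategory.isIso_iff_bijective (ModuleCat.ofHom (φ.H j)))

/-- A short exact sequence, exact in each degree. -/
structure IsShortExact {A B C : GradedComplex k} (φ : Map A B) (ψ : Map B C) : Prop where
  inj : Function.Injective φ.f
  zero : ∀ v, ψ.f (φ.f v) = 0
  exact : ∀ j, ∀ b ∈ B.gr j, ψ.f b = 0 → ∃ a ∈ A.gr j, φ.f a = b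
  surj : ∀ j, ∀ c ∈ C.gr j, ∃ b ∈ B.gr j, ψ.f b = c

namespace IsShortExact

variable {A B C : GradedComplex k} {φ : Map A B} {ψ : Map B C} (h : IsShortExact φ ψ)

include h

theorem comp_eq_zero : φ.toHom ≫ ψ.toHom = 0 := by
  ext i v
  exact Subtype.ext (h.zero v.1)

/-- The associated short complex of cochain complexes. -/
abbrev shortComplex : ShortComplex (CochainComplex (ModuleCat.{u} k) ℤ) :=
  ShortComplex.mk φ.toHom ψ.toHom h.comp_eq_zero

theorem shortExact : h.shortComplex.ShortExact := by
  refine HomologicalComplex.shortExact_of_degreewise_shortExact _ fun i => ?_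
  refine { exact := ?_, mono_f := ?_, epi_g := ?_ }
  · rw [ShortComplex.moduleCat_exact_iff]
    intro v hv
    obtain ⟨a, ha, hav⟩ := h.exact i v.1 v.2 (congrArg Subtype.val hv)
    exact ⟨⟨a, ha⟩, Subtype.ext hav⟩
  · refine (ModuleCat.mono_iff_injective _).2 fun v w hvw => Subtype.ext (h.inj ?_)
    exact congrArg Subtype.val hvw
  · refine (ModuleCat.epi_iff_surjective _).2 fun v => ?_
    obtain ⟨b, hb, hbv⟩ := h.surj i v.1 v.2
    exact ⟨⟨b, hb⟩, Subtype.ext hbv⟩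

end IsShortExact

theorem finite_iff (A : GradedComplex k) (j : ℤ) :
    Module.Finite k (A.H j) ↔ Module.Finite k (A.toComplex.homology j) :=
  (Module.Finite.equiv_iff (A.homologyIso j).toLinearEquiv).symm

theorem nontrivial_iff (A : GradedComplex k) (j : ℤ) :
    Nontrivial (A.H j) ↔ Nontrivial (A.toComplex.homology j) :=
  (A.homologyIso j).toLinearEquiv.symm.toEquiv.nontrivial_congr

/-- The middle term is an extension of a subspace of the third by a quotient of the first. -/
theorem finite_of_exact {S : ShortComplex (ModuleCat.{u} k)} (hS : S.Exact)
    (h₁ : Module.Finite k S.X₁) (h₃ : Module.Finite k S.X₃) : Module.Finite k S.X₂ := by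
  have h := hS.moduleCat_range_eq_ker
  refine ⟨Submodule.fg_of_fg_map_of_fg_inf_ker S.g.hom ?_ ?_⟩
  · exact IsNoetherian.noetherian _
  · rw [top_inf_eq, ← h, LinearMap.range_eq_map]
    exact Submodule.FG.map _ h₁.1

theorem nontrivial_of_exact {S : ShortComplex (ModuleCat.{u} k)} (hS : S.Exact)
    (h : Nontrivial S.X₂) : Nontrivial S.X₁ ∨ Nontrivial S.X₃ := by
  by_contra! hc
  rw [← not_subsingleton_iff_nontrivial] at h
  have h1 := hc.1
  have h3 := hc.2
  refine h ⟨fun x y => ?_⟩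
  have key (x : S.X₂) : x = 0 := by
    obtain ⟨a, rfl⟩ := (ShortComplex.moduleCat_exact_iff S).1 hS x (Subsingleton.elim _ _)
    rw [Subsingleton.elim a 0, map_zero]
  rw [key x, key y]

namespace IsShortExact

variable {A B C : GradedComplex k} {φ : Map A B} {ψ : Map B C} (h : IsShortExact φ ψ)

include h

theorem nontrivial_middle {j : ℤ} (hB : Nontrivial (B.H j)) :
    Nontrivial (A.H j) ∨ Nontrivial (C.H j) := by
  rw [nontrivial_iff] at *
  exact (nontrivial_of_exact (h.shortExact.homology_exact₂ j) hB).imp_right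
    (nontrivial_iff C j).2

theorem nontrivial_right {j i : ℤ} (hij : j + 1 = i) (hC : Nontrivial (C.H j)) :
    Nontrivial (B.H j) ∨ Nontrivial (A.H i) := by
  rw [nontrivial_iff] at *
  exact (nontrivial_of_exact (h.shortExact.homology_exact₃ j i hij) hC).imp_right
    (nontrivial_iff A i).2

theorem nontrivial_left {j i : ℤ} (hij : j + 1 = i) (hA : Nontrivial (A.H i)) :
    Nontrivial (C.H j) ∨ Nontrivial (B.H i) := by
  rw [nontrivial_iff] at *
  exact (nontrivial_of_exact (h.shortExact.homology_exact₁ j i hij) hA).imp_right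
    (nontrivial_iff B i).2

theorem finite_middle {j : ℤ} (hA : Module.Finite k (A.H j)) (hC : Module.Finite k (C.H j)) :
    Module.Finite k (B.H j) := by
  rw [finite_iff] at *
  exact finite_of_exact (h.shortExact.homology_exact₂ j) hA hC

theorem finite_right {j i : ℤ} (hij : j + 1 = i) (hB : Module.Finite k (B.H j))
    (hA : Module.Finite k (A.H i)) : Module.Finite k (C.H j) := by
  rw [finite_iff] at *
  exact finite_of_exact (h.shortExact.homology_exact₃ j i hij) hB hA

theorem finite_left {j i : ℤ} (hij : j + 1 = i) (hC : Module.Finite k (C.H j))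
    (hB : Module.Finite k (B.H i)) : Module.Finite k (A.H i) := by
  rw [finite_iff] at *
  exact finite_of_exact (h.shortExact.homology_exact₁ j i hij) hC hB

/-- The five lemma for a morphism of short exact sequences. -/
theorem bijective_right {A' B' C' : GradedComplex k} {φ' : Map A' B'} {ψ' : Map B' C'}
    (h' : IsShortExact φ' ψ') (a : Map A A') (b : Map B B') (c : Map C C')
    (hab : ∀ v, b.f (φ.f v) = φ'.f (a.f v)) (hbc : ∀ v, c.f (ψ.f v) = ψ'.f (b.f v))
    (ha : ∀ j, Function.Bijective (a.H j)) (hb : ∀ j, Function.Bijective (b.H j)) (j : ℤ) :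
    Function.Bijective (c.H j) := by
  let Φ : h.shortComplex ⟶ h'.shortComplex :=
    { τ₁ := a.toHom
      τ₂ := b.toHom
      τ₃ := c.toHom
      comm₁₂ := by
        ext i v
        exact Subtype.ext (hab v.1).symm
      comm₂₃ := by
        ext i v
        exact Subtype.ext (hbc v.1).symm }
  have h1 : QuasiIso Φ.τ₁ := ⟨fun i => (a.quasiIsoAt_iff i).2 (ha i)⟩
  have h2 : QuasiIso Φ.τ₂ := ⟨fun i => (b.quasiIsoAt_iff i).2 (hb i)⟩
  have h3 := HomologicalComplex.HomologySequence.quasiIso_τ₃ Φ h.shortExact h'.shortExact h1 h2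
  exact (c.quasiIsoAt_iff j).1 (h3.quasiIsoAt j)

end IsShortExact

end GradedComplex

namespace DGMod

variable {k R : Type u} [Field k] [Ring R] [Algebra k R] [DGAlgebra k R]

/-! ### Short exact sequences of DG modules -/

/-- The graded vector space with a differential which underlies a DG module. -/
abbrev toGradedComplex (M : DGMod k R) : GradedComplex k where
  V := M
  gr := M.gr
  d := M.d
  d_mem := M.d_mem
  d_d := M.d_d

/-- The map underlying a morphism of DG modules. -/
abbrev toMap {M N : DGMod k R} (f : M ⟶ N) :
    GradedComplex.Map M.toGradedComplex N.toGradedComplex where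
  f := (lin f).restrictScalars k
  map_mem _ _ h := lin_mem f h
  map_d := lin_d f

/-- A short exact sequence of DG modules. -/
structure IsShortExact {A B C : DGMod k R} (f : A ⟶ B) (g : B ⟶ C) : Prop where
  inj : Function.Injective (lin f)
  exact : Function.Exact (lin f) (lin g)
  surj : Function.Surjective (lin g)

/-- A lift of a homogeneous element need not be homogeneous, but its projection to the right degree
is again a lift, as morphisms commute with `proj`. -/
theorem IsShortExact.toGraded {A B C : DGMod k R} {f : A ⟶ B} {g : B ⟶ C}
    (h : IsShortExact f g) : GradedComplex.IsShortExact (toMap f) (toMap g) where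
  inj := h.inj
  zero v := (h.exact _).2 ⟨v, rfl⟩
  exact j b hb hgb := by
    obtain ⟨a, rfl⟩ := (h.exact b).1 hgb
    refine ⟨A.proj j a, proj_mem j a, ?_⟩
    change lin f (A.proj j a) = lin f a
    rw [← proj_lin, proj_of_mem hb]
  surj j c hc := by
    obtain ⟨b, rfl⟩ := h.surj c
    refine ⟨B.proj j b, proj_mem j b, ?_⟩
    change lin g (B.proj j b) = lin g b
    rw [← proj_lin, proj_of_mem hc]

theorem quasiIso_right {A B C A' B' C' : DGMod k R} {f : A ⟶ B} {g : B ⟶ C} {f' : A' ⟶ B'}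
    {g' : B' ⟶ C'} (h : IsShortExact f g) (h' : IsShortExact f' g') (a : A ⟶ A') (b : B ⟶ B')
    (c : C ⟶ C') (hab : f ≫ b = a ≫ f') (hbc : g ≫ c = b ≫ g') (ha : quasiIso k R a)
    (hb : quasiIso k R b) : quasiIso k R c := fun j =>
  h.toGraded.bijective_right h'.toGraded (toMap a) (toMap b) (toMap c)
    (fun v => congrArg (fun φ => lin φ v) hab) (fun v => congrArg (fun φ => lin φ v) hbc) ha hb j

theorem exists_sum_proj {M : DGMod k R} (m : M) : ∃ s : Finset ℤ, ∑ n ∈ s, M.proj n m = m := by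
  classical
  refine ⟨(M.decomp.symm m).support, eq_of_proj_eq fun j => ?_⟩
  rw [map_sum]
  by_cases hj : j ∈ (M.decomp.symm m).support
  · rw [Finset.sum_eq_single_of_mem j hj, proj_proj]
    intro i _ hi
    exact proj_of_mem_ne (proj_mem i m) hi
  · have : M.proj j m = 0 := by
      change (M.decomp.symm m j).1 = 0
      rw [DFinsupp.notMem_support_iff.1 hj]
      rfl
    rw [this]
    refine Finset.sum_eq_zero fun i hi => proj_of_mem_ne (proj_mem i m) ?_
    rintro rfl
    exact hj hi

/-! ### The zero DG module -/

variable (k R) in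
/-- The zero DG module. -/
abbrev zero : DGMod k R where
  carrier := PUnit
  gr _ := ⊤
  isInternal := isInternal_of_proj _ (fun _ => 0) (fun _ _ _ => rfl) (fun _ _ _ _ _ => rfl)
    (by simp)
  smul_mem _ _ _ _ _ _ := trivial
  d := 0
  d_mem _ _ _ := trivial
  d_d _ := rfl
  leibniz _ _ _ _ := rfl

instance : Subsingleton (zero k R) := inferInstanceAs (Subsingleton PUnit)

/-- The morphism from the zero DG module. -/
def fromZero (M : DGMod k R) : zero k R ⟶ M where
  toLin := 0
  map_mem _ _ _ := Submodule.zero_mem _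
  map_d _ := by simp

/-! ### DG submodules and quotients -/

section Sub

variable (M : DGMod k R) (N : Submodule R M) (hp : ∀ n, ∀ x ∈ N, M.proj n x ∈ N)
  (hd : ∀ x ∈ N, M.d x ∈ N)

/-- The DG module given by a homogeneous submodule which is stable under the differential. -/
abbrev sub : DGMod k R where
  carrier := N
  gr n := (M.gr n).comap (N.subtype.restrictScalars k)
  isInternal := by
    refine isInternal_of_proj _
      (fun n => { toFun := fun x => ⟨M.proj n x, hp n x x.2⟩
                  map_add' := fun x y => Subtype.ext (map_add _ _ _)
                  map_smul' := fun c x => Subtype.ext (map_smul _ _ _) }) ?_ ?_ ?_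
    · exact fun i x hx => Subtype.ext (proj_of_mem hx)
    · exact fun i j hij x hx => Subtype.ext (proj_of_mem_ne hx hij)
    · rw [Submodule.eq_top_iff']
      intro x
      obtain ⟨s, hs⟩ := exists_sum_proj (M := M) x
      have : x = ∑ n ∈ s, (⟨M.proj n x, hp n x x.2⟩ : N) := Subtype.ext (by simp [hs])
      rw [this]
      exact Submodule.sum_mem _ fun n _ => Submodule.mem_iSup_of_mem n (proj_mem n x.1)
  smul_mem i j r m hr hm := M.smul_mem i j r m hr hm
  d := { toFun := fun x => ⟨M.d x, hd x x.2⟩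
         map_add' := fun x y => Subtype.ext (map_add _ _ _)
         map_smul' := fun c x => Subtype.ext (map_smul _ _ _) }
  d_mem i m hm := M.d_mem i m hm
  d_d m := Subtype.ext (M.d_d m)
  leibniz i r m hr := Subtype.ext <| (M.leibniz i r m hr).trans <| by
    simp [Units.smul_def]

/-- The inclusion of a DG submodule. -/
def subInc : M.sub N hp hd ⟶ M where
  toLin := N.subtype
  map_mem _ _ h := h
  map_d _ := rfl

/-- The quotient by a homogeneous submodule which is stable under the differential. -/
abbrev quot : DGMod k R where
  carrier := M ⧸ N
  gr n := (M.gr n).map (N.mkQ.restrictScalars k)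
  isInternal := by
    refine isInternal_of_proj _
      (fun n => (N.restrictScalars k).mapQ (N.restrictScalars k) (M.proj n)
        (fun x hx => hp n x hx)) ?_ ?_ ?_
    · rintro i _ ⟨x, hx, rfl⟩
      exact congrArg (Submodule.Quotient.mk (p := N)) (proj_of_mem hx)
    · rintro i j hij _ ⟨x, hx, rfl⟩
      exact (congrArg (Submodule.Quotient.mk (p := N)) (proj_of_mem_ne hx hij)).trans rfl
    · rw [← Submodule.map_iSup, M.iSup_gr, Submodule.map_top, LinearMap.range_eq_top]
      exact N.mkQ_surjective
  smul_mem i j r m hr hm := by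
    obtain ⟨x, hx, rfl⟩ := hm
    exact ⟨r • x, M.smul_mem i j r x hr hx, rfl⟩
  d := (N.restrictScalars k).mapQ (N.restrictScalars k) M.d (fun x hx => hd x hx)
  d_mem i m hm := by
    obtain ⟨x, hx, rfl⟩ := hm
    exact ⟨M.d x, M.d_mem i x hx, rfl⟩
  d_d m := by
    obtain ⟨x, rfl⟩ := N.mkQ_surjective m
    exact congrArg (Submodule.Quotient.mk (p := N)) (M.d_d x)
  leibniz i r m hr := by
    obtain ⟨x, rfl⟩ := N.mkQ_surjective m
    exact congrArg (Submodule.Quotient.mk (p := N)) (M.leibniz i r x hr)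

/-- The projection to a quotient. -/
def quotProj : M ⟶ M.quot N hp hd where
  toLin := N.mkQ
  map_mem _ x h := ⟨x, h, rfl⟩
  map_d _ := rfl

theorem subQuot_exact : IsShortExact (M.subInc N hp hd) (M.quotProj N hp hd) where
  inj := N.injective_subtype
  exact := LinearMap.exact_subtype_mkQ N
  surj := N.mkQ_surjective

end Sub

/-! ### The mapping cone -/

section Cone

variable {X Y : DGMod k R} (q : X ⟶ Y)

/-- The mapping cone. -/
abbrev cone : DGMod k R where
  carrier := X × Y
  gr n := (X.gr (n + 1)).prod (Y.gr n)
  isInternal := by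
    refine isInternal_of_proj _ (fun n => (X.proj (n + 1)).prodMap (Y.proj n)) ?_ ?_ ?_
    · rintro i ⟨x, y⟩ ⟨hx, hy⟩
      exact Prod.ext (proj_of_mem hx) (proj_of_mem hy)
    · rintro i j hij ⟨x, y⟩ ⟨hx, hy⟩
      exact Prod.ext (proj_of_mem_ne hx (by omega)) (proj_of_mem_ne hy hij)
    · rw [Submodule.eq_top_iff']
      rintro ⟨x, y⟩
      have hx : (x, (0 : Y)) ∈ ⨆ n, (X.gr (n + 1)).prod (Y.gr n) :=
        mem_of_homogeneous (Submodule.comap (LinearMap.inl k X Y)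
          (⨆ n, (X.gr (n + 1)).prod (Y.gr n))) (fun n m hm =>
            Submodule.mem_iSup_of_mem (n - 1)
              ⟨by rw [sub_add_cancel]; exact hm, Submodule.zero_mem _⟩) x
      have hy : ((0 : X), y) ∈ ⨆ n, (X.gr (n + 1)).prod (Y.gr n) :=
        mem_of_homogeneous (Submodule.comap (LinearMap.inr k X Y)
          (⨆ n, (X.gr (n + 1)).prod (Y.gr n))) (fun n m hm =>
            Submodule.mem_iSup_of_mem n ⟨Submodule.zero_mem _, hm⟩) y
      have := Submodule.add_mem _ hx hy
      simpa using this
  smul_mem i j r m hr hm :=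
    ⟨by rw [add_assoc]; exact X.smul_mem _ _ r _ hr hm.1, Y.smul_mem _ _ r _ hr hm.2⟩
  d := (X.d ∘ₗ LinearMap.fst k X Y).prod
    (((lin q).restrictScalars k ∘ₗ X.sgn).coprod Y.d)
  d_mem i m hm := ⟨X.d_mem _ _ hm.1, Submodule.add_mem _
    (lin_mem q (sgn_mem hm.1)) (Y.d_mem _ _ hm.2)⟩
  d_d m := by
    refine Prod.ext (X.d_d m.1) ?_
    change lin q (X.sgn (X.d m.1)) + Y.d (lin q (X.sgn m.1) + Y.d m.2) = 0
    rw [map_add, Y.d_d, ← lin_d, d_sgn]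
    simp
  leibniz i r m hr := by
    refine Prod.ext (X.leibniz i r m.1 hr) ?_
    change lin q (X.sgn (r • m.1)) + Y.d (r • m.2) = DGAlgebra.d (k := k) r • m.2 +
      i.negOnePow • (r • (lin q (X.sgn m.1) + Y.d m.2))
    rw [sgn_smul, map_smul, Y.leibniz i r m.2 hr, sg, sgn_of_mem (M := self k R) hr, smul_add]
    simp only [Units.smul_def, smul_assoc, smul_add]
    abel

theorem cone_d (x : X) (y : Y) :
    (cone q).d ((x, y) : X × Y) = ((X.d x, lin q (X.sgn x) + Y.d y) : X × Y) := rfl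

theorem mem_cone_gr {n : ℤ} {x : X} {y : Y} :
    ((x, y) : X × Y) ∈ (cone q).gr n ↔ x ∈ X.gr (n + 1) ∧ y ∈ Y.gr n := Iff.rfl

/-- The inclusion of the target into the mapping cone. -/
def coneInr : Y ⟶ cone q where
  toLin := LinearMap.inr R X Y
  map_mem _ _ h := ⟨Submodule.zero_mem _, h⟩
  map_d y := by
    refine Prod.ext ?_ ?_
    · exact (map_zero X.d).symm
    · change Y.d y = lin q (X.sgn 0) + Y.d y
      simp

/-- The projection of the mapping cone to the suspension of the source. -/
def coneFst : cone q ⟶ X.shift 1 where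
  toLin := LinearMap.fst R X Y
  map_mem _ _ h := h.1
  map_d _ := rfl

theorem cone_exact : IsShortExact (coneInr q) (coneFst q) where
  inj := LinearMap.inr_injective
  exact := Function.Exact.inr_fst
  surj := LinearMap.fst_surjective

/-- The mapping cone of a quasi-isomorphism is acyclic. -/
theorem cone_acyclic (hq : quasiIso k R q) {i j : ℤ} (hij : i + 1 = j) (z : cone q)
    (hz : z ∈ (cone q).gr j) (hdz : (cone q).d z = 0) :
    ∃ w ∈ (cone q).gr i, (cone q).d w = z := by
  obtain ⟨x, y⟩ : X × Y := z
  rw [cone_d] at hdz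
  have h1 : X.d x = 0 := congrArg Prod.fst hdz
  have h2 : lin q (X.sgn x) + Y.d y = 0 := congrArg Prod.snd hdz
  obtain ⟨hx, hy⟩ := hz
  change x ∈ X.gr (j + 1) at hx
  -- The second component of the cocycle condition says that `q` sends `sgn x` to the boundary of
  -- `-y`, so `sgn x` is itself a boundary.
  obtain ⟨w, hw, hwx⟩ := (cohomologyMap_injective_iff q rfl).1 (hq (j + 1)).1 (X.sgn x)
    (sgn_mem hx) (by rw [d_sgn, h1, map_zero, neg_zero]) (-y) (Submodule.neg_mem _ hy)
    (by rw [map_neg]; exact (eq_neg_of_add_eq_zero_left h2).symm)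
  have hw' : X.d (-X.sgn w) = x := by
    rw [map_neg, d_sgn, neg_neg, hwx, sgn_sgn]
  -- Now `y + q w` is a cocycle of `Y`. Up to a boundary it comes from a cocycle `v` of `X`, which
  -- is used to correct the first component.
  obtain ⟨v, hv, hdv, u, hu, hduv⟩ := (cohomologyMap_surjective_iff q hij).1 (hq j).2
    (y + lin q w) (Submodule.add_mem _ hy (lin_mem q hw)) (by
      rw [map_add, ← lin_d, hwx, add_comm]
      exact h2)
  refine ⟨((-X.sgn w + X.sgn v, -u) : X × Y), ?_, ?_⟩
  · rw [mem_cone_gr, hij]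
    exact ⟨Submodule.add_mem _ (Submodule.neg_mem _ (sgn_mem hw)) (sgn_mem hv),
      Submodule.neg_mem _ hu⟩
  · rw [cone_d]
    refine Prod.ext ?_ ?_
    · change X.d (-X.sgn w + X.sgn v) = x
      rw [map_add, hw', d_sgn, hdv, map_zero, neg_zero, add_zero]
    · change lin q (X.sgn (-X.sgn w + X.sgn v)) + Y.d (-u) = y
      rw [map_add, map_neg, sgn_sgn, sgn_sgn, map_neg, hduv, map_add, map_neg]
      abel

end Cone

/-! ### Adjoining free generators -/

section Twist

variable (X : DGMod k R) {G : Type u} (deg : G → ℤ) (bd : G → X × (G →₀ R))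

/-- The grading of `X ⊕ ⨁ R e_g`. -/
def twistGr (n : ℤ) : Submodule k (X × (G →₀ R)) where
  carrier := {p | p.1 ∈ X.gr n ∧ ∀ g, p.2 g ∈ DGAlgebra.gr (k := k) (n - deg g)}
  add_mem' hp hq := ⟨Submodule.add_mem _ hp.1 hq.1, fun g => Submodule.add_mem _ (hp.2 g) (hq.2 g)⟩
  zero_mem' := ⟨Submodule.zero_mem _, fun _ => Submodule.zero_mem _⟩
  smul_mem' c _ hp := ⟨Submodule.smul_mem _ c hp.1, fun g => Submodule.smul_mem _ c (hp.2 g)⟩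

/-- The differential of `X ⊕ ⨁ R e_g` with `d e_g = bd g`. -/
def twistD : (X × (G →₀ R)) →ₗ[k] (X × (G →₀ R)) :=
  X.d.prodMap (Finsupp.mapRange.linearMap (DGAlgebra.d (k := k) (R := R))) +
    (Finsupp.linearCombination R bd).restrictScalars k ∘ₗ
      Finsupp.mapRange.linearMap (sg k) ∘ₗ LinearMap.snd k X (G →₀ R)

theorem twistD_inl (x : X) : twistD X bd (x, 0) = (X.d x, 0) := by
  simp [twistD]

theorem twistD_single (g : G) (r : R) : twistD X bd (0, Finsupp.single g r) =
    (0, Finsupp.single g (DGAlgebra.d (k := k) r)) + sg k r • bd g := by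
  simp [twistD]

theorem single_mem_twistGr {g : G} {a n : ℤ} {r : R} (hr : r ∈ DGAlgebra.gr (k := k) a)
    (h : a + deg g = n) : (0, Finsupp.single g r) ∈ twistGr X deg n := by
  classical
  refine ⟨Submodule.zero_mem _, fun g' => ?_⟩
  obtain rfl : a = n - deg g := by omega
  change Finsupp.single g r g' ∈ _
  rw [Finsupp.single_apply]
  split_ifs with hg
  · exact hg ▸ hr
  · exact Submodule.zero_mem _

theorem twist_mem_of_single {S : Submodule k (X × (G →₀ R))}
    (h1 : ∀ n, ∀ x ∈ X.gr n, (x, 0) ∈ S)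
    (h2 : ∀ g, ∀ a, ∀ r ∈ DGAlgebra.gr (k := k) (R := R) a, (0, Finsupp.single g r) ∈ S)
    (p : X × (G →₀ R)) : p ∈ S := by
  obtain ⟨x, c⟩ := p
  have hx : (x, (0 : G →₀ R)) ∈ S :=
    mem_of_homogeneous (S.comap (LinearMap.inl k X (G →₀ R))) h1 x
  have hc : ((0 : X), c) ∈ S := by
    induction c using Finsupp.induction_linear with
    | zero => exact S.zero_mem
    | add c c' hc hc' => simpa using S.add_mem hc hc'
    | single g r =>
      exact smul_decomp_induction (k := k) (P := fun r => ((0 : X), Finsupp.single g r) ∈ S)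
        (fun r s hr hs => by simpa using S.add_mem hr hs) (h2 g) r
  simpa using S.add_mem hx hc

theorem twist_linearMap_ext {V : Type*} [AddCommGroup V] [Module k V]
    {f f' : (X × (G →₀ R)) →ₗ[k] V} (h1 : ∀ x, f (x, 0) = f' (x, 0))
    (h2 : ∀ g, ∀ a, ∀ r ∈ DGAlgebra.gr (k := k) (R := R) a,
      f (0, Finsupp.single g r) = f' (0, Finsupp.single g r)) : f = f' :=
  LinearMap.ext (twist_mem_of_single X (S := LinearMap.eqLocus f f') (fun _ x _ => h1 x) h2)

theorem twistGr_smul_mem {i j : ℤ} {r : R} {p : X × (G →₀ R)}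
    (hr : r ∈ DGAlgebra.gr (k := k) i) (hp : p ∈ twistGr X deg j) :
    r • p ∈ twistGr X deg (i + j) :=
  ⟨X.smul_mem i j r _ hr hp.1, fun g => by
    rw [add_sub_assoc]; exact (self k R).smul_mem _ _ r _ hr (hp.2 g)⟩

theorem twist_isInternal : DirectSum.IsInternal (twistGr (k := k) X deg) := by
  classical
  let P (n : ℤ) : (G →₀ R) →ₗ[k] (G →₀ R) :=
    Finsupp.lsum k fun g => Finsupp.lsingle g ∘ₗ (self k R).proj (n - deg g)
  have hP (n : ℤ) (c : G →₀ R) (g : G) : P n c g = (self k R).proj (n - deg g) (c g) := by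
    induction c using Finsupp.induction_linear with
    | zero => simp
    | add c c' hc hc' => simp [hc, hc']
    | single g' r =>
      by_cases h : g' = g
      · subst h; simp [P]
      · simp [P, h]
  refine isInternal_of_proj _ (fun n => (X.proj n).prodMap (P n)) ?_ ?_ ?_
  · rintro n ⟨x, c⟩ ⟨hx, hc⟩
    refine Prod.ext (proj_of_mem hx) (Finsupp.ext fun g => ?_)
    exact (hP n c g).trans (proj_of_mem (M := self k R) (hc g))
  · rintro n j hij ⟨x, c⟩ ⟨hx, hc⟩
    refine Prod.ext (proj_of_mem_ne hx hij) (Finsupp.ext fun g => ?_)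
    exact (hP j c g).trans (proj_of_mem_ne (M := self k R) (hc g) (by omega))
  · rw [Submodule.eq_top_iff']
    refine twist_mem_of_single X (fun n x hx => ?_) fun g a r hr => ?_
    · exact Submodule.mem_iSup_of_mem n ⟨hx, fun _ => Submodule.zero_mem _⟩
    · exact Submodule.mem_iSup_of_mem (a + deg g) (single_mem_twistGr X deg hr rfl)

variable (h1 : ∀ g, bd g ∈ twistGr X deg (deg g + 1)) (h2 : ∀ g, twistD X bd (bd g) = 0)

include h1 in
theorem twistD_mem (n : ℤ) (p : X × (G →₀ R)) (hp : p ∈ twistGr X deg n) :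
    twistD X bd p ∈ twistGr X deg (n + 1) := by
  obtain ⟨x, c⟩ := p
  refine Submodule.add_mem _ ⟨X.d_mem n x hp.1, fun g => ?_⟩ ?_
  · have := DGAlgebra.d_mem _ _ (hp.2 g)
    rw [sub_add_eq_add_sub] at this
    exact this
  · change Finsupp.linearCombination R bd (Finsupp.mapRange.linearMap (sg k) c) ∈ _
    rw [Finsupp.linearCombination_apply, Finsupp.sum]
    refine Submodule.sum_mem _ fun g _ => ?_
    have := twistGr_smul_mem X deg (sgn_mem (M := self k R) (hp.2 g)) (h1 g)
    rw [show n - deg g + (deg g + 1) = n + 1 by ring] at this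
    exact this

theorem twistD_smul (r : R) (p : X × (G →₀ R)) : twistD X bd (r • p) =
    DGAlgebra.d (k := k) r • p + sg k r • twistD X bd p := by
  obtain ⟨x, c⟩ := p
  have hsg (r s : R) : sg k (r * s) = sg k r * sg k s := sgn_smul (M := self k R) r s
  have hd (r s : R) : DGAlgebra.d (k := k) (r * s) =
      DGAlgebra.d (k := k) r * s + sg k r * DGAlgebra.d (k := k) s := d_smul (M := self k R) r s
  have h1 : Finsupp.mapRange.linearMap (sg k) (r • c) =
      sg k r • Finsupp.mapRange.linearMap (sg k) c := by
    ext g; exact hsg r (c g)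
  have h2 : Finsupp.mapRange.linearMap (DGAlgebra.d (k := k)) (r • c) =
      DGAlgebra.d (k := k) r • c +
        sg k r • Finsupp.mapRange.linearMap (DGAlgebra.d (k := k)) c := by
    ext g; exact hd r (c g)
  have h3 (x : X) (c : G →₀ R) : twistD X bd (x, c) =
      (X.d x, Finsupp.mapRange.linearMap (DGAlgebra.d (k := k)) c) +
        Finsupp.linearCombination R bd (Finsupp.mapRange.linearMap (sg k) c) := rfl
  rw [Prod.smul_mk, h3, h3, h1, h2, d_smul, map_smul (Finsupp.linearCombination R bd), smul_add,
    ← add_assoc]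
  rfl

include h2 in
theorem twistD_twistD (p : X × (G →₀ R)) : twistD X bd (twistD X bd p) = 0 := by
  have : twistD X bd ∘ₗ twistD X bd = 0 := by
    refine twist_linearMap_ext X (fun x => ?_) (fun g a r hr => ?_)
    · simp only [LinearMap.comp_apply, twistD_inl, X.d_d]
      rfl
    · rw [LinearMap.comp_apply, twistD_single, map_add, twistD_single, twistD_smul, h2,
        DGAlgebra.d_d, d_sgn (M := self k R) r]
      simp only [Finsupp.single_zero, Prod.mk_zero_zero, zero_add, smul_zero, add_zero]
      have (s : R) : s • bd g + (-s) • bd g = 0 :=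
        (congrArg (s • bd g + ·) (neg_smul s (bd g))).trans (add_neg_cancel _)
      exact this _
  exact LinearMap.congr_fun this p

/-- The DG module obtained from `X` by adjoining free generators `e_g` with `d e_g = bd g`. -/
abbrev twist : DGMod k R where
  carrier := X × (G →₀ R)
  gr := twistGr X deg
  isInternal := twist_isInternal X deg
  smul_mem _ _ _ _ hr hm := twistGr_smul_mem X deg hr hm
  d := twistD X bd
  d_mem := twistD_mem X deg bd h1
  d_d := twistD_twistD X bd h2
  leibniz i r p hr := by
    rw [twistD_smul, sg, sgn_of_mem (M := self k R) hr]
    simp only [Units.smul_def, smul_assoc]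

/-- The inclusion of `X`. -/
def twistInl : X ⟶ twist X deg bd h1 h2 where
  toLin := LinearMap.inl R X (G →₀ R)
  map_mem _ _ h := ⟨h, fun _ => Submodule.zero_mem _⟩
  map_d x := (twistD_inl X bd x).symm

/-- A morphism out of `twist`. -/
def twistDesc {Y : DGMod k R} (f : X ⟶ Y) (v : G → Y) (hv : ∀ g, v g ∈ Y.gr (deg g))
    (hd : ∀ g, (lin f).coprod (Finsupp.linearCombination R v) (bd g) = Y.d (v g)) :
    twist X deg bd h1 h2 ⟶ Y where
  toLin := (lin f).coprod (Finsupp.linearCombination R v)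
  map_mem n p hp := by
    refine Submodule.add_mem _ (lin_mem f hp.1) ?_
    change Finsupp.linearCombination R v p.2 ∈ _
    rw [Finsupp.linearCombination_apply, Finsupp.sum]
    refine Submodule.sum_mem _ fun g _ => ?_
    have := Y.smul_mem _ _ _ _ (hp.2 g) (hv g)
    rwa [sub_add_cancel] at this
  map_d p := by
    let F := (lin f).coprod (Finsupp.linearCombination R v)
    have : F.restrictScalars k ∘ₗ twistD X bd = Y.d ∘ₗ F.restrictScalars k := by
      refine twist_linearMap_ext X (fun x => ?_) (fun g a r hr => ?_)
      · change F (twistD X bd (x, 0)) = Y.d (F (x, 0))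
        rw [twistD_inl]
        simp [F, lin_d]
      · change F (twistD X bd (0, Finsupp.single g r)) = Y.d (F (0, Finsupp.single g r))
        rw [twistD_single, map_add, map_smul, hd]
        simp [F, d_smul]
    exact LinearMap.congr_fun this p

/-- Semi-freeness of `twist`. -/
theorem twist_isSemifree {ι : Type u} (b : Module.Basis ι R X) (dι : ι → ℤ) (lι : ι → ℕ)
    (hb : ∀ i, b i ∈ X.gr (dι i))
    (hl : ∀ i, X.d (b i) ∈ Submodule.span R (b '' {j | lι j < lι i})) (lG : G → ℕ)
    (hbd1 : ∀ g, (bd g).1 ∈ Submodule.span R (b '' {j | lι j < lG g}))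
    (hbd2 : ∀ g g', (bd g).2 g' ≠ 0 → lG g' < lG g) :
    (twist X deg bd h1 h2).IsSemifree := by
  classical
  let B : Module.Basis (ι ⊕ G) R (X × (G →₀ R)) := b.prod Finsupp.basisSingleOne
  have hinl (n : ℕ) (x : X) (hx : x ∈ Submodule.span R (b '' {j | lι j < n})) :
      (x, 0) ∈ Submodule.span R (B '' {j | Sum.elim lι lG j < n}) := by
    have h := Submodule.mem_map_of_mem (f := LinearMap.inl R X (G →₀ R)) hx
    rw [Submodule.map_span] at h
    refine Submodule.span_mono ?_ h
    rintro _ ⟨_, ⟨i, hi, rfl⟩, rfl⟩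
    exact ⟨Sum.inl i, hi, by simp [B]⟩
  refine ⟨ι ⊕ G, B, Sum.elim dι deg, Sum.elim lι lG, ?_, ?_⟩
  · rintro (i | g)
    · have : B (Sum.inl i) = (b i, 0) := by simp [B]
      rw [this]
      exact ⟨hb i, fun _ => Submodule.zero_mem _⟩
    · have : B (Sum.inr g) = (0, Finsupp.single g 1) := by simp [B]
      rw [this]
      exact single_mem_twistGr X deg (SetLike.GradedOne.one_mem (A := DGAlgebra.gr (k := k))) (by simp)
  · rintro (i | g)
    · have : B (Sum.inl i) = (b i, 0) := by simp [B]
      rw [this, twistD_inl]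
      exact hinl _ _ (hl i)
    · have : B (Sum.inr g) = (0, Finsupp.single g 1) := by simp [B]
      have hone : (1 : R) ∈ DGAlgebra.gr (k := k) 0 :=
        SetLike.GradedOne.one_mem (A := DGAlgebra.gr (k := k))
      have hd1 : DGAlgebra.d (k := k) (1 : R) = 0 := by
        have := DGAlgebra.leibniz (k := k) 0 (1 : R) 1 hone
        simpa using this
      rw [this, twistD_single, hd1, sg, sgn_of_mem (M := self k R) hone]
      simp only [Finsupp.single_zero, Int.negOnePow_zero, one_smul, Prod.mk_zero_zero, zero_add]
      have hsplit : bd g = ((bd g).1, 0) + ∑ g' ∈ (bd g).2.support,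
          (bd g).2 g' • B (Sum.inr g') := by
        have h (g' : G) : (bd g).2 g' • B (Sum.inr g') =
            LinearMap.inr R X (G →₀ R) (Finsupp.single g' ((bd g).2 g')) := by simp [B]
        simp only [h]
        rw [← map_sum]
        change _ = _ + LinearMap.inr R X (G →₀ R) ((bd g).2.sum Finsupp.single)
        rw [Finsupp.sum_single]
        simp
      rw [hsplit]
      refine Submodule.add_mem _ (hinl _ _ (hbd1 g)) (Submodule.sum_mem _ fun g' hg' => ?_)
      exact Submodule.smul_mem _ _ (Submodule.subset_span
        ⟨Sum.inr g', hbd2 g g' (Finsupp.mem_support_iff.1 hg'), rfl⟩)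

end Twist

end DGMod

/-! ### Semi-free resolutions -/

/-- Formal cells: a cell is recorded by its degree `n`, by its boundary `x + ∑ rᵢ gᵢ`, where the
`gᵢ` are cells, and by its image `y`. -/
inductive Cell (X Y R : Type u) : Type u
  | mk (n : ℤ) (x : X) (m : ℕ) (r : Fin m → R) (g : Fin m → Cell X Y R) (y : Y) : Cell X Y R

namespace DGMod

variable {k R : Type u} [Field k] [Ring R] [Algebra k R] [DGAlgebra k R]

section Cell

variable {X Y : DGMod k R} (φ : X ⟶ Y)

/-- The degree of a cell. -/
def cellDeg : Cell X Y R → ℤ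
  | .mk n _ _ _ _ _ => n

open Classical in
/-- The boundary and the image of a cell.  They are set to zero if the recorded data are not
admissible. -/
def cellAtt : Cell X Y R → (X × (Cell X Y R →₀ R)) × Y
  | .mk n x _ r g y =>
    if y ∈ Y.gr n ∧ x ∈ X.gr (n + 1) ∧
      (∀ i, r i ∈ DGAlgebra.gr (k := k) (n + 1 - cellDeg (g i))) ∧
      (X.d x, ∑ i, Finsupp.single (g i) (DGAlgebra.d (k := k) (r i))) +
        ∑ i, sg k (r i) • (cellAtt (g i)).1 = 0 ∧
      lin φ x + ∑ i, r i • (cellAtt (g i)).2 = Y.d y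
    then ((x, ∑ i, Finsupp.single (g i) (r i)), y) else 0

/-- The boundary of a cell. -/
def cellBd (g : Cell X Y R) : X × (Cell X Y R →₀ R) := (cellAtt φ g).1

/-- The image of a cell. -/
def cellVal (g : Cell X Y R) : Y := (cellAtt φ g).2

/-- The recursion in `cellAtt` may only mention the finitely many `g i`, not the differential built
from all cells. This formula and the next one identify its conditions with "the boundary is a
cocycle" and "the image is compatible with `φ`". -/
theorem twistD_sum {G : Type u} (bd : G → X × (G →₀ R)) (x : X) {m : ℕ} (g : Fin m → G)
    (r : Fin m → R) : twistD X bd (x, ∑ i, Finsupp.single (g i) (r i)) =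
      (X.d x, ∑ i, Finsupp.single (g i) (DGAlgebra.d (k := k) (r i))) +
        ∑ i, sg k (r i) • bd (g i) := by
  simp [twistD, map_sum]

theorem coprod_sum {G : Type u} (v : G → Y) (x : X) {m : ℕ} (g : Fin m → G)
    (r : Fin m → R) : (lin φ).coprod (Finsupp.linearCombination R v)
      (x, ∑ i, Finsupp.single (g i) (r i)) = lin φ x + ∑ i, r i • v (g i) := by
  simp [map_sum]

/-- The default value is harmless: a cell with boundary 0 and image 0 satisfies every compatibility.
Hence no validity predicate on cells is needed, and the inadmissible ones just contribute free
summands. -/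
theorem cell_cases (n : ℤ) (x : X) (m : ℕ) (r : Fin m → R) (g : Fin m → Cell X Y R) (y : Y) :
    (cellBd φ (.mk n x m r g y) = 0 ∧ cellVal φ (.mk n x m r g y) = 0) ∨
    (cellBd φ (.mk n x m r g y) = (x, ∑ i, Finsupp.single (g i) (r i)) ∧
      cellVal φ (.mk n x m r g y) = y ∧ y ∈ Y.gr n ∧ x ∈ X.gr (n + 1) ∧
      (∀ i, r i ∈ DGAlgebra.gr (k := k) (n + 1 - cellDeg (g i))) ∧
      twistD X (cellBd φ) (x, ∑ i, Finsupp.single (g i) (r i)) = 0 ∧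
      (lin φ).coprod (Finsupp.linearCombination R (cellVal φ))
        (x, ∑ i, Finsupp.single (g i) (r i)) = Y.d y) := by
  simp only [twistD_sum, coprod_sum]
  unfold cellBd cellVal
  rw [cellAtt]
  split_ifs with h
  · exact Or.inr ⟨rfl, rfl, h⟩
  · exact Or.inl ⟨rfl, rfl⟩

theorem cell_valid (n : ℤ) (x : X) (m : ℕ) (r : Fin m → R) (g : Fin m → Cell X Y R) (y : Y)
    (hy : y ∈ Y.gr n) (hx : x ∈ X.gr (n + 1))
    (hr : ∀ i, r i ∈ DGAlgebra.gr (k := k) (n + 1 - cellDeg (g i)))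
    (hd : twistD X (cellBd φ) (x, ∑ i, Finsupp.single (g i) (r i)) = 0)
    (hv : (lin φ).coprod (Finsupp.linearCombination R (cellVal φ))
        (x, ∑ i, Finsupp.single (g i) (r i)) = Y.d y) :
    cellBd φ (.mk n x m r g y) = (x, ∑ i, Finsupp.single (g i) (r i)) ∧
      cellVal φ (.mk n x m r g y) = y := by
  simp only [twistD_sum, coprod_sum] at hd hv
  unfold cellBd cellVal at *
  rw [cellAtt, if_pos ⟨hy, hx, hr, hd, hv⟩]
  exact ⟨rfl, rfl⟩

theorem cellBd_mem (g : Cell X Y R) : cellBd φ g ∈ twistGr X cellDeg (cellDeg g + 1) := by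
  obtain ⟨n, x, m, r, g, y⟩ := g
  rcases cell_cases φ n x m r g y with h | h
  · rw [h.1]; exact Submodule.zero_mem _
  · rw [h.1]
    have : (x, ∑ i, Finsupp.single (g i) (r i)) = (x, (0 : Cell X Y R →₀ R)) +
        ∑ i, (0, Finsupp.single (g i) (r i)) := by
      refine Prod.ext ?_ ?_ <;> simp [Prod.fst_sum, Prod.snd_sum]
    rw [this]
    refine Submodule.add_mem _ ⟨h.2.2.2.1, fun _ => Submodule.zero_mem _⟩
      (Submodule.sum_mem _ fun i _ => ?_)
    exact single_mem_twistGr X cellDeg (h.2.2.2.2.1 i) (sub_add_cancel _ _)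

theorem twistD_cellBd (g : Cell X Y R) : twistD X (cellBd φ) (cellBd φ g) = 0 := by
  obtain ⟨n, x, m, r, g, y⟩ := g
  rcases cell_cases φ n x m r g y with h | h
  · rw [h.1, map_zero]
  · rw [h.1, h.2.2.2.2.2.1]

theorem cellVal_mem (g : Cell X Y R) : cellVal φ g ∈ Y.gr (cellDeg g) := by
  obtain ⟨n, x, m, r, g, y⟩ := g
  rcases cell_cases φ n x m r g y with h | h
  · rw [h.2]; exact Submodule.zero_mem _
  · rw [h.2.1]; exact h.2.2.1

theorem coprod_cellBd (g : Cell X Y R) :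
    (lin φ).coprod (Finsupp.linearCombination R (cellVal φ)) (cellBd φ g) =
      Y.d (cellVal φ g) := by
  obtain ⟨n, x, m, r, g, y⟩ := g
  rcases cell_cases φ n x m r g y with h | h
  · rw [h.1, h.2, map_zero, map_zero]
  · rw [h.1, h.2.1, h.2.2.2.2.2.2]

/-- The DG module obtained from `X` by adjoining all cells. -/
abbrev resolve : DGMod k R :=
  twist X cellDeg (cellBd φ) (cellBd_mem φ) (twistD_cellBd φ)

/-- The factorization of `φ` through `resolve φ`. -/
abbrev resolveMap : resolve φ ⟶ Y :=
  twistDesc X cellDeg (cellBd φ) (cellBd_mem φ) (twistD_cellBd φ) φ (cellVal φ) (cellVal_mem φ)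
    (coprod_cellBd φ)

theorem exists_eq_sum_single {G : Type u} (c : G →₀ R) :
    ∃ (m : ℕ) (g : Fin m → G), c = ∑ i, Finsupp.single (g i) (c (g i)) := by
  refine ⟨c.support.card, fun i => (c.support.equivFin.symm i : G), ?_⟩
  rw [Equiv.sum_comp c.support.equivFin.symm fun g : c.support => Finsupp.single (g : G) (c g),
    Finset.sum_coe_sort c.support fun g => Finsupp.single g (c g)]
  exact c.sum_single.symm

/-- No iteration is needed, because the type of cells is closed under attaching. A cocycle of `Y` is
the image of a cell with empty boundary. A cocycle `z` that maps to the boundary of `y` is the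
boundary of the cell that records `z` and `y`. -/
theorem resolveMap_quasiIso : quasiIso k R (resolveMap φ) := by
  refine quasiIso_of _ (fun i y hy hdy => ?_) (fun i z hz hdz y hy hyz => ?_)
  · obtain ⟨h1, h2⟩ := cell_valid φ (i + 1) 0 0 Fin.elim0 Fin.elim0 y hy (Submodule.zero_mem _)
      (fun i => i.elim0) (by
        rw [Finset.univ_eq_empty, Finset.sum_empty]; exact map_zero _) (by simp [hdy])
    refine ⟨(0, Finsupp.single (.mk (i + 1) 0 0 Fin.elim0 Fin.elim0 y) 1), ?_, ?_, 0,
      Submodule.zero_mem _, ?_⟩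
    · exact single_mem_twistGr X cellDeg
        (SetLike.GradedOne.one_mem (A := DGAlgebra.gr (k := k))) (zero_add _)
    · have hone : DGAlgebra.d (k := k) (1 : R) = 0 := by
        have := DGAlgebra.leibniz (k := k) 0 (1 : R) 1
          (SetLike.GradedOne.one_mem (A := DGAlgebra.gr (k := k)))
        simpa using this
      change twistD X (cellBd φ) _ = 0
      rw [twistD_single, h1, hone]
      simp
    · change Y.d 0 = (lin φ).coprod (Finsupp.linearCombination R (cellVal φ)) _ - y
      simp [h2]
  · obtain ⟨x, c⟩ := z
    obtain ⟨m, g, hc⟩ := exists_eq_sum_single c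
    obtain ⟨h1, h2⟩ := cell_valid φ i x m (fun i => c (g i)) g y hy hz.1 (fun j => hz.2 (g j))
      (by rw [← hc]; exact hdz) (by rw [← hc]; exact hyz.symm)
    have hone : (1 : R) ∈ DGAlgebra.gr (k := k) 0 :=
      SetLike.GradedOne.one_mem (A := DGAlgebra.gr (k := k))
    refine ⟨(0, Finsupp.single (.mk i x m (fun i => c (g i)) g y) 1), ?_, ?_⟩
    · exact single_mem_twistGr X cellDeg hone (zero_add _)
    · have hd1 : DGAlgebra.d (k := k) (1 : R) = 0 := by
        have := DGAlgebra.leibniz (k := k) 0 (1 : R) 1 hone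
        simpa using this
      change twistD X (cellBd φ) _ = _
      rw [twistD_single, h1, ← hc, hd1, sg, sgn_of_mem (M := self k R) hone]
      simp

/-- The level of a cell, given a level on `X`. -/
def cellLvl (ℓ : X → ℕ) : Cell X Y R → ℕ
  | .mk _ x _ _ g _ => ℓ x ⊔ Finset.univ.sup fun i => cellLvl ℓ (g i) + 1

/-- A boundary involves finitely many basis elements of `X` and finitely many cells, each of which
is a subterm, so recursion over the cell gives a finite level above all of them. -/
theorem resolve_isSemifree_of_basis {ι : Type u} (b : Module.Basis ι R X) (dι : ι → ℤ)
    (lι : ι → ℕ) (hb : ∀ i, b i ∈ X.gr (dι i))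
    (hl : ∀ i, X.d (b i) ∈ Submodule.span R (b '' {j | lι j < lι i})) :
    ∃ lG : Cell X Y R → ℕ, (∀ g g', (cellBd φ g).2 g' ≠ 0 → lG g' < lG g) ∧
      (resolve φ).IsSemifree := by
  classical
  -- One more than the highest level among the basis elements that occur in `x`.
  let ℓ (x : X) : ℕ := (b.repr x).support.sup fun i => lι i + 1
  have hℓ (x : X) : x ∈ Submodule.span R (b '' {j | lι j < ℓ x}) := by
    rw [Module.Basis.mem_span_image]
    intro i hi
    exact Nat.lt_of_succ_le (Finset.le_sup (f := fun i => lι i + 1) hi)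
  have h2 (g g' : Cell X Y R) (hg : (cellBd φ g).2 g' ≠ 0) : cellLvl ℓ g' < cellLvl ℓ g := by
    obtain ⟨n, x, m, r, g, y⟩ := g
    rcases cell_cases φ n x m r g y with h | h
    · rw [h.1] at hg; exact absurd rfl hg
    · rw [h.1] at hg
      simp only [Finsupp.coe_finsetSum, Finset.sum_apply] at hg
      obtain ⟨i, -, hi⟩ := Finset.exists_ne_zero_of_sum_ne_zero hg
      rw [Finsupp.single_apply] at hi
      have hgi : g i = g' := by by_contra hne; exact hi (if_neg hne)
      rw [cellLvl, ← hgi]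
      exact lt_sup_of_lt_right (Nat.lt_of_succ_le
        (Finset.le_sup (f := fun i => cellLvl ℓ (g i) + 1) (Finset.mem_univ i)))
  refine ⟨cellLvl ℓ, h2, twist_isSemifree X cellDeg (cellBd φ) _ _ b dι lι hb hl (cellLvl ℓ) ?_ h2⟩
  intro g
  obtain ⟨n, x, m, r, g, y⟩ := g
  rcases cell_cases φ n x m r g y with h | h
  · rw [h.1]; exact Submodule.zero_mem _
  · have h3 : (cellBd φ (.mk n x m r g y)).1 = x := congrArg Prod.fst h.1
    have h4 : ℓ x ≤ cellLvl ℓ (.mk n x m r g y) := by rw [cellLvl]; exact le_sup_left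
    rw [h3]
    exact Submodule.span_mono (Set.image_mono fun j (hj : lι j < ℓ x) => hj.trans_le h4) (hℓ x)

theorem resolve_isSemifree (hX : X.IsSemifree) : (resolve φ).IsSemifree := by
  obtain ⟨ι, b, dι, lι, hb, hl⟩ := hX
  exact (resolve_isSemifree_of_basis φ b dι lι hb hl).choose_spec.2

/-- The DG module obtained from `resolve φ` by killing `X`. -/
theorem cofiber_bd_mem (g : Cell X Y R) :
    ((0, (cellBd φ g).2) : zero k R × (Cell X Y R →₀ R)) ∈
      twistGr (zero k R) cellDeg (cellDeg g + 1) :=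
  ⟨trivial, (cellBd_mem φ g).2⟩

theorem cofiber_map_d (p : X × (Cell X Y R →₀ R)) :
    ((0, (twistD X (cellBd φ) p).2) : zero k R × (Cell X Y R →₀ R)) =
      twistD (zero k R) (fun g => (0, (cellBd φ g).2)) (0, p.2) := by
  let F : (X × (Cell X Y R →₀ R)) →ₗ[R] (zero k R × (Cell X Y R →₀ R)) :=
    LinearMap.prodMap 0 LinearMap.id
  have : F.restrictScalars k ∘ₗ twistD X (cellBd φ) =
      twistD (zero k R) (fun g => (0, (cellBd φ g).2)) ∘ₗ F.restrictScalars k := by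
    refine twist_linearMap_ext X (fun x => ?_) (fun g a r hr => ?_)
    · change F (twistD X (cellBd φ) (x, 0)) =
        twistD (zero k R) (fun g => (0, (cellBd φ g).2)) (F (x, 0))
      rw [twistD_inl]
      have h (x : X) : F (x, 0) = 0 := rfl
      rw [h, h, map_zero]
    · change F (twistD X (cellBd φ) (0, Finsupp.single g r)) =
        twistD (zero k R) (fun g => (0, (cellBd φ g).2)) (F (0, Finsupp.single g r))
      have h : F (0, Finsupp.single g r) = (0, Finsupp.single g r) := rfl
      rw [twistD_single, h, twistD_single, map_add, map_smul]
      rfl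
  exact LinearMap.congr_fun this p

theorem cofiber_d_bd (g : Cell X Y R) :
    twistD (zero k R) (fun g => (0, (cellBd φ g).2)) (0, (cellBd φ g).2) = 0 := by
  rw [← cofiber_map_d, twistD_cellBd]
  rfl

/-- The cofiber of `X → resolve φ`. -/
abbrev cofiber : DGMod k R :=
  twist (zero k R) cellDeg (fun g : Cell X Y R => (0, (cellBd φ g).2)) (cofiber_bd_mem φ)
    (cofiber_d_bd φ)

/-- The inclusion of `X` into `resolve φ`. -/
abbrev resolveInl : X ⟶ resolve φ := twistInl X _ _ _ _

/-- The projection of `resolve φ` onto the cofiber. -/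
def resolveProj : resolve φ ⟶ cofiber φ where
  toLin := LinearMap.prodMap 0 LinearMap.id
  map_mem _ _ h := ⟨trivial, h.2⟩
  map_d p := cofiber_map_d φ p

theorem zero_isSemifree : (zero k R).IsSemifree :=
  ⟨PEmpty, Module.Basis.empty _, PEmpty.elim, PEmpty.elim, fun i => i.elim, fun i => i.elim⟩

theorem cofiber_isSemifree (hX : X.IsSemifree) : (cofiber φ).IsSemifree := by
  obtain ⟨ι, b, dι, lι, hb, hl⟩ := hX
  obtain ⟨lG, hG, -⟩ := resolve_isSemifree_of_basis φ b dι lι hb hl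
  exact twist_isSemifree _ _ _ _ _ (ι := PEmpty) (Module.Basis.empty _) PEmpty.elim PEmpty.elim
    (fun i => i.elim) (fun i => i.elim) lG (fun g => Submodule.zero_mem _) hG

/-- As a graded `R`-module, `resolve φ` is the direct sum of `X` and the free module on the cells;
only the differential mixes them. -/
theorem resolve_exact : IsShortExact (resolveInl φ) (resolveProj φ) where
  inj := LinearMap.inl_injective
  exact p := by
    constructor
    · intro hp
      refine ⟨p.1, Prod.ext rfl ?_⟩
      exact (congrArg Prod.snd hp).symm
    · rintro ⟨x, rfl⟩
      rfl
  surj p := ⟨(0, p.2), Prod.ext (Subsingleton.elim _ _) rfl⟩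

end Cell

/-- Every DG module has a semi-free resolution. -/
theorem exists_semifree (M : DGMod k R) : ∃ (F : DGMod k R) (q : F ⟶ M), F.IsSemifree ∧
    quasiIso k R q :=
  ⟨resolve (fromZero M), resolveMap _, resolve_isSemifree _ zero_isSemifree,
    resolveMap_quasiIso _⟩

/-! ### Homotopies -/

/-- The degree of an `R`-linear map may be checked on a homogeneous basis. -/
theorem mem_gr_of_basis {F N : DGMod k R} {ι : Type u} (b : Module.Basis ι R F) (deg : ι → ℤ)
    (hb : ∀ i, b i ∈ F.gr (deg i)) (h : F →ₗ[R] N) (c : ℤ)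
    (hh : ∀ i, h (b i) ∈ N.gr (deg i + c)) {n : ℤ} {m : F} (hm : m ∈ F.gr n) :
    h m ∈ N.gr (n + c) := by
  have key (m : F) : ∀ n, N.proj (n + c) (h m) = h (F.proj n m) := by
    have hmem : m ∈ Submodule.span R (Set.range b) := by rw [b.span_eq]; trivial
    induction hmem using Submodule.span_induction with
    | mem x hx =>
      obtain ⟨i, rfl⟩ := hx
      intro n
      by_cases hn : deg i = n
      · subst hn
        rw [proj_of_mem (hb i), proj_of_mem (hh i)]
      · rw [proj_of_mem_ne (hb i) hn, map_zero, proj_of_mem_ne (hh i) (by omega)]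
    | zero => intro n; simp
    | add x y _ _ hx hy => intro n; simp [hx, hy]
    | smul r x _ hx =>
      revert r
      refine smul_decomp_induction (k := k) (fun r s hr hs n => ?_) fun a r hr n => ?_
      · simp only [add_smul, map_add, hr, hs]
      · rw [map_smul, proj_smul hr, proj_smul hr, map_smul, ← hx, sub_add_eq_add_sub]
  rw [mem_gr_iff, key, proj_of_mem hm]

/-- Homotopic morphisms of DG modules.  The homotopy is the map `m ↦ (-1)^{|m|} h m`. -/
def Homotopic {F X : DGMod k R} (f g : F ⟶ X) : Prop :=
  ∃ h : F →ₗ[R] X, (∀ n, ∀ m ∈ F.gr n, h m ∈ X.gr (n + -1)) ∧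
    ∀ m, lin f (F.sgn m) - lin g (F.sgn m) = X.d (h m) - h (F.d m)

theorem Homotopic.equivalence (F X : DGMod k R) :
    Equivalence (Homotopic (F := F) (X := X)) where
  refl f := ⟨0, fun _ _ _ => Submodule.zero_mem _, fun m => by simp⟩
  symm := fun ⟨h, hn, hm⟩ => ⟨-h, fun n m hm => Submodule.neg_mem _ (hn n m hm), fun m => by
    rw [← neg_sub, hm, LinearMap.neg_apply, LinearMap.neg_apply, map_neg]; abel⟩
  trans := fun ⟨h, hn, hm⟩ ⟨h', hn', hm'⟩ =>
    ⟨h + h', fun n m hm => Submodule.add_mem _ (hn n m hm) (hn' n m hm), fun m => by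
      rw [← sub_add_sub_cancel, hm, hm', LinearMap.add_apply, LinearMap.add_apply, map_add]
      abel⟩

/-- The setoid of homotopic morphisms. -/
def homotopySetoid (F X : DGMod k R) : Setoid (F ⟶ X) := ⟨Homotopic, Homotopic.equivalence F X⟩

theorem Homotopic.comp {F X Y : DGMod k R} {f g : F ⟶ X} (h : Homotopic f g) (u : X ⟶ Y) :
    Homotopic (f ≫ u) (g ≫ u) := by
  obtain ⟨h, hn, hm⟩ := h
  refine ⟨(lin u).comp h, fun n m hm => lin_mem u (hn n m hm), fun m => ?_⟩
  rw [comp_apply, comp_apply, ← map_sub, hm, map_sub, lin_d]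
  rfl

theorem Homotopic.precomp {F F' X : DGMod k R} {f g : F ⟶ X} (h : Homotopic f g) (u : F' ⟶ F) :
    Homotopic (u ≫ f) (u ≫ g) := by
  obtain ⟨h, hn, hm⟩ := h
  refine ⟨h.comp (lin u), fun n m hm => hn n _ (lin_mem u hm), fun m => ?_⟩
  rw [comp_apply, comp_apply, ← sgn_lin, hm, LinearMap.comp_apply, LinearMap.comp_apply, lin_d]

/-- A morphism from a semi-free DG module to an acyclic one is null-homotopic. -/
theorem IsSemifree.exists_nullhomotopy {F C : DGMod k R} (hF : F.IsSemifree)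
    (hC : ∀ i, ∀ z ∈ C.gr (i + 1), C.d z = 0 → ∃ w ∈ C.gr i, C.d w = z) (f : F ⟶ C) :
    ∃ h : F →ₗ[R] C, (∀ n, ∀ m ∈ F.gr n, h m ∈ C.gr (n + -1)) ∧
      ∀ m, lin f (F.sgn m) = C.d (h m) - h (F.d m) := by
  classical
  obtain ⟨ι, b, deg, lvl, hb, hl⟩ := hF
  -- The homotopy is built by recursion on the level. `part` is the map already determined on lower
  -- levels, extended by 0. `good` is the equation that its value at the basis vector `b i` must
  -- satisfy.
  let part (i : ι) (rec : ∀ j, lvl j < lvl i → C) : F →ₗ[R] C :=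
    b.constr ℕ fun j => if hj : lvl j < lvl i then rec j hj else 0
  let good (i : ι) (h : F →ₗ[R] C) (c : C) : Prop :=
    c ∈ C.gr (deg i + -1) ∧ C.d c = h (F.d (b i)) + lin f (F.sgn (b i))
  -- A value is chosen if one exists and is 0 otherwise; `main` shows that one always exists.
  let H : ι → C := WellFounded.fix (measure lvl).wf fun i rec =>
    if hc : ∃ c, good i (part i rec) c then hc.choose else 0
  have hH (i : ι) : H i =
      if hc : ∃ c, good i (part i fun j _ => H j) c then hc.choose else 0 :=
    WellFounded.fix_eq _ _ _
  let h : F →ₗ[R] C := b.constr ℕ H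
  have hhb (i : ι) : h (b i) = H i := b.constr_basis ℕ H i
  have hpart (i : ι) (x : F) (hx : x ∈ Submodule.span R (b '' {j | lvl j < lvl i})) :
      part i (fun j _ => H j) x = h x := by
    have : Set.EqOn (part i fun j _ => H j) h (b '' {j | lvl j < lvl i}) := by
      rintro _ ⟨j, hj, rfl⟩
      rw [hhb, b.constr_basis]
      exact dif_pos hj
    exact LinearMap.eqOn_span this hx
  have main (n : ℕ) : ∀ i, lvl i = n → good i h (H i) := by
    induction n using Nat.strong_induction_on with
    | _ n ih =>
    rintro i rfl
    have hrel (x : F) (hx : x ∈ Submodule.span R (b '' {j | lvl j < lvl i})) :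
        lin f (F.sgn x) = C.d (h x) - h (F.d x) := by
      induction hx using Submodule.span_induction with
      | mem x hx =>
        obtain ⟨j, hj, rfl⟩ := hx
        rw [hhb, (ih _ hj j rfl).2]
        abel
      | zero => simp
      | add x y _ _ hx hy => simp only [map_add, hx, hy]; abel
      | smul r x _ hx =>
        rw [sgn_smul, map_smul, hx, map_smul, d_smul, d_smul, map_add, map_smul, map_smul,
          smul_sub]
        abel
    have hmem : part i (fun j _ => H j) (F.d (b i)) ∈ C.gr (deg i) := by
      have := mem_gr_of_basis b deg hb (part i fun j _ => H j) (-1) (fun j => by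
        rw [b.constr_basis]
        split_ifs with hj
        · exact (ih _ hj j rfl).1
        · exact Submodule.zero_mem _) (F.d_mem _ _ (hb i))
      rwa [add_neg_cancel_right] at this
    have hex : ∃ c, good i (part i fun j _ => H j) c := by
      have h0 : deg i + -1 + 1 = deg i := by omega
      -- The right-hand side is a cocycle: the homotopy relation on the lower levels, applied to
      -- `F.d (b i)`, evaluates the boundary of the first term, and `d_sgn` makes the second cancel
      -- it. Acyclicity of `C` then supplies the value.
      have := hC (deg i + -1) (part i (fun j _ => H j) (F.d (b i)) + lin f (F.sgn (b i)))
        (by rw [h0]; exact Submodule.add_mem _ hmem (lin_mem f (sgn_mem (hb i))))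
        (by
          have h1 := hrel _ (hl i)
          rw [F.d_d, map_zero, sub_zero] at h1
          rw [hpart i _ (hl i), map_add, ← h1, ← lin_d, d_sgn, map_neg, add_neg_cancel])
      obtain ⟨c, hc, hdc⟩ := this
      exact ⟨c, hc, hdc⟩
    have := hex.choose_spec
    rw [hH, dif_pos hex]
    refine ⟨this.1, this.2.trans ?_⟩
    rw [hpart i _ (hl i)]
  refine ⟨h, fun n m hm => mem_gr_of_basis b deg hb h (-1)
    (fun i => by rw [hhb]; exact (main _ i rfl).1) hm, fun m => ?_⟩
  have hmem : m ∈ Submodule.span R (Set.range b) := by rw [b.span_eq]; trivial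
  induction hmem using Submodule.span_induction with
  | mem x hx =>
    obtain ⟨j, rfl⟩ := hx
    rw [hhb, (main _ j rfl).2]
    abel
  | zero => simp
  | add x y _ _ hx hy => simp only [map_add, hx, hy]; abel
  | smul r x _ hx =>
    rw [sgn_smul, map_smul, hx, map_smul, d_smul, d_smul, map_add, map_smul, map_smul, smul_sub]
    abel

/-- The composite of `f` with the inclusion of `Y` into the cone of `q` is null-homotopic. The
`X`-component of a null-homotopy is a chain map of degree 0, the lift, and its `Y`-component is the
homotopy. -/
theorem IsSemifree.exists_lift {F X Y : DGMod k R} (hF : F.IsSemifree) (q : X ⟶ Y)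
    (hq : quasiIso k R q) (f : F ⟶ Y) : ∃ g : F ⟶ X, Homotopic (g ≫ q) f := by
  obtain ⟨w, hw, hm⟩ := hF.exists_nullhomotopy (fun i z hz hdz => cone_acyclic q hq rfl z hz hdz)
    (f ≫ coneInr q)
  have h1 (m : F) : 0 = X.d (w m).1 - (w (F.d m)).1 := congrArg Prod.fst (hm m)
  have h2 (m : F) : lin f (F.sgn m) =
      lin q (X.sgn (w m).1) + Y.d (w m).2 - (w (F.d m)).2 := congrArg Prod.snd (hm m)
  have hw1 (n : ℤ) (m : F) (hmn : m ∈ F.gr n) : (w m).1 ∈ X.gr n := by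
    have : (w m).1 ∈ X.gr (n + -1 + 1) := (hw n m hmn).1
    rwa [neg_add_cancel_right] at this
  let w1 : F →ₗ[R] X := (LinearMap.fst R X Y).comp w
  let w2 : F →ₗ[R] Y := (LinearMap.snd R X Y).comp w
  let g : F ⟶ X := Hom.mk w1 hw1 fun m => (sub_eq_zero.1 (h1 m).symm).symm
  refine ⟨g, (Homotopic.equivalence F Y).symm ⟨w2, fun n m hmn => (hw n m hmn).2, fun m => ?_⟩⟩
  have h3 : lin (g ≫ q) (F.sgn m) = lin q (X.sgn (w m).1) := by
    rw [comp_apply, ← sgn_lin]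
    rfl
  rw [h2, h3]
  change _ = Y.d (w m).2 - (w (F.d m)).2
  abel

/-- The morphism to a shifted mapping cone given by two morphisms whose composites with `q` are
homotopic. -/
def homotopyToCone {F X Y : DGMod k R} (q : X ⟶ Y) (g g' : F ⟶ X) (h : F →ₗ[R] Y)
    (hn : ∀ n, ∀ m ∈ F.gr n, h m ∈ Y.gr (n + -1))
    (hm : ∀ m, lin (g ≫ q) (F.sgn m) - lin (g' ≫ q) (F.sgn m) = Y.d (h m) - h (F.d m)) :
    F ⟶ (cone q).shift (-1) where
  toLin := (lin g - lin g').prod (-h)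
  map_mem n m hmn := by
    refine ⟨?_, Submodule.neg_mem _ (hn n m hmn)⟩
    change lin g m - lin g' m ∈ X.gr (n + -1 + 1)
    rw [neg_add_cancel_right]
    exact Submodule.sub_mem _ (lin_mem g hmn) (lin_mem g' hmn)
  map_d m := by
    refine Prod.ext ?_ ?_
    · change lin g (F.d m) - lin g' (F.d m) = X.d (lin g m - lin g' m)
      rw [lin_d, lin_d, map_sub]
    · change - h (F.d m) = lin q (X.sgn (lin g m - lin g' m)) + Y.d (- h m)
      have := hm m
      rw [comp_apply, comp_apply] at this
      rw [map_sub, map_sub, sgn_lin, sgn_lin, this, map_neg]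
      abel

/-- The two maps together with the given homotopy form one morphism to a shift of the acyclic cone;
the `X`-component of its null-homotopy is the homotopy sought. -/
theorem IsSemifree.homotopic_of_comp {F X Y : DGMod k R} (hF : F.IsSemifree) (q : X ⟶ Y)
    (hq : quasiIso k R q) (g g' : F ⟶ X) (h : Homotopic (g ≫ q) (g' ≫ q)) : Homotopic g g' := by
  obtain ⟨h, hn, hm⟩ := h
  have hac (i : ℤ) (z : (cone q).shift (-1)) (hz : z ∈ ((cone q).shift (-1)).gr (i + 1))
      (hdz : ((cone q).shift (-1)).d z = 0) :
      ∃ w ∈ ((cone q).shift (-1)).gr i, ((cone q).shift (-1)).d w = z :=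
    cone_acyclic q hq (i := i + -1) (by omega) z hz hdz
  obtain ⟨w, hw, hwm⟩ := hF.exists_nullhomotopy hac (homotopyToCone q g g' h hn hm)
  let w1 : F →ₗ[R] X := (LinearMap.fst R X Y).comp w
  have hw1 (n : ℤ) (m : F) (hmn : m ∈ F.gr n) : w1 m ∈ X.gr (n + -1 + -1 + 1) := (hw n m hmn).1
  refine ⟨w1, fun n m hmn => ?_, fun m => ?_⟩
  · have := hw1 n m hmn
    rwa [neg_add_cancel_right] at this
  · exact congrArg Prod.fst (hwm m)

/-- The functor `[F, -]` of homotopy classes of morphisms. -/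
def homotopyFunctor (F : DGMod k R) : DGMod k R ⥤ Type u where
  obj X := Quotient (homotopySetoid F X)
  map u := ↾(Quotient.map (fun f => f ≫ u) fun _ _ h => h.comp u)
  map_id X := by
    ext x
    induction x using Quotient.inductionOn
    rfl
  map_comp u v := by
    ext x
    induction x using Quotient.inductionOn
    rfl

theorem homotopyFunctor_inverts {F : DGMod k R} (hF : F.IsSemifree) :
    (quasiIso k R).IsInvertedBy (homotopyFunctor F) := by
  intro X Y q hq
  rw [isIso_iff_bijective]
  constructor
  · intro x y hxy
    induction x using Quotient.inductionOn
    induction y using Quotient.inductionOn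
    exact Quotient.sound (hF.homotopic_of_comp q hq _ _ (Quotient.exact hxy))
  · intro y
    induction y using Quotient.inductionOn with
    | _ f =>
    obtain ⟨g, hg⟩ := hF.exists_lift q hq f
    exact ⟨Quotient.mk _ g, Quotient.sound hg⟩

/-- Precomposition. -/
def homotopyPrecomp {F F' : DGMod k R} (u : F' ⟶ F) : homotopyFunctor F ⟶ homotopyFunctor F' where
  app X := ↾(Quotient.map (fun f => u ≫ f) fun _ _ h => h.precomp u)
  naturality X Y v := by
    ext x
    induction x using Quotient.inductionOn
    rfl

/-- A retract in the derived category yields a homotopy retract of semi-free resolutions. -/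
theorem exists_homotopy_retract {M N F G : DGMod k R} (r : Retract M.toDerived N.toDerived)
    (hF : F.IsSemifree) (hG : G.IsSemifree) (p : F ⟶ M) (hp : quasiIso k R p) (q : G ⟶ N)
    (hq : quasiIso k R q) : ∃ (u : F ⟶ G) (v : G ⟶ F), Homotopic (u ≫ v) (𝟙 F) := by
  let s : Retract F.toDerived G.toDerived := (Retract.ofIso (derivedIso p hp)).trans
    (r.trans (Retract.ofIso (derivedIso q hq).symm))
  let L (E : DGMod k R) (hE : E.IsSemifree) :=
    Localization.lift (homotopyFunctor E) (homotopyFunctor_inverts hE) (quasiIso k R).Q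
  let e (E : DGMod k R) (hE : E.IsSemifree) : (quasiIso k R).Q ⋙ L E hE ≅ homotopyFunctor E :=
    Localization.fac _ _ _
  -- The action of a morphism of the derived category on homotopy classes of maps out of `E`.
  let T (E : DGMod k R) (hE : E.IsSemifree) {A B : DGMod k R} (φ : A.toDerived ⟶ B.toDerived) :
      (homotopyFunctor E).obj A ⟶ (homotopyFunctor E).obj B :=
    (e E hE).inv.app A ≫ (L E hE).map φ ≫ (e E hE).hom.app B
  have hT (E : DGMod k R) (hE : E.IsSemifree) {A B C : DGMod k R} (φ : A.toDerived ⟶ B.toDerived)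
      (ψ : B.toDerived ⟶ C.toDerived) : T E hE (φ ≫ ψ) = T E hE φ ≫ T E hE ψ := by
    simp [T]
  have hT1 (E : DGMod k R) (hE : E.IsSemifree) {A : DGMod k R} : T E hE (𝟙 A.toDerived) = 𝟙 _ := by
    simp [T]
  -- This action commutes with precomposition, because a natural transformation between functors
  -- that invert quasi-isomorphisms extends to the localization.
  have hnat {E E' : DGMod k R} (hE : E.IsSemifree) (hE' : E'.IsSemifree) (u : E' ⟶ E)
      {A B : DGMod k R} (φ : A.toDerived ⟶ B.toDerived) :
      T E hE φ ≫ (homotopyPrecomp u).app B = (homotopyPrecomp u).app A ≫ T E' hE' φ := by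
    let τ : L E hE ⟶ L E' hE' := Localization.liftNatTrans (quasiIso k R).Q (quasiIso k R)
      (homotopyFunctor E) (homotopyFunctor E') (L E hE) (L E' hE') (homotopyPrecomp u)
    have hτ (X : DGMod k R) : τ.app ((quasiIso k R).Q.obj X) =
        (e E hE).hom.app X ≫ (homotopyPrecomp u).app X ≫ (e E' hE').inv.app X :=
      Localization.liftNatTrans_app _ _ _ _ _ _ _ X
    have h2 := τ.naturality φ
    rw [hτ, hτ] at h2
    have h3 : (L E hE).map φ ≫ (e E hE).hom.app B ≫ (homotopyPrecomp u).app B =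
        (e E hE).hom.app A ≫ (homotopyPrecomp u).app A ≫ (e E' hE').inv.app A ≫
          (L E' hE').map φ ≫ (e E' hE').hom.app B := by
      have h4 := congrArg (fun x => x ≫ (e E' hE').hom.app B) h2
      simp only [Category.assoc, Iso.inv_hom_id_app] at h4
      rw [← h4]
      exact congrArg (fun x => (L E hE).map φ ≫ (e E hE).hom.app B ≫ x) (Category.comp_id _).symm
    simp only [T, Category.assoc]
    rw [h3, Iso.inv_hom_id_app_assoc]
  let x : (homotopyFunctor F).obj F := Quotient.mk _ (𝟙 F)
  let y : (homotopyFunctor G).obj G := Quotient.mk _ (𝟙 G)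
  -- A Yoneda argument: `u` and `v` represent the images of the identities under the two maps of the
  -- retract. By naturality the class of `u ≫ v` is `s.r` applied to the class of `u`, which is the
  -- class of the identity.
  obtain ⟨u, hu⟩ := Quotient.exists_rep (T F hF s.i x)
  obtain ⟨v, hv⟩ := Quotient.exists_rep (T G hG s.r y)
  refine ⟨u, v, Quotient.exact (s := homotopySetoid F F) ?_⟩
  have h1 : T F hF s.r (T F hF s.i x) = x := by
    have h := hT F hF s.i s.r
    rw [s.retract, hT1 F hF] at h
    exact (congrArg (fun φ => φ x) h).symm
  have h2 : (homotopyPrecomp u).app F (T G hG s.r y) =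
      T F hF s.r ((homotopyPrecomp u).app G y) :=
    congrArg (fun φ => φ y) (hnat hG hF u s.r)
  have h3 : (homotopyPrecomp u).app G y = T F hF s.i x := hu
  rw [h3, h1, ← hv] at h2
  exact h2

end DGMod

namespace DGMod

variable {k R : Type u} [Field k] [Ring R] [Algebra k R] [DGAlgebra k R]
  [IsSimplyConnectedCochain k R]

/-! ### The functor `k ⊗_R -` -/

/-- The map `m ↦ 1 ⊗ m`. -/
def rtMk (M : DGMod k R) : M →ₗ[k] ResidueTensor M :=
  (tensorRel M).mkQ ∘ₗ TensorProduct.mk k k M 1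

theorem rtMk_surjective (M : DGMod k R) : Function.Surjective (rtMk M) := by
  intro x
  obtain ⟨t, rfl⟩ := (tensorRel M).mkQ_surjective x
  induction t using TensorProduct.induction_on with
  | zero => exact ⟨0, by simp⟩
  | add x y hx hy =>
    obtain ⟨a, ha⟩ := hx
    obtain ⟨b, hb⟩ := hy
    exact ⟨a + b, by rw [map_add, map_add, ha, hb]⟩
  | tmul c m =>
    refine ⟨c • m, ?_⟩
    change (tensorRel M).mkQ ((1 : k) ⊗ₜ[k] (c • m)) = _
    rw [← TensorProduct.smul_tmul, smul_eq_mul, mul_one]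

theorem rtMk_smul {M : DGMod k R} (r : R) (m : M) : rtMk M (r • m) = aug k R r • rtMk M m := by
  symm
  change aug k R r • (tensorRel M).mkQ ((1 : k) ⊗ₜ[k] m) = (tensorRel M).mkQ ((1 : k) ⊗ₜ[k] (r • m))
  rw [← map_smul, TensorProduct.smul_tmul', ← sub_eq_zero, ← map_sub, ← LinearMap.mem_ker,
    Submodule.ker_mkQ]
  exact Submodule.subset_span ⟨1, r, m, by rw [one_mul, smul_eq_mul, mul_one]⟩

/-- The map `k ⊗_R h`. -/
def rtMap {M N : DGMod k R} (h : M →ₗ[R] N) : ResidueTensor M →ₗ[k] ResidueTensor N :=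
  Submodule.mapQ _ _ (LinearMap.lTensor k (h.restrictScalars k)) (by
    refine Submodule.span_le.2 ?_
    rintro _ ⟨c, r, m, rfl⟩
    refine Submodule.subset_span ⟨c, r, h m, ?_⟩
    rw [map_sub, LinearMap.lTensor_tmul, LinearMap.lTensor_tmul]
    change (c * aug k R r) ⊗ₜ[k] h m - c ⊗ₜ[k] h (r • m) = _
    rw [map_smul])

theorem rtMap_mk {M N : DGMod k R} (h : M →ₗ[R] N) (m : M) :
    rtMap h (rtMk M m) = rtMk N (h m) := rfl

theorem residueTensorD_mk {M : DGMod k R} (m : M) :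
    residueTensorD M (rtMk M m) = rtMk M (M.d m) := rfl

/-- The complex `k ⊗_R M`. -/
abbrev rtComplex (M : DGMod k R) : GradedComplex k where
  V := ResidueTensor M
  gr := residueTensorGr M
  d := residueTensorD M
  d_mem := by
    rintro i _ ⟨m, hm, rfl⟩
    exact ⟨M.d m, M.d_mem i m hm, rfl⟩
  d_d x := by
    obtain ⟨m, rfl⟩ := rtMk_surjective M x
    rw [residueTensorD_mk, residueTensorD_mk, M.d_d, map_zero]

/-- The morphism `k ⊗_R f`. -/
abbrev rtComplexMap {M N : DGMod k R} (f : M ⟶ N) :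
    GradedComplex.Map (rtComplex M) (rtComplex N) where
  f := rtMap (lin f)
  map_mem := by
    rintro i _ ⟨m, hm, rfl⟩
    exact ⟨lin f m, lin_mem f hm, rfl⟩
  map_d x := by
    obtain ⟨m, rfl⟩ := rtMk_surjective M x
    rw [rtMap_mk, residueTensorD_mk, residueTensorD_mk, rtMap_mk, lin_d]

/-- An `R`-linear homotopy passes to `k ⊗_R -`. If the image under `u` of a cocycle bounds, then so
does the cocycle: transport the bounding element back along `v` and correct it by the homotopy. -/
theorem nontrivial_of_homotopy_retract {F G : DGMod k R} (u : F ⟶ G) (v : G ⟶ F)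
    (h : Homotopic (u ≫ v) (𝟙 F)) (j : ℤ) (hj : Nontrivial (residueTensorCohomology F j)) :
    Nontrivial (residueTensorCohomology G j) := by
  by_contra hc
  have hij : j + -1 + 1 = j := by omega
  rw [not_nontrivial_gradedCohomology_iff hij] at hc
  rw [gradedCohomology_nontrivial_iff hij] at hj
  obtain ⟨_, ⟨m, hm, rfl⟩, hx, hx'⟩ := hj
  obtain ⟨h, hn, hh⟩ := h
  obtain ⟨y, hy, hyx⟩ := hc (rtMap (lin u) (rtMk F m)) ((rtComplexMap u).map_mem j _ ⟨m, hm, rfl⟩)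
    (by
      have := (rtComplexMap u).map_d (rtMk F m)
      exact this.symm.trans ((congrArg _ hx).trans (map_zero _)))
  have hx1 : rtMk F (F.d m) = 0 := hx
  -- Only `1 ⊗ d m` vanishes, not `d m` itself; `R`-linearity of `h` is what removes the term `1 ⊗ h
  -- (d m)`.
  have h1 : rtMk F (lin v (lin u (F.sgn m))) - rtMk F (F.sgn m) = rtMk F (F.d (h m)) := by
    have := congrArg (rtMk F) (hh m)
    rw [map_sub, map_sub, ← rtMap_mk h, hx1, map_zero, sub_zero] at this
    exact this
  have h2 : residueTensorD F (rtMap (lin v) y) = rtMk F (lin v (lin u m)) := by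
    have := (rtComplexMap v).map_d y
    exact this.symm.trans (congrArg (rtMap (lin v)) hyx)
  rw [sgn_of_mem hm] at h1
  simp only [Units.smul_def, map_zsmul] at h1
  rw [← smul_sub] at h1
  have h3 : rtMk F (lin v (lin u m)) - rtMk F m = j.negOnePow • rtMk F (F.d (h m)) := by
    rw [← h1, ← Units.smul_def, units_smul_units_smul]
  refine hx' (rtMap (lin v) y - j.negOnePow • rtMk F (h m)) ?_ ?_
  · refine Submodule.sub_mem _ ((rtComplexMap v).map_mem _ _ hy) ?_
    have hmem : rtMk F (h m) ∈ residueTensorGr F (j + -1) := ⟨h m, hn j m hm, rfl⟩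
    rw [Units.smul_def]
    exact zsmul_mem hmem _
  · rw [map_sub, h2, Units.smul_def, map_zsmul, residueTensorD_mk, ← Units.smul_def, ← h3]
    exact sub_sub_cancel _ _

/-! ### Derived tensor products -/

theorem TorNonzero.of_retract {M N : DGMod k R} (r : Retract M.toDerived N.toDerived) {j : ℤ}
    (h : TorNonzero M j) : TorNonzero N j := by
  obtain ⟨F, p, hF, hp, hj⟩ := h
  obtain ⟨G, q, hG, hq⟩ := exists_semifree N
  obtain ⟨u, v, huv⟩ := exists_homotopy_retract r hF hG p hp q hq
  exact ⟨G, q, hG, hq, nontrivial_of_homotopy_retract u v huv j hj⟩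

theorem torNonzero_iff_of_iso {M N : DGMod k R} (e : M.toDerived ≅ N.toDerived) (j : ℤ) :
    TorNonzero M j ↔ TorNonzero N j :=
  ⟨TorNonzero.of_retract (Retract.ofIso e), TorNonzero.of_retract (Retract.ofIso e.symm)⟩

theorem torNonzero_iff_of_quasiIso {M N : DGMod k R} (f : M ⟶ N) (hf : quasiIso k R f) (j : ℤ) :
    TorNonzero M j ↔ TorNonzero N j := torNonzero_iff_of_iso (derivedIso f hf) j

/-- Any semi-free resolution may be used: two resolutions of `M` are homotopy retracts of each
other, by the identity retract in the derived category. -/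
theorem torNonzero_iff {F M : DGMod k R} (q : F ⟶ M) (hF : F.IsSemifree) (hq : quasiIso k R q)
    (j : ℤ) : TorNonzero M j ↔ Nontrivial (residueTensorCohomology F j) := by
  refine ⟨fun ⟨G, p, hG, hp, hj⟩ => ?_, fun h => ⟨F, q, hF, hq, h⟩⟩
  obtain ⟨u, v, huv⟩ := exists_homotopy_retract (Retract.refl M.toDerived) hG hF p hp q hq
  exact nontrivial_of_homotopy_retract u v huv j hj

/-- The sequence splits over `R`, with splittings `ρ` and `σ` that ignore the differentials; split
exactness is preserved by any additive functor. -/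
theorem cofiber_rt_exact {X Y : DGMod k R} (φ : X ⟶ Y) :
    GradedComplex.IsShortExact (rtComplexMap (resolveInl φ)) (rtComplexMap (resolveProj φ)) := by
  let ρ : resolve φ →ₗ[R] X := LinearMap.fst R X _
  let σ : cofiber φ →ₗ[R] resolve φ := LinearMap.prodMap 0 LinearMap.id
  have key (x : ResidueTensor (resolve φ)) : rtMap (lin (resolveInl φ)) (rtMap ρ x) +
      rtMap σ (rtMap (lin (resolveProj φ)) x) = x := by
    obtain ⟨m, rfl⟩ := rtMk_surjective _ x
    rw [rtMap_mk, rtMap_mk, rtMap_mk, rtMap_mk, ← map_add]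
    congr 1
    exact Prod.ext (add_zero _) (zero_add _)
  refine ⟨?_, ?_, ?_, ?_⟩
  · refine Function.LeftInverse.injective (g := rtMap ρ) fun x => ?_
    obtain ⟨m, rfl⟩ := rtMk_surjective _ x
    rfl
  · intro x
    obtain ⟨m, rfl⟩ := rtMk_surjective _ x
    exact map_zero (rtMk (cofiber φ))
  · rintro j _ ⟨m, hm, rfl⟩ hb
    refine ⟨rtMap ρ (rtMk _ m), ⟨ρ m, hm.1, rfl⟩, ?_⟩
    have := key (rtMk _ m)
    rw [show rtMap (lin (resolveProj φ)) (rtMk _ m) = 0 from hb, map_zero, add_zero] at this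
    exact this
  · rintro j _ ⟨m, hm, rfl⟩
    exact ⟨rtMk _ (σ m), ⟨σ m, ⟨Submodule.zero_mem _, hm.2⟩, rfl⟩,
      congrArg (rtMk (cofiber φ)) (Prod.ext (Subsingleton.elim _ _) rfl)⟩

/-- A short exact sequence of DG modules has a short exact sequence of semi-free resolutions which
stays exact after tensoring with `k`. -/
theorem exists_resolution {A B C : DGMod k R} {f : A ⟶ B} {g : B ⟶ C} (h : IsShortExact f g) :
    ∃ TA TB TC : GradedComplex k,
      ∃ (φ : TA.Map TB) (ψ : TB.Map TC), GradedComplex.IsShortExact φ ψ ∧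
        ∀ j, (TorNonzero A j ↔ Nontrivial (TA.H j)) ∧ (TorNonzero B j ↔ Nontrivial (TB.H j)) ∧
          (TorNonzero C j ↔ Nontrivial (TC.H j)) := by
  -- Resolve `A` by `F`, factor `F → A → B` through `resolve φ`, and take the cofiber; the five
  -- lemma shows that the cofiber resolves `C`.
  obtain ⟨F, p, hF, hp⟩ := exists_semifree A
  let φ : F ⟶ B := p ≫ f
  have hfg (a : A) : lin g (lin f a) = 0 := (h.exact _).2 ⟨a, rfl⟩
  have hdesc (x : F) (c : Cell F B R →₀ R) : lin g (lin (resolveMap φ) ((x, c) : F × _)) =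
      Finsupp.linearCombination R (fun e => lin g (cellVal φ e)) c := by
    change lin g (lin f (lin p x) + Finsupp.linearCombination R (cellVal φ) c) = _
    rw [map_add, hfg, zero_add, Finsupp.apply_linearCombination]
    rfl
  let γ : cofiber φ ⟶ C :=
    twistDesc (zero k R) _ _ _ _ (fromZero C) (fun e => lin g (cellVal φ e))
      (fun e => lin_mem g (cellVal_mem φ e)) (fun e => by
        rw [← lin_d, ← coprod_cellBd φ e]
        have := hdesc (cellBd φ e).1 (cellBd φ e).2
        refine Eq.trans ?_ this.symm
        change lin (fromZero C) 0 + _ = _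
        rw [map_zero, zero_add]
        rfl)
  have hγ : quasiIso k R γ := by
    refine quasiIso_right (resolve_exact φ) h p (resolveMap φ) γ ?_ ?_ hp (resolveMap_quasiIso φ)
    · ext x
      change lin φ x + Finsupp.linearCombination R (cellVal φ) 0 = lin f (lin p x)
      rw [map_zero, add_zero]
      rfl
    · ext x
      refine Eq.trans ?_ (hdesc x.1 x.2).symm
      change lin (fromZero C) 0 + _ = _
      rw [map_zero, zero_add]
      rfl
  exact ⟨_, _, _, _, _, cofiber_rt_exact φ, fun j => ⟨torNonzero_iff p hF hp j,
    torNonzero_iff (resolveMap φ) (resolve_isSemifree φ hF) (resolveMap_quasiIso φ) j,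
    torNonzero_iff γ (cofiber_isSemifree φ hF) hγ j⟩⟩

section LongExact

variable {A B C : DGMod k R} {f : A ⟶ B} {g : B ⟶ C} (h : IsShortExact f g)

include h

theorem TorNonzero.middle {j : ℤ} (hB : TorNonzero B j) : TorNonzero A j ∨ TorNonzero C j := by
  obtain ⟨_, _, _, _, _, hS, H⟩ := exists_resolution h
  rw [(H j).1, (H j).2.2]
  exact hS.nontrivial_middle ((H j).2.1.1 hB)

theorem TorNonzero.right {j i : ℤ} (hij : j + 1 = i) (hC : TorNonzero C j) :
    TorNonzero B j ∨ TorNonzero A i := by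
  obtain ⟨_, _, _, _, _, hS, H⟩ := exists_resolution h
  rw [(H j).2.1, (H i).1]
  exact hS.nontrivial_right hij ((H j).2.2.1 hC)

theorem TorNonzero.left {j i : ℤ} (hij : j + 1 = i) (hA : TorNonzero A i) :
    TorNonzero C j ∨ TorNonzero B i := by
  obtain ⟨_, _, _, _, _, hS, H⟩ := exists_resolution h
  rw [(H j).2.2, (H i).2.1]
  exact hS.nontrivial_left hij ((H i).1.1 hA)

end LongExact

end DGMod

namespace DGMod

variable {k R : Type u} [Field k] [Ring R] [Algebra k R] [DGAlgebra k R]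

/-! ### Suspensions -/

section Shift

variable {M N : DGMod k R}

theorem shift_nontrivial_iff (n j : ℤ) :
    Nontrivial ((M.shift n).cohomology j) ↔ Nontrivial (M.cohomology (j + n)) :=
  (gradedCohomology_nontrivial_iff (gr := (M.shift n).gr) (sub_add_cancel j 1)).trans
    (gradedCohomology_nontrivial_iff (gr := M.gr) (i := j - 1 + n) (by omega)).symm

theorem shift_finite_iff (n j : ℤ) :
    Module.Finite k ((M.shift n).cohomology j) ↔ Module.Finite k (M.cohomology (j + n)) := by
  have h : j - 1 + n = j + n - 1 := by omega
  change Module.Finite k (↥(LinearMap.ker M.d ⊓ M.gr (j + n)) ⧸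
    ((M.gr (j - 1 + n)).map M.d).comap (LinearMap.ker M.d ⊓ M.gr (j + n)).subtype) ↔ _
  rw [h]

/-- The suspension of a morphism. -/
def shiftMap (f : M ⟶ N) (n : ℤ) : M.shift n ⟶ N.shift n where
  toLin := let F : M →ₗ[R] N := lin f; F
  map_mem _ _ h := lin_mem (M := M) (N := N) f h
  map_d := lin_d (M := M) (N := N) f

theorem shiftMap_quasiIso (f : M ⟶ N) (hf : quasiIso k R f) (n : ℤ) :
    quasiIso k R (shiftMap f n) :=
  quasiIso_of _
    (fun i => (cohomologyMap_surjective_iff f (i := i + n) (by omega)).1 (hf (i + 1 + n)).2)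
    (fun i => (cohomologyMap_injective_iff f (i := i + n) (by omega)).1 (hf (i + 1 + n)).1)

theorem shift_isSemifree (hM : M.IsSemifree) (n : ℤ) : (M.shift n).IsSemifree := by
  obtain ⟨ι, b, deg, lvl, hb, hl⟩ := hM
  refine ⟨ι, b, fun i => deg i - n, lvl, fun i => ?_, hl⟩
  change b i ∈ M.gr (deg i - n + n)
  rw [sub_add_cancel]
  exact hb i

end Shift

/-! ### Submodules which are cut off below a given degree -/

section Cut

variable [IsSimplyConnectedCochain k R] (M : DGMod k R) (l : ℤ) (W : Submodule k M)

theorem eq_zero_of_neg {a : ℤ} (ha : a < 0) {r : R} (hr : r ∈ DGAlgebra.gr (k := k) a) : r = 0 := by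
  rw [IsSimplyConnectedCochain.gr_neg a ha] at hr
  exact hr

theorem eq_zero_of_one {r : R} (hr : r ∈ DGAlgebra.gr (k := k) 1) : r = 0 := by
  rw [IsSimplyConnectedCochain.gr_one] at hr
  exact hr

/-- The submodule `W ⊕ M^{> l}`, where `W ⊆ M^l`. -/
def cutSubmodule : Submodule R M where
  carrier := {m | (∀ n < l, M.proj n m = 0) ∧ M.proj l m ∈ W}
  add_mem' hx hy := ⟨fun n hn => by rw [map_add, hx.1 n hn, hy.1 n hn, add_zero],
    by rw [map_add]; exact W.add_mem hx.2 hy.2⟩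
  zero_mem' := ⟨fun n _ => map_zero _, by rw [map_zero]; exact W.zero_mem⟩
  smul_mem' r m hm := by
    revert r
    refine smul_decomp_induction (k := k) (fun r s hr hs => ?_) fun a r hr => ?_
    · rw [add_smul]
      exact ⟨fun n hn => by rw [map_add, hr.1 n hn, hs.1 n hn, add_zero],
        by rw [map_add]; exact W.add_mem hr.2 hs.2⟩
    -- This is where the shape of `R` is used: negative degrees vanish, degree 0 consists of
    -- scalars, which preserve `W`, and positive degrees move everything above `l`.
    · rcases lt_trichotomy a 0 with ha | rfl | ha
      · rw [eq_zero_of_neg ha hr, zero_smul]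
        exact ⟨fun n _ => map_zero _, by rw [map_zero]; exact W.zero_mem⟩
      · obtain ⟨c, rfl, -⟩ := IsSimplyConnectedCochain.gr_zero (k := k) r hr
        rw [algebraMap_smul]
        exact ⟨fun n hn => by rw [map_smul, hm.1 n hn, smul_zero],
          by rw [map_smul]; exact W.smul_mem c hm.2⟩
      · refine ⟨fun n hn => ?_, ?_⟩
        · rw [proj_smul hr, hm.1 _ (by omega), smul_zero]
        · rw [proj_smul hr, hm.1 _ (by omega), smul_zero]
          exact W.zero_mem

variable {M l W}

theorem mem_cut_of_lt {n : ℤ} {m : M} (hm : m ∈ M.gr n) (hn : l < n) :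
    m ∈ cutSubmodule M l W :=
  ⟨fun j hj => proj_of_mem_ne hm (by omega), by
    rw [proj_of_mem_ne hm (by omega)]; exact W.zero_mem⟩

theorem mem_cut_of_mem {m : M} (hm : m ∈ M.gr l) (hW : m ∈ W) : m ∈ cutSubmodule M l W :=
  ⟨fun j hj => proj_of_mem_ne hm (by omega), by rwa [proj_of_mem hm]⟩

theorem eq_zero_of_mem_cut {n : ℤ} {m : M} (hm : m ∈ M.gr n) (hn : n < l)
    (h : m ∈ cutSubmodule M l W) : m = 0 := by
  rw [← proj_of_mem hm, h.1 n hn]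

theorem mem_of_mem_cut {m : M} (hm : m ∈ M.gr l) (h : m ∈ cutSubmodule M l W) : m ∈ W := by
  have := h.2
  rwa [proj_of_mem hm] at this

theorem cut_proj (n : ℤ) (m : M) (hm : m ∈ cutSubmodule M l W) :
    M.proj n m ∈ cutSubmodule M l W := by
  rcases lt_trichotomy n l with h | rfl | h
  · rw [hm.1 n h]; exact Submodule.zero_mem _
  · exact mem_cut_of_mem (proj_mem _ _) hm.2
  · exact mem_cut_of_lt (proj_mem _ _) h

/-- No condition on `W` is needed, since the differential maps degree `l` to degree `l + 1`, where
nothing is cut. -/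
theorem cut_d (m : M) (hm : m ∈ cutSubmodule M l W) : M.d m ∈ cutSubmodule M l W := by
  have key (n : ℤ) (hn : n ≤ l) : M.proj n (M.d m) = 0 := by
    have := proj_d (n - 1) m
    rw [sub_add_cancel] at this
    rw [this, hm.1 _ (by omega), map_zero]
  exact ⟨fun n hn => key n hn.le, by rw [key l le_rfl]; exact W.zero_mem⟩

variable (M l W)

/-- The DG submodule `W ⊕ M^{> l}`, where `W ⊆ M^l`. -/
abbrev cut : DGMod k R := M.sub (cutSubmodule M l W) cut_proj cut_d

/-- The inclusion of `cut M l W`. -/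
abbrev cutInc : cut M l W ⟶ M := M.subInc _ cut_proj cut_d

/-- The quotient by `cut M l W`. -/
abbrev cutQuot : DGMod k R := M.quot (cutSubmodule M l W) cut_proj cut_d

/-- The projection to the quotient by `cut M l W`. -/
abbrev cutProj : M ⟶ cutQuot M l W := M.quotProj _ cut_proj cut_d

theorem cut_exact : IsShortExact (cutInc M l W) (cutProj M l W) := subQuot_exact M _ _ _

variable {M l W}

variable (k R) in
/-- The DG module `k[-n]`, which is `k` in degree `n`. -/
def residueShift (n : ℤ) : DGMod k R := (residue k R).shift (-n)

/-- A linear form on `M^n` which vanishes on boundaries gives a morphism to `k[-n]`. -/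
def cutToResidue (n : ℤ) (hn : n - 1 ≤ l) (hn' : l ≤ n) (φ : M →ₗ[k] k)
    (hφ : ∀ y ∈ M.gr (n - 1), φ (M.d y) = 0) :
    cut M l W ⟶ residueShift k R n where
  toLin :=
    { toFun := fun x => φ (M.proj n x.1)
      map_add' := fun x y => (congrArg φ (map_add (M.proj n) x.1 y.1)).trans (map_add φ _ _)
      map_smul' := fun r x => by
        change φ (M.proj n (r • x.1)) = aug k R r * φ (M.proj n x.1)
        revert r
        refine smul_decomp_induction (k := k) (fun r s hr hs => ?_) fun a r hr => ?_
        · rw [add_smul, map_add, map_add, hr, hs, map_add, add_mul]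
        · rcases lt_trichotomy a 0 with ha | rfl | ha
          · simp [eq_zero_of_neg ha hr]
          · obtain ⟨c, rfl, -⟩ := IsSimplyConnectedCochain.gr_zero (k := k) r hr
            rw [algebraMap_smul, map_smul, map_smul, smul_eq_mul, AlgHom.commutes]
            rfl
          · rw [aug_of_ne ha.ne' hr, zero_mul]
            -- If `l = n - 1`, an element of degree 1 could move degree `n - 1` into degree `n` and
            -- spoil linearity. The hypothesis `R¹ = 0` excludes this, and for `a ≥ 2` the degree `n
            -- - a` lies below the cut.
            by_cases h1 : a = 1
            · subst h1
              simp [eq_zero_of_one hr]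
            · rw [proj_smul hr, x.2.1 _ (by omega), smul_zero, map_zero] }
  map_mem i x hx := by
    change φ (M.proj n x.1) ∈ if i + -n = 0 then (⊤ : Submodule k k) else ⊥
    split_ifs with h
    · trivial
    · rw [proj_of_mem_ne (show x.1 ∈ M.gr i from hx) (by omega), map_zero]
      exact Submodule.zero_mem _
  map_d x := by
    change φ (M.proj n (M.d x.1)) = 0
    have := proj_d (n - 1) x.1
    rw [sub_add_cancel] at this
    rw [this]
    exact hφ _ (proj_mem _ _)

theorem cutToResidue_apply (n : ℤ) (hn : n - 1 ≤ l) (hn' : l ≤ n) (φ : M →ₗ[k] k)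
    (hφ : ∀ y ∈ M.gr (n - 1), φ (M.d y) = 0) (x : cut M l W) :
    lin (cutToResidue n hn hn' φ hφ) x = φ (M.proj n x.1) := rfl

end Cut

/-! ### Preliminaries on the unit of the algebra, and linear algebra -/

theorem one_mem : (1 : R) ∈ DGAlgebra.gr (k := k) 0 :=
  SetLike.GradedOne.one_mem (A := DGAlgebra.gr (k := k))

theorem d_one : DGAlgebra.d (k := k) (1 : R) = 0 := by
  have := DGAlgebra.leibniz (k := k) 0 (1 : R) 1
    (SetLike.GradedOne.one_mem (A := DGAlgebra.gr (k := k)))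
  simpa using this

theorem quasiIso_id (M : DGMod k R) : quasiIso k R (𝟙 M) := fun j => by
  rw [cohomologyMap_id]; exact Function.bijective_id

theorem self_isSemifree : (self k R).IsSemifree := by
  refine ⟨PUnit, Module.Basis.singleton PUnit R, fun _ => 0, fun _ => 0, fun i => ?_, fun i => ?_⟩
  · rw [Module.Basis.singleton_apply]
    exact one_mem
  · rw [Module.Basis.singleton_apply, show (self k R).d 1 = 0 from d_one]
    exact Submodule.zero_mem _

/-- A linear form which separates a vector from a subspace. -/
theorem exists_form {V : Type u} [AddCommGroup V] [Module k V] (N : Submodule k V) {x : V}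
    (hx : x ∉ N) : ∃ φ : V →ₗ[k] k, φ x = 1 ∧ ∀ y ∈ N, φ y = 0 := by
  obtain ⟨f, hf, hN⟩ := Submodule.exists_le_ker_of_notMem hx
  exact ⟨(f x)⁻¹ • f, by simp [hf], fun y hy => by simp [LinearMap.mem_ker.1 (hN hy)]⟩

/-- Relative complements of subspaces. -/
theorem exists_compl {V : Type u} [AddCommGroup V] [Module k V] {N P : Submodule k V}
    (h : N ≤ P) : ∃ W ≤ P, (∀ x ∈ W, x ∈ N → x = 0) ∧ ∀ x ∈ P, ∃ w ∈ W, ∃ y ∈ N, w + y = x := by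
  obtain ⟨C, hC⟩ := N.exists_isCompl
  refine ⟨C ⊓ P, inf_le_right, fun x hx hN => ?_, fun x hx => ?_⟩
  · exact Submodule.disjoint_def.1 hC.disjoint x hN hx.1
  · obtain ⟨y, hy, w, hw, rfl⟩ := Submodule.mem_sup.1
      (show x ∈ N ⊔ C by rw [hC.sup_eq_top]; trivial)
    refine ⟨w, ⟨hw, ?_⟩, y, hy, add_comm _ _⟩
    simpa using P.sub_mem hx (h hy)

/-! ### Basic properties of derived tensor products -/

variable [IsSimplyConnectedCochain k R]

theorem rt_shift_nontrivial_iff (M : DGMod k R) (n j : ℤ) :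
    Nontrivial (residueTensorCohomology (M.shift n) j) ↔
      Nontrivial (residueTensorCohomology M (j + n)) :=
  (gradedCohomology_nontrivial_iff (gr := residueTensorGr (M.shift n))
    (sub_add_cancel j 1)).trans
    (gradedCohomology_nontrivial_iff (gr := residueTensorGr M) (i := j - 1 + n) (by omega)).symm

theorem torNonzero_shift_iff (M : DGMod k R) (n j : ℤ) :
    TorNonzero (M.shift n) j ↔ TorNonzero M (j + n) := by
  obtain ⟨F, q, hF, hq⟩ := exists_semifree M
  rw [torNonzero_iff q hF hq, torNonzero_iff (shiftMap q n) (shift_isSemifree hF n)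
    (shiftMap_quasiIso q hq n), rt_shift_nontrivial_iff]

/-- `R` is its own semi-free resolution, and `1 ⊗ r = aug r • (1 ⊗ 1)`, so `k ⊗_R R` lives in degree
0. -/
theorem eq_zero_of_torNonzero_self {j : ℤ} (h : TorNonzero (self k R) j) : j = 0 := by
  rw [torNonzero_iff (𝟙 _) self_isSemifree (quasiIso_id _),
    gradedCohomology_nontrivial_iff (sub_add_cancel j 1)] at h
  obtain ⟨_, ⟨r, hr, rfl⟩, -, h⟩ := h
  by_contra hj
  refine h 0 (Submodule.zero_mem _) ?_
  have h1 : rtMk (self k R) (r • (1 : R)) = aug k R r • rtMk (self k R) 1 := rtMk_smul r 1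
  rw [aug_of_ne hj hr, zero_smul, smul_eq_mul, mul_one] at h1
  exact (map_zero _).trans h1.symm

/-- The zero module is a semi-free resolution. -/
theorem not_torNonzero_of_acyclic {M : DGMod k R} (h : ∀ j, ¬ Nontrivial (M.cohomology j)) (j : ℤ) :
    ¬ TorNonzero M j := by
  have h' (i : ℤ) := (not_nontrivial_gradedCohomology_iff (rfl : i + 1 = i + 1)).1 (h (i + 1))
  have hq : quasiIso k R (fromZero M) := by
    refine quasiIso_of _ (fun i x hx hdx => ?_) (fun i y hy hdy z _ _ => ?_)
    · obtain ⟨z, hz, hzx⟩ := h' i x hx hdx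
      refine ⟨0, trivial, rfl, -z, Submodule.neg_mem _ hz, ?_⟩
      rw [map_neg, hzx, map_zero, zero_sub]
    · exact ⟨0, trivial, Subsingleton.elim _ _⟩
  rw [torNonzero_iff _ zero_isSemifree hq, not_nontrivial_gradedCohomology_iff (sub_add_cancel j 1)]
  intro x _ _
  obtain ⟨m, rfl⟩ := rtMk_surjective _ x
  exact ⟨0, Submodule.zero_mem _, by rw [Subsingleton.elim m 0, map_zero, map_zero]⟩

/-- The lowest cohomology group survives in `k ⊗ᴸ_R M`. -/
theorem torNonzero_of_lowest {M : DGMod k R} {n : ℤ}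
    (hlt : ∀ j < n, ¬ Nontrivial (M.cohomology j)) (hn : Nontrivial (M.cohomology n)) :
    TorNonzero M n := by
  obtain ⟨x, hx, hdx, hxb⟩ := (gradedCohomology_nontrivial_iff (sub_add_cancel n 1)).1 hn
  let B : Submodule k M := (M.gr (n - 1)).map M.d
  have hB : B ≤ M.gr n := by
    rintro _ ⟨y, hy, rfl⟩
    have := M.d_mem _ _ hy
    rwa [sub_add_cancel] at this
  obtain ⟨W, hWle, hWB, hW⟩ := exists_compl hB
  obtain ⟨φ, hφx, hφ⟩ := exists_form B (x := x) (fun ⟨y, hy, h⟩ => hxb y hy h)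
  -- `W` is a complement of the boundaries in `M^n`, so cutting there discards an acyclic part: in
  -- degree `n` each cocycle keeps a representative in `W`, and nothing else is lost because `M` has
  -- no cohomology below `n`.
  have hq : quasiIso k R (cutInc M n W) := by
    refine quasiIso_of _ (fun i y hy hdy => ?_) (fun i y hy hdy z hz hzy => ?_)
    · rcases lt_trichotomy (i + 1) n with hi | hi | hi
      · obtain ⟨z, hz, rfl⟩ := (not_nontrivial_gradedCohomology_iff rfl).1 (hlt _ hi) y hy hdy
        exact ⟨0, Submodule.zero_mem _, map_zero _, -z, Submodule.neg_mem _ hz, by simp⟩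
      · obtain rfl : i = n - 1 := by omega
        rw [sub_add_cancel] at hy
        obtain ⟨w, hw, _, ⟨z, hz, rfl⟩, rfl⟩ := hW y hy
        refine ⟨⟨w, mem_cut_of_mem (hWle hw) hw⟩, ?_, Subtype.ext ?_, -z,
          Submodule.neg_mem _ hz, ?_⟩
        · rw [sub_add_cancel]; exact hWle hw
        · rw [map_add, M.d_d, add_zero] at hdy
          exact hdy
        · rw [map_neg]
          change _ = w - (w + M.d z)
          abel
      · exact ⟨⟨y, mem_cut_of_lt hy hi⟩, hy, Subtype.ext hdy, 0, Submodule.zero_mem _,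
          by rw [map_zero]; exact (sub_self y).symm⟩
    · change M.d z = y.1 at hzy
      rcases lt_trichotomy (i + 1) n with hi | hi | hi
      · refine ⟨0, Submodule.zero_mem _, ?_⟩
        rw [map_zero]
        exact Subtype.ext (eq_zero_of_mem_cut (M := M) (m := y.1) hy hi y.2).symm
      · obtain rfl : i = n - 1 := by omega
        have hy' : y.1 ∈ M.gr (n - 1 + 1) := hy
        rw [sub_add_cancel] at hy'
        refine ⟨0, Submodule.zero_mem _, ?_⟩
        rw [map_zero]
        exact Subtype.ext (hWB y.1 (mem_of_mem_cut hy' y.2) ⟨z, hz, hzy⟩).symm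
      · rcases eq_or_lt_of_le (show n ≤ i by omega) with rfl | hi'
        · obtain ⟨w, hw, _, ⟨v, hv, rfl⟩, rfl⟩ := hW z hz
          refine ⟨⟨w, mem_cut_of_mem (hWle hw) hw⟩, hWle hw, Subtype.ext ?_⟩
          rw [map_add, M.d_d, add_zero] at hzy
          exact hzy
        · exact ⟨⟨z, mem_cut_of_lt hz hi'⟩, hz, Subtype.ext hzy⟩
  rw [← torNonzero_iff_of_quasiIso _ hq]
  obtain ⟨F, q, hF, hFq⟩ := exists_semifree (cut M n W)
  refine ⟨F, q, hF, hFq, ?_⟩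
  let g := q ≫ cutToResidue (W := W) n (by omega) le_rfl φ (fun y hy => hφ _ ⟨y, hy, rfl⟩)
  obtain ⟨w, hw, v, ⟨y, hy, rfl⟩, hwv⟩ := hW x hx
  have hdw : M.d w = 0 := by
    rw [← hwv, map_add, M.d_d, add_zero] at hdx
    exact hdx
  have hφw : φ w = 1 := by
    rw [← hwv, map_add, hφ _ ⟨y, hy, rfl⟩, add_zero] at hφx
    exact hφx
  obtain ⟨z, hz, hdz, v, hv, hvz⟩ := (cohomologyMap_surjective_iff q (sub_add_cancel n 1)).1
    (hFq n).2 ⟨w, mem_cut_of_mem (hWle hw) hw⟩ (hWle hw) (Subtype.ext hdw)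
  -- The cut module vanishes below degree `n`, so `q z` equals `w` exactly and not just up to a
  -- boundary.
  have hv0 : v = 0 := Subtype.ext (eq_zero_of_mem_cut (M := M) (m := v.1) hv (by omega) v.2)
  rw [hv0, map_zero] at hvz
  have hqz : (lin q z).1 = w := congrArg Subtype.val (sub_eq_zero.1 hvz.symm)
  let γ : F →ₗ[k] k := (lin g).restrictScalars k
  have hgz : γ z = 1 := by
    change φ (M.proj n (lin q z).1) = 1
    rw [hqz, proj_of_mem (hWle hw), hφw]
  rw [gradedCohomology_nontrivial_iff (sub_add_cancel n 1)]
  refine ⟨rtMk F z, ⟨z, hz, rfl⟩, by rw [residueTensorD_mk, hdz, map_zero], fun y hy hyz => ?_⟩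
  obtain ⟨y, rfl⟩ := rtMk_surjective F y
  -- A morphism to a shift of `k` factors through `k ⊗_R F`. The induced form is 1 on the class of
  -- `z` and kills boundaries, as the target has zero differential.
  let θ : ResidueTensor F →ₗ[k] k := (tensorRel F).liftQ
    (TensorProduct.lid k k ∘ₗ LinearMap.lTensor k γ) (by
      refine Submodule.span_le.2 ?_
      rintro _ ⟨c, r, m, rfl⟩
      rw [SetLike.mem_coe, LinearMap.mem_ker, map_sub]
      change (c * aug k R r) * γ m - c * γ (r • m) = 0
      have : γ (r • m) = aug k R r * γ m := (lin g).map_smul r m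
      rw [this, mul_assoc, sub_self])
  have hθ (m : F) : θ (rtMk F m) = γ m := one_mul (γ m)
  have h1 := congrArg θ hyz
  rw [residueTensorD_mk, hθ, hθ, hgz] at h1
  exact zero_ne_one (α := k) ((lin_d g y).symm.trans h1)

end DGMod

namespace DGMod

variable {k R : Type u} [Field k] [Ring R] [Algebra k R] [DGAlgebra k R]

/-! ### Maps on cohomology in a short exact sequence -/

/-- The consequences of the long exact sequence recorded for `GradedComplex` concern only vanishing
and finiteness. Dimension counts need the actual map, hence this diagram chase and the next one. -/
theorem cohomologyMap_surjective_left {A B C : DGMod k R} {f : A ⟶ B} {g : B ⟶ C}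
    (h : IsShortExact f g) {j : ℤ} (hC : ¬ Nontrivial (C.cohomology j)) :
    Function.Surjective (cohomologyMap f j) := by
  have hij := sub_add_cancel j 1
  rw [cohomologyMap_surjective_iff f hij]
  intro b hb hdb
  obtain ⟨c, hc, hdc⟩ := (not_nontrivial_gradedCohomology_iff hij).1 hC (lin g b) (lin_mem g hb)
    (by rw [← lin_d, hdb, map_zero])
  obtain ⟨e, he, rfl⟩ := h.toGraded.surj _ c hc
  change C.d (lin g e) = lin g b at hdc
  have hde : B.d e ∈ B.gr j := by
    have := B.d_mem _ _ he
    rwa [hij] at this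
  obtain ⟨a, ha, hab⟩ := h.toGraded.exact j (b - B.d e) (Submodule.sub_mem _ hb hde) (by
    change lin g (b - B.d e) = 0
    rw [map_sub, lin_d, hdc, sub_self])
  change lin f a = b - B.d e at hab
  refine ⟨a, ha, h.inj ?_, -e, Submodule.neg_mem _ he, ?_⟩
  · rw [lin_d, hab, map_sub, hdb, B.d_d, sub_zero, map_zero]
  · rw [hab, map_neg]; abel

theorem cohomologyMap_surjective_right {A B C : DGMod k R} {f : A ⟶ B} {g : B ⟶ C}
    (h : IsShortExact f g) {j : ℤ} (hA : ¬ Nontrivial (A.cohomology (j + 1))) :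
    Function.Surjective (cohomologyMap g j) := by
  rw [cohomologyMap_surjective_iff g (sub_add_cancel j 1)]
  intro c hc hdc
  obtain ⟨b, hb, rfl⟩ := h.toGraded.surj _ c hc
  change C.d (lin g b) = 0 at hdc
  obtain ⟨a, ha, hab⟩ := h.toGraded.exact _ (B.d b) (B.d_mem _ _ hb) (by
    change lin g (B.d b) = 0
    rw [lin_d, hdc])
  change lin f a = B.d b at hab
  obtain ⟨e, he, rfl⟩ := (not_nontrivial_gradedCohomology_iff rfl).1 hA a ha (h.inj (by
    rw [lin_d, hab, B.d_d, map_zero]))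
  refine ⟨b - lin f e, Submodule.sub_mem _ hb (lin_mem f he), ?_, 0, Submodule.zero_mem _, ?_⟩
  · rw [map_sub, ← lin_d, hab, sub_self]
  · rw [map_zero, map_sub]
    have : lin g (lin f e) = 0 := (h.exact _).2 ⟨e, rfl⟩
    rw [this]
    change 0 = lin g b - 0 - lin g b
    abel

/-- Rank-nullity: the class of `x` is a nonzero element of the kernel. -/
theorem finrank_cohomology_lt {M N : DGMod k R} (f : M ⟶ N) {j : ℤ}
    (hf : Function.Surjective (cohomologyMap f j)) (hM : Module.Finite k (M.cohomology j)) {x : M}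
    (hx : x ∈ M.gr j) (hdx : M.d x = 0) (hxb : ∀ y ∈ M.gr (j - 1), M.d y ≠ x) {y : N}
    (hy : y ∈ N.gr (j - 1)) (hyx : N.d y = lin f x) :
    Module.finrank k (N.cohomology j) < Module.finrank k (M.cohomology j) := by
  have h1 := LinearMap.finrank_range_add_finrank_ker (cohomologyMap f j)
  rw [LinearMap.range_eq_top.2 hf, finrank_top] at h1
  have : Nontrivial (LinearMap.ker (cohomologyMap f j)) := by
    refine ⟨⟨Submodule.Quotient.mk ⟨x, hdx, hx⟩, ?_⟩, 0, fun h => ?_⟩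
    · rw [LinearMap.mem_ker, cohomologyMap_mk, Submodule.Quotient.mk_eq_zero]
      exact ⟨y, hy, hyx⟩
    · obtain ⟨z, hz, hzx⟩ := (Submodule.Quotient.mk_eq_zero _).1 (congrArg Subtype.val h)
      exact hxb z hz hzx
  have := Module.finrank_pos (R := k) (M := LinearMap.ker (cohomologyMap f j))
  omega

/-- The morphism `R[-i] → M` given by a cocycle of degree `i`. -/
def ofCocycle {M : DGMod k R} {i : ℤ} {x : M} (hx : x ∈ M.gr i) (hdx : M.d x = 0) :
    (self k R).shift (-i) ⟶ M where
  toLin := LinearMap.toSpanSingleton R M x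
  map_mem n r hr := by
    have := M.smul_mem (n + -i) i r x hr hx
    rwa [neg_add_cancel_right] at this
  map_d r := by
    change DGAlgebra.d (k := k) (r : R) • x = M.d ((r : R) • x)
    rw [d_smul, hdx, smul_zero, add_zero]

theorem shift_self_nontrivial {i j : ℤ} :
    Nontrivial ((((self k R).shift (-i)).shift 1).cohomology j) ↔
      Nontrivial ((self k R).cohomology (j + 1 - i)) := by
  rw [shift_nontrivial_iff, shift_nontrivial_iff]
  rfl

variable [IsSimplyConnectedCochain k R]

/-! ### Compact DG modules -/

theorem self_cohomology_neg {j : ℤ} (hj : j < 0) : ¬ Nontrivial ((self k R).cohomology j) := by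
  rw [not_nontrivial_gradedCohomology_iff (sub_add_cancel j 1)]
  intro x hx _
  exact ⟨0, Submodule.zero_mem _, by rw [map_zero, eq_zero_of_neg hj hx]⟩

theorem self_cohomology_one : ¬ Nontrivial ((self k R).cohomology 1) := by
  rw [not_nontrivial_gradedCohomology_iff (sub_add_cancel 1 1)]
  intro x hx _
  exact ⟨0, Submodule.zero_mem _, by rw [map_zero, eq_zero_of_one hx]⟩

theorem algebraMap_injective : Function.Injective (algebraMap k R) := by
  intro a b h
  obtain ⟨c, -, hc⟩ := IsSimplyConnectedCochain.gr_zero (k := k) (algebraMap k R b)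
    (baseEquiv k R b).2
  rw [hc a h, hc b rfl]

theorem self_cohomology_zero : Nontrivial ((self k R).cohomology 0) := by
  rw [gradedCohomology_nontrivial_iff (sub_add_cancel 0 1)]
  refine ⟨1, one_mem, d_one, fun y hy h => ?_⟩
  rw [eq_zero_of_neg (by norm_num) hy, map_zero] at h
  have := algebraMap_injective (k := k) (R := R) (a₁ := 0) (a₂ := 1) (by simpa using h)
  exact zero_ne_one this

/-- The finiteness properties of a DG module which hold for compact ones. -/
structure IsBounded (M : DGMod k R) : Prop where
  lower : ∃ i, ∀ j < i, ¬ Nontrivial (M.cohomology j)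
  finite : ∀ j, Module.Finite k (M.cohomology j)
  tor : ∃ p, ∀ j, p < j → ¬ TorNonzero M j

/-- All three properties hold for `R`, whose Tor is confined to degree 0, and they pass to shifts,
through short exact sequences by the long exact sequences of H and Tor, and to retracts in the
derived category. -/
theorem IsCompact.isBounded {M : DGMod k R} (hM : M.IsCompact) : IsBounded M := by
  induction hM with
  | self =>
    exact ⟨⟨0, fun j hj => self_cohomology_neg hj⟩,
      IsSimplyConnectedCochain.finite_cohomology,
      ⟨0, fun j hj h => hj.ne' (eq_zero_of_torNonzero_self h)⟩⟩
  | shift M n _ ih =>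
    obtain ⟨⟨i, hi⟩, hf, ⟨p, hp⟩⟩ := ih
    exact ⟨⟨i - n, fun j hj => by rw [shift_nontrivial_iff]; exact hi _ (by omega)⟩,
      fun j => (shift_finite_iff n j).2 (hf _),
      ⟨p - n, fun j hj => by rw [torNonzero_shift_iff]; exact hp _ (by omega)⟩⟩
  | left f g hf hfg hg _ _ ihB ihC =>
    have h : IsShortExact f g := ⟨hf, hfg, hg⟩
    obtain ⟨⟨i, hi⟩, hB, ⟨p, hp⟩⟩ := ihB
    obtain ⟨⟨i', hi'⟩, hC, ⟨p', hp'⟩⟩ := ihC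
    -- The connecting map goes from degree `j - 1` of `C` to degree `j` of `A`, which costs one in
    -- the upper bound for Tor.
    refine ⟨⟨min i i', fun j hj hA => ?_⟩, fun j => ?_, ⟨max p (p' + 1), fun j hj hA => ?_⟩⟩
    · rcases h.toGraded.nontrivial_left (sub_add_cancel j 1) hA with h' | h'
      · exact hi' _ (by omega) h'
      · exact hi _ (by omega) h'
    · exact h.toGraded.finite_left (sub_add_cancel j 1) (hC _) (hB _)
    · rcases hA.left h (sub_add_cancel j 1) with h' | h'
      · exact hp' _ (by omega) h'
      · exact hp _ (by omega) h'
  | middle f g hf hfg hg _ _ ihA ihC =>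
    have h : IsShortExact f g := ⟨hf, hfg, hg⟩
    obtain ⟨⟨i, hi⟩, hA, ⟨p, hp⟩⟩ := ihA
    obtain ⟨⟨i', hi'⟩, hC, ⟨p', hp'⟩⟩ := ihC
    refine ⟨⟨min i i', fun j hj hB => ?_⟩, fun j => ?_, ⟨max p p', fun j hj hB => ?_⟩⟩
    · rcases h.toGraded.nontrivial_middle hB with h' | h'
      · exact hi _ (by omega) h'
      · exact hi' _ (by omega) h'
    · exact h.toGraded.finite_middle (hA _) (hC _)
    · rcases hB.middle h with h' | h'
      · exact hp _ (by omega) h'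
      · exact hp' _ (by omega) h'
  | right f g hf hfg hg _ _ ihA ihB =>
    have h : IsShortExact f g := ⟨hf, hfg, hg⟩
    obtain ⟨⟨i, hi⟩, hA, ⟨p, hp⟩⟩ := ihA
    obtain ⟨⟨i', hi'⟩, hB, ⟨p', hp'⟩⟩ := ihB
    refine ⟨⟨min (i - 1) i', fun j hj hC => ?_⟩, fun j => ?_, ⟨max p p', fun j hj hC => ?_⟩⟩
    · rcases h.toGraded.nontrivial_right rfl hC with h' | h'
      · exact hi' _ (by omega) h'
      · exact hi _ (by omega) h'
    · exact h.toGraded.finite_right rfl (hB _) (hA _)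
    · rcases hC.right h rfl with h' | h'
      · exact hp' _ (by omega) h'
      · exact hp _ (by omega) h'
  | retract r _ ih =>
    obtain ⟨⟨i, hi⟩, hf, ⟨p, hp⟩⟩ := ih
    refine ⟨⟨i, fun j hj h => ?_⟩, fun j => ?_, ⟨p, fun j hj h => hp j hj (h.of_retract r)⟩⟩
    · obtain ⟨f, hfs⟩ := exists_surjective_of_retract r j
      exact hi j hj hfs.nontrivial
    · obtain ⟨f, hfs⟩ := exists_surjective_of_retract r j
      have := hf j
      exact Module.Finite.of_surjective f hfs

/-- A DG module with bounded below cohomology is acyclic if its derived tensor product with `k`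
vanishes in the relevant degrees. -/
theorem acyclic_of_tor {M : DGMod k R} {i : ℤ} (hi : ∀ j < i, ¬ Nontrivial (M.cohomology j))
    (ht : ∀ j, i ≤ j → ¬ TorNonzero M j) (j : ℤ) : ¬ Nontrivial (M.cohomology j) := by
  -- The lower bound is pushed up one degree at a time: a first nonzero cohomology group would be
  -- lowest and so visible in Tor.
  have key (n : ℕ) : ∀ j < i + n, ¬ Nontrivial (M.cohomology j) := by
    induction n with
    | zero => simpa using hi
    | succ n ih =>
      intro j hj h
      by_cases hjn : j < i + n
      · exact ih j hjn h
      · obtain rfl : j = i + n := by push_cast at hj; omega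
        exact ht _ (by omega) (torNonzero_of_lowest ih h)
  exact key (j - i + 1).toNat j (by omega)

/-! ### Removing the lowest cohomology class -/

theorem shift_self_tor {i j : ℤ} (h : TorNonzero (((self k R).shift (-i)).shift 1) j) :
    j + 1 = i := by
  rw [torNonzero_shift_iff, torNonzero_shift_iff] at h
  have := eq_zero_of_torNonzero_self h
  omega

theorem shift_self_finite {i j : ℤ} :
    Module.Finite k ((((self k R).shift (-i)).shift 1).cohomology j) := by
  rw [shift_finite_iff, shift_finite_iff]
  exact IsSimplyConnectedCochain.finite_cohomology _

section Lowest

variable {M : DGMod k R} {i : ℤ} {x : M} (hx : x ∈ M.gr i) (hdx : M.d x = 0)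
  (hxb : ∀ y ∈ M.gr (i - 1), M.d y ≠ x) (hi : ∀ j < i, ¬ Nontrivial (M.cohomology j))

-- Only degree `i - 1` is delicate, where the cone acquires the scalars `R⁰ = k`. A cocycle with
-- scalar part `c` would make `c • x` a boundary up to sign, so `c = 0`.
include hxb hi in
theorem cone_ofCocycle_lower {j : ℤ} (hj : j < i) :
    ¬ Nontrivial ((cone (ofCocycle hx hdx)).cohomology j) := by
  rcases eq_or_lt_of_le (show j ≤ i - 1 by omega) with rfl | hj'
  · rw [not_nontrivial_gradedCohomology_iff (sub_add_cancel (i - 1) 1)]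
    rintro ⟨r, y⟩ ⟨hr, hy⟩ hd
    have h2 : lin (ofCocycle hx hdx) (((self k R).shift (-i)).sgn r) + M.d y = 0 :=
      congrArg Prod.snd hd
    rw [sub_add_cancel] at hr
    rw [sgn_of_mem hr, Units.smul_def, map_zsmul] at h2
    change r ∈ DGAlgebra.gr (k := k) (R := R) (i + -i) at hr
    rw [add_neg_cancel] at hr
    obtain ⟨c, rfl, -⟩ := IsSimplyConnectedCochain.gr_zero (k := k) (r : R) hr
    have h3 : lin (ofCocycle hx hdx) (algebraMap k R c) = c • x := algebraMap_smul R c x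
    rw [h3] at h2
    have hc : c = 0 := by
      by_contra hc
      have h4 : c • x = M.d (-(i.negOnePow • y)) := by
        rw [map_neg, Units.smul_def, map_zsmul, ← Units.smul_def]
        rw [← Units.smul_def] at h2
        rw [← units_smul_units_smul i (c • x), ← smul_neg, eq_neg_of_add_eq_zero_left h2]
      refine hxb (c⁻¹ • -(i.negOnePow • y)) (Submodule.smul_mem _ _ (Submodule.neg_mem _ ?_)) ?_
      · rw [Units.smul_def]; exact zsmul_mem hy _
      · rw [map_smul, ← h4, inv_smul_smul₀ hc]
    subst hc
    rw [zero_smul, smul_zero, zero_add] at h2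
    obtain ⟨z, hz, rfl⟩ := (not_nontrivial_gradedCohomology_iff (sub_add_cancel (i - 1) 1)).1
      (hi _ hj) y hy h2
    refine ⟨lin (coneInr _) z, lin_mem _ hz, ?_⟩
    rw [← lin_d]
    exact Prod.ext (map_zero (algebraMap k R)).symm rfl
  · intro h
    rcases (cone_exact (ofCocycle hx hdx)).toGraded.nontrivial_middle h with h' | h'
    · exact hi j hj h'
    · exact self_cohomology_neg (by omega) (shift_self_nontrivial.1 h')

-- The new generator of the cone bounds `x`, and no class is added in degree `i`, because the
-- suspended copy of `R` contributes `H¹(R) = 0` there.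
include hxb in
theorem finrank_cone_ofCocycle_lt (hf : Module.Finite k (M.cohomology i)) :
    Module.finrank k ((cone (ofCocycle hx hdx)).cohomology i) <
      Module.finrank k (M.cohomology i) := by
  refine finrank_cohomology_lt (coneInr (ofCocycle hx hdx))
    (cohomologyMap_surjective_left (cone_exact _) ?_) hf hx hdx hxb
    (y := ((((self k R).shift (-i)).sgn (1 : R), 0) : R × M)) ?_ ?_
  · rw [shift_self_nontrivial, add_sub_cancel_left]
    exact self_cohomology_one
  · refine ⟨?_, Submodule.zero_mem _⟩
    refine sgn_mem ?_
    change (1 : R) ∈ DGAlgebra.gr (k := k) (i - 1 + 1 + -i)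
    rw [show i - 1 + 1 + -i = 0 by omega]
    exact one_mem
  · refine Prod.ext ?_ ?_
    · change ((self k R).shift (-i)).d (((self k R).shift (-i)).sgn (1 : R)) = 0
      rw [d_sgn]
      have : ((self k R).shift (-i)).d (1 : R) = 0 := d_one
      rw [this, map_zero, neg_zero]
    · change lin (ofCocycle hx hdx) (((self k R).shift (-i)).sgn
        (((self k R).shift (-i)).sgn (1 : R))) + M.d 0 = x
      rw [sgn_sgn, map_zero, add_zero]
      exact one_smul R x

end Lowest

/-- If `H^{> s}(R) = 0` and `k ⊗ᴸ_R M` vanishes above degree `p`, then `M` vanishes above degree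
`p + s`, and the cohomology in the extremal degrees is nonzero at the same time. -/
theorem cohomology_of_tor {s p : ℤ} (hs : ∀ j, s < j → ¬ Nontrivial ((self k R).cohomology j))
    (hs' : Nontrivial ((self k R).cohomology s)) {M : DGMod k R} (hM : ∃ i, ∀ j < i,
      ¬ Nontrivial (M.cohomology j)) (hf : ∀ j, Module.Finite k (M.cohomology j))
    (hp : ∀ j, p < j → ¬ TorNonzero M j) :
    (∀ j, p + s < j → ¬ Nontrivial (M.cohomology j)) ∧
      (TorNonzero M p → Nontrivial (M.cohomology (p + s))) := by
  -- Double induction: `N` is the distance from the lower bound of `M` up to `p + 1`, and `n` bounds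
  -- the dimension of cohomology at that lower bound.
  have key (N : ℕ) : ∀ (n : ℕ) (M : DGMod k R), (∀ j < p + 1 - N, ¬ Nontrivial (M.cohomology j)) →
      (∀ j, Module.Finite k (M.cohomology j)) → (∀ j, p < j → ¬ TorNonzero M j) →
      Module.finrank k (M.cohomology (p + 1 - N)) ≤ n →
      (∀ j, p + s < j → ¬ Nontrivial (M.cohomology j)) ∧
        (TorNonzero M p → Nontrivial (M.cohomology (p + s))) := by
    induction N with
    | zero =>
      intro n M hi _ hp _
      have := acyclic_of_tor (M := M) (i := p + 1) (by simpa using hi) (fun j hj => hp j (by omega))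
      exact ⟨fun j _ => this j, fun h => absurd h (not_torNonzero_of_acyclic this p)⟩
    | succ N ihN =>
      intro n
      induction n with
      | zero =>
        intro M hi hf hp hn
        refine ihN _ M (fun j hj h => ?_) hf hp le_rfl
        rcases eq_or_lt_of_le (show j ≤ p + 1 - (N + 1 : ℕ) by push_cast; omega) with rfl | hj'
        · have := hf (p + 1 - (N + 1 : ℕ))
          exact (Module.finrank_pos (R := k)).not_ge hn
        · exact hi j hj' h
      | succ n ihn =>
        intro M hi hf hp hn
        by_cases h0 : Nontrivial (M.cohomology (p + 1 - (N + 1 : ℕ)))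
        swap
        · refine ihN _ M (fun j hj h => ?_) hf hp le_rfl
          rcases eq_or_lt_of_le (show j ≤ p + 1 - (N + 1 : ℕ) by push_cast; omega) with rfl | hj'
          · exact h0 h
          · exact hi j hj' h
        obtain ⟨i, hiN⟩ : ∃ i : ℤ, i = p + 1 - (N + 1 : ℕ) := ⟨_, rfl⟩
        rw [← hiN] at hi hn h0
        have hip : i ≤ p := by push_cast at hiN; omega
        obtain ⟨x, hx, hdx, hxb⟩ := (gradedCohomology_nontrivial_iff (sub_add_cancel i 1)).1 h0
        have hex := cone_exact (ofCocycle hx hdx)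
        have hlow (j : ℤ) (hj : j < i) := cone_ofCocycle_lower hx hdx hxb hi hj
        have hCp (j : ℤ) (hj : p < j) : ¬ TorNonzero (cone (ofCocycle hx hdx)) j := fun h => by
          rcases h.middle hex with h' | h'
          · exact hp j hj h'
          · have := shift_self_tor h'
            omega
        obtain ⟨h1, h2⟩ := ihn (cone (ofCocycle hx hdx)) (by rw [← hiN]; exact hlow)
          (fun j => hex.toGraded.finite_middle (hf j) shift_self_finite) hCp (by
            rw [← hiN]
            have := finrank_cone_ofCocycle_lt hx hdx hxb (hf i)
            omega)
        refine ⟨fun j hj h => ?_, fun h => ?_⟩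
        -- The copy of `R` contributes `H^{j-i}(R)`, which vanishes because `i ≤ p` and `p + s < j`
        -- give `s < j - i`.
        · rcases hex.toGraded.nontrivial_left (sub_add_cancel j 1) h with h' | h'
          · exact hs _ (by omega) (shift_self_nontrivial.1 h')
          · exact h1 j hj h'
        · by_cases hC : TorNonzero (cone (ofCocycle hx hdx)) p
          · rcases hex.toGraded.nontrivial_middle (h2 hC) with h' | h'
            · exact h'
            · exact absurd (shift_self_nontrivial.1 h') (hs _ (by omega))
          · rcases h.left hex (sub_add_cancel p 1) with h' | h'
            · have hpi : p = i := by have := shift_self_tor h'; omega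
              have hac := acyclic_of_tor (M := cone (ofCocycle hx hdx)) hlow (fun j hj => by
                by_cases hjp : j = p
                · rwa [hjp]
                · exact hCp j (by omega))
              rcases hex.toGraded.nontrivial_right (sub_add_cancel (p + s) 1)
                (shift_self_nontrivial.2 (by
                  rw [show p + s - 1 + 1 - i = s by omega]; exact hs')) with h' | h'
              · exact absurd h' (hac _)
              · exact h'
            · exact absurd h' hC
  obtain ⟨i, hi⟩ := hM
  -- If `i > p + 1`, truncation to 0 just replaces the lower bound `i` by the weaker bound `p + 1`.
  refine key (p + 1 - i).toNat _ M (fun j hj => hi j ?_) hf hp le_rfl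
  omega

end DGMod

namespace DGMod

variable {k R : Type u} [Field k] [Ring R] [Algebra k R] [DGAlgebra k R]

theorem not_nontrivial_of_surjective {M N : DGMod k R} {f : M ⟶ N} {j : ℤ}
    (hf : Function.Surjective (cohomologyMap f j)) (hM : ¬ Nontrivial (M.cohomology j)) :
    ¬ Nontrivial (N.cohomology j) := fun _ => hM hf.nontrivial

variable [IsSimplyConnectedCochain k R]

/-! ### Removing the highest cohomology class -/

theorem residueShift_eq_zero {n j : ℤ} {x : residueShift k R n}
    (hx : x ∈ (residueShift k R n).gr j) (hj : j ≠ n) : x = 0 := by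
  have h : (residueShift k R n).gr j = ⊥ := if_neg (show ¬ j + -n = 0 by omega)
  rw [h] at hx
  exact hx

theorem eq_of_residueShift_nontrivial {n j : ℤ}
    (h : Nontrivial ((residueShift k R n).cohomology j)) : j = n := by
  obtain ⟨x, hx, -, hxb⟩ := (gradedCohomology_nontrivial_iff (sub_add_cancel j 1)).1 h
  by_contra hj
  exact hxb 0 (Submodule.zero_mem _) (by rw [map_zero, residueShift_eq_zero hx hj])

theorem torNonzero_residueShift_iff {n j : ℤ} :
    TorNonzero (residueShift k R n) j ↔ TorNonzero (residue k R) (j - n) :=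
  torNonzero_shift_iff _ _ _

/-- A cocycle of the quotient below the cut lifts to some `b` with `d b` in the submodule. Then `d b
= 0`, for degree reasons or, when it lands in degree `l`, by the hypothesis on `W`. -/
theorem cohomologyMap_cutProj_surjective {M : DGMod k R} {l : ℤ} {W : Submodule k M}
    (hW : ∀ y ∈ M.gr (l - 1), M.d y ∈ W → M.d y = 0) {j : ℤ} (hj : j < l) :
    Function.Surjective (cohomologyMap (cutProj M l W) j) := by
  rw [cohomologyMap_surjective_iff _ (sub_add_cancel j 1)]
  intro c hc hdc
  obtain ⟨b, hb, rfl⟩ := (cut_exact M l W).toGraded.surj _ c hc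
  change (cutQuot M l W).d (lin (cutProj M l W) b) = 0 at hdc
  rw [← lin_d] at hdc
  obtain ⟨a, ha⟩ := ((cut_exact M l W).exact _).1 hdc
  have hcut : M.d b ∈ cutSubmodule M l W := by
    rw [← ha]
    exact a.2
  have hdb : M.d b = 0 := by
    rcases eq_or_lt_of_le (show j ≤ l - 1 by omega) with rfl | hj'
    · refine hW b hb (mem_of_mem_cut ?_ hcut)
      have := M.d_mem _ _ hb
      rwa [sub_add_cancel] at this
    · exact eq_zero_of_mem_cut (M.d_mem _ _ hb) (by omega) hcut
  refine ⟨b, hb, hdb, 0, Submodule.zero_mem _, ?_⟩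
  rw [map_zero]
  exact (sub_self _).symm

/-- The highest cohomology group of `M` can be reduced by dividing out a DG submodule which is
quasi-isomorphic to `k[-m]`. -/
theorem exists_cut_quasiIso {M : DGMod k R} {m : ℤ}
    (hm : ∀ j, m < j → ¬ Nontrivial (M.cohomology j)) {x : M} (hx : x ∈ M.gr m)
    (hdx : M.d x = 0) (hxb : ∀ y ∈ M.gr (m - 1), M.d y ≠ x) :
    ∃ (W : Submodule k M) (φ : M →ₗ[k] k) (hφ : ∀ y ∈ M.gr (m - 1), φ (M.d y) = 0), x ∈ W ∧
      quasiIso k R (cutToResidue (W := W) m (by omega) le_rfl φ hφ) ∧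
      ∀ j, Function.Surjective (cohomologyMap (cutProj M m W) j) := by
  obtain ⟨φ, hφx, hφ'⟩ := exists_form ((M.gr (m - 1)).map M.d) (x := x)
    (fun ⟨y, hy, h⟩ => hxb y hy h)
  have hφ : ∀ y ∈ M.gr (m - 1), φ (M.d y) = 0 := fun y hy => hφ' _ ⟨y, hy, rfl⟩
  -- `U` is a complement of the cocycles in `M^m`: it adds no cocycles but has the same boundaries
  -- as all of `M^m`. Hence `U ⊕ M^{>m}` is acyclic, and adding `x` to `U` leaves exactly one class.
  obtain ⟨U, hU, hUz, hUs⟩ := exists_compl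
    (inf_le_right : LinearMap.ker M.d ⊓ M.gr m ≤ M.gr m)
  let W : Submodule k M := U ⊔ Submodule.span k {x}
  have hxW : x ∈ W := Submodule.mem_sup_right (Submodule.mem_span_singleton_self x)
  have hWx (w : M) (hw : w ∈ W) (hdw : M.d w = 0) (hφw : φ w = 0) : w = 0 := by
    obtain ⟨a, ha, _, hb, rfl⟩ := Submodule.mem_sup.1 hw
    obtain ⟨c, rfl⟩ := Submodule.mem_span_singleton.1 hb
    rw [map_add, map_smul, hdx, smul_zero, add_zero] at hdw
    have := hUz a ha ⟨hdw, hU ha⟩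
    subst this
    rw [zero_add, map_smul, hφx, smul_eq_mul, mul_one] at hφw
    rw [hφw, zero_smul, zero_add]
  have hq : quasiIso k R (cutToResidue (W := W) m (by omega) le_rfl φ hφ) := by
    refine quasiIso_of _ (fun i c hc _ => ?_) (fun i y hy hdy z _ hzy => ?_)
    · by_cases hi : i + 1 = m
      · subst hi
        let c' : k := c
        have hcx : c' • x ∈ M.gr (i + 1) := Submodule.smul_mem _ _ hx
        refine ⟨⟨c' • x, mem_cut_of_mem hcx (W.smul_mem _ hxW)⟩, hcx, Subtype.ext ?_, 0,
          Submodule.zero_mem _, ?_⟩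
        · change M.d (c' • x) = 0
          rw [map_smul, hdx, smul_zero]
        · rw [map_zero, cutToResidue_apply, proj_of_mem hcx, map_smul, hφx, smul_eq_mul, mul_one]
          exact (sub_self c').symm
      · refine ⟨0, Submodule.zero_mem _, map_zero _, 0, Submodule.zero_mem _, ?_⟩
        rw [map_zero, map_zero, residueShift_eq_zero hc hi, sub_zero]
    · have hdy' : M.d y.1 = 0 := congrArg Subtype.val hdy
      have hy' : y.1 ∈ M.gr (i + 1) := hy
      rcases lt_trichotomy (i + 1) m with hi | hi | hi
      · exact ⟨0, Submodule.zero_mem _,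
          by rw [map_zero]; exact Subtype.ext (eq_zero_of_mem_cut hy' hi y.2).symm⟩
      · subst hi
        rw [cutToResidue_apply, proj_of_mem hy'] at hzy
        refine ⟨0, Submodule.zero_mem _, ?_⟩
        rw [map_zero]
        exact Subtype.ext (hWx y.1 (mem_of_mem_cut hy' y.2) hdy' hzy.symm).symm
      · obtain ⟨v, hv, hvy⟩ := (not_nontrivial_gradedCohomology_iff rfl).1 (hm _ hi) y.1 hy' hdy'
        rcases eq_or_lt_of_le (show m ≤ i by omega) with rfl | hi'
        · obtain ⟨w, hw, t, ht, rfl⟩ := hUs v hv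
          refine ⟨⟨w, mem_cut_of_mem (hU hw) (Submodule.mem_sup_left hw)⟩, hU hw, Subtype.ext ?_⟩
          rw [map_add, LinearMap.mem_ker.1 ht.1, add_zero] at hvy
          exact hvy
        · exact ⟨⟨v, mem_cut_of_lt hv hi'⟩, hv, Subtype.ext hvy⟩
  refine ⟨W, φ, hφ, hxW, hq, fun j => ?_⟩
  by_cases hj : j < m
  · exact cohomologyMap_cutProj_surjective (fun y hy hyW => hWx _ hyW (M.d_d y) (hφ y hy)) hj
  -- From degree `m` on, the obstruction lies in degree `j + 1 > m` of the submodule, where `k[-m]`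
  -- has no cohomology.
  · refine cohomologyMap_surjective_right (cut_exact M m W) fun h => ?_
    have h' : Nontrivial ((residueShift k R m).cohomology (j + 1)) :=
      (Equiv.ofBijective _ (hq (j + 1))).nontrivial_congr.1 h
    have := eq_of_residueShift_nontrivial h'
    omega

/-- If `k ⊗ᴸ_R k` vanishes above degree `q` and `M` vanishes above degree `m`, then
`k ⊗ᴸ_R M` vanishes above degree `m + q`. -/
theorem not_torNonzero_of_lt {q : ℤ} (hq : ∀ j, q < j → ¬ TorNonzero (residue k R) j)
    {M : DGMod k R} {m : ℤ} (hM : ∃ i, ∀ j < i, ¬ Nontrivial (M.cohomology j))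
    (hf : ∀ j, Module.Finite k (M.cohomology j))
    (hm : ∀ j, m < j → ¬ Nontrivial (M.cohomology j)) {j : ℤ} (hj : m + q < j) :
    ¬ TorNonzero M j := by
  obtain ⟨i, hi⟩ := hM
  -- Double induction from the top: `N` is the number of degrees from `i` to `m`, and `n` bounds the
  -- dimension of `H^m`. The lower bound `i` stays fixed while `m` decreases.
  have key (N : ℕ) : ∀ (n : ℕ) (M : DGMod k R) (m : ℤ), m = i + N - 1 →
      (∀ j < i, ¬ Nontrivial (M.cohomology j)) → (∀ j, Module.Finite k (M.cohomology j)) →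
      (∀ j, m < j → ¬ Nontrivial (M.cohomology j)) → Module.finrank k (M.cohomology m) ≤ n →
      ∀ j, m + q < j → ¬ TorNonzero M j := by
    induction N with
    | zero =>
      intro n M m hmN hi hf hm _ j _
      refine not_torNonzero_of_acyclic (fun j => ?_) j
      by_cases hj : j < i
      · exact hi j hj
      · exact hm j (by push_cast at hmN; omega)
    | succ N ihN =>
      intro n
      have step (M : DGMod k R) (m : ℤ) (hmN : m = i + (N + 1 : ℕ) - 1)
          (hi : ∀ j < i, ¬ Nontrivial (M.cohomology j))
          (hf : ∀ j, Module.Finite k (M.cohomology j))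
          (hm : ∀ j, m < j → ¬ Nontrivial (M.cohomology j))
          (h0 : ¬ Nontrivial (M.cohomology m)) (j : ℤ) (hj : m + q < j) : ¬ TorNonzero M j := by
        refine ihN _ M (m - 1) (by push_cast at hmN; omega) hi hf (fun j hj => ?_) le_rfl j
          (by omega)
        by_cases hjm : j = m
        · rwa [hjm]
        · exact hm j (by omega)
      induction n with
      | zero =>
        intro M m hmN hi hf hm hn
        refine step M m hmN hi hf hm fun h => ?_
        have := hf m
        exact (Module.finrank_pos (R := k)).not_ge hn
      | succ n ihn =>
        intro M m hmN hi hf hm hn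
        by_cases h0 : Nontrivial (M.cohomology m)
        swap
        · exact step M m hmN hi hf hm h0
        obtain ⟨x, hx, hdx, hxb⟩ := (gradedCohomology_nontrivial_iff (sub_add_cancel m 1)).1 h0
        obtain ⟨W, φ, hφ, hxW, hqi, hs⟩ := exists_cut_quasiIso hm hx hdx hxb
        intro j hj h
        rcases h.middle (cut_exact M m W) with h' | h'
        · rw [torNonzero_iff_of_quasiIso _ hqi, torNonzero_residueShift_iff] at h'
          exact hq _ (by omega) h'
        · refine ihn (cutQuot M m W) m hmN
            (fun j hj => not_nontrivial_of_surjective (hs j) (hi j hj))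
            (fun j => have := hf j; Module.Finite.of_surjective _ (hs j))
            (fun j hj => not_nontrivial_of_surjective (hs j) (hm j hj)) ?_ j hj h'
          have := finrank_cohomology_lt (cutProj M m W) (hs m) (hf m) hx hdx hxb (y := 0)
            (Submodule.zero_mem _) (by
              rw [map_zero]
              exact (((cut_exact M m W).exact x).2 ⟨⟨x, mem_cut_of_mem hx hxW⟩, rfl⟩).symm)
          omega
  by_cases him : i ≤ m + 1
  · exact key (m + 1 - i).toNat _ M m (by omega) hi hf hm le_rfl j hj
  · refine not_torNonzero_of_acyclic (fun j => ?_) j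
    by_cases hj : j < i
    · exact hi j hj
    · exact hm j (by omega)

/-- If the highest nonzero cohomology groups of `k ⊗ᴸ_R k` and of `M` are those in degrees `q` and
`m`, then `k ⊗ᴸ_R M` does not vanish in degree `m + q`. -/
theorem torNonzero_of_highest {q : ℤ} (hq : ∀ j, q < j → ¬ TorNonzero (residue k R) j)
    (hq' : TorNonzero (residue k R) q) {M : DGMod k R} {m : ℤ}
    (hM : ∃ i, ∀ j < i, ¬ Nontrivial (M.cohomology j))
    (hf : ∀ j, Module.Finite k (M.cohomology j))
    (hm : ∀ j, m < j → ¬ Nontrivial (M.cohomology j)) (hm' : Nontrivial (M.cohomology m)) :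
    TorNonzero M (m + q) := by
  obtain ⟨x, hx, hdx, hxb⟩ := (gradedCohomology_nontrivial_iff (sub_add_cancel m 1)).1 hm'
  obtain ⟨W, φ, hφ, hxW, hqi, -⟩ := exists_cut_quasiIso hm hx hdx hxb
  -- The cut is made at `m - 1`, one degree below the top, with `V` complementary to the boundaries.
  -- The submodule then carries `H^{m-1}` and `H^m`, and the quotient has cohomology only up to `m -
  -- 2`. A cut at `m` would leave a possible obstruction in the Tor of the quotient.
  let B : Submodule k M := (M.gr (m - 1 - 1)).map M.d
  have hB : B ≤ M.gr (m - 1) := by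
    rintro _ ⟨y, hy, rfl⟩
    have := M.d_mem _ _ hy
    rwa [sub_add_cancel] at this
  obtain ⟨V, hVle, hVB, hV⟩ := exists_compl hB
  have hle : cutSubmodule M m W ≤ cutSubmodule M (m - 1) V := fun y hy =>
    ⟨fun n hn => hy.1 n (by omega), by rw [hy.1 (m - 1) (by omega)]; exact V.zero_mem⟩
  let ι : cut M m W ⟶ cut M (m - 1) V :=
    { toLin := Submodule.inclusion hle
      map_mem := fun _ _ h => h
      map_d := fun _ => rfl }
  let ρ : cut M (m - 1) V ⟶ residueShift k R m := cutToResidue m le_rfl (by omega) φ hφ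
  have hιρ : quasiIso k R (ι ≫ ρ) := hqi
  -- The form `φ` extends from the smaller cut to the larger one, thanks to `R¹ = 0`. As the
  -- composite `ι ≫ ρ` is a quasi-isomorphism, `k[-m]` splits off in the derived category.
  let r : Retract (residueShift k R m).toDerived (cut M (m - 1) V).toDerived :=
    { i := (derivedIso _ hιρ).inv ≫ (quasiIso k R).Q.map ι
      r := (quasiIso k R).Q.map ρ
      retract := by
        rw [Category.assoc, ← Functor.map_comp]
        exact (derivedIso _ hιρ).inv_hom_id }
  have hD : TorNonzero (cut M (m - 1) V) (m + q) :=
    (torNonzero_residueShift_iff.2 (by rwa [add_sub_cancel_left])).of_retract r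
  have hQ (j : ℤ) (hj : m - 2 < j) : ¬ Nontrivial ((cutQuot M (m - 1) V).cohomology j) := by
    rw [not_nontrivial_gradedCohomology_iff (sub_add_cancel j 1)]
    intro c hc _
    obtain ⟨b, hb, rfl⟩ := (cut_exact M (m - 1) V).toGraded.surj _ c hc
    have hzero (a : M) (ha : a ∈ cutSubmodule M (m - 1) V) : lin (cutProj M (m - 1) V) a = 0 :=
      ((cut_exact M (m - 1) V).exact a).2 ⟨⟨a, ha⟩, rfl⟩
    rcases eq_or_lt_of_le (show m - 1 ≤ j by omega) with rfl | hj'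
    · obtain ⟨w, hw, _, ⟨e, he, rfl⟩, rfl⟩ := hV b hb
      refine ⟨lin (cutProj M (m - 1) V) e, lin_mem _ he, ?_⟩
      change _ = lin (cutProj M (m - 1) V) (w + M.d e)
      rw [map_add, hzero w (mem_cut_of_mem (hVle hw) hw), zero_add, lin_d]
    · exact ⟨0, Submodule.zero_mem _, by rw [map_zero]; exact (hzero b (mem_cut_of_lt hb hj')).symm⟩
  have hs (j : ℤ) : Function.Surjective (cohomologyMap (cutProj M (m - 1) V) j) := by
    by_cases hj : j < m - 1
    · exact cohomologyMap_cutProj_surjective (fun y hy h => hVB _ h ⟨y, hy, rfl⟩) hj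
    · have := not_nontrivial_iff_subsingleton.1 (hQ j (by omega))
      exact Function.surjective_to_subsingleton _
  obtain ⟨i, hi⟩ := hM
  -- The class in Tor of the submodule could only die against degree `m + q - 1` of the quotient,
  -- which exceeds its bound `(m - 2) + q`.
  refine (hD.left (cut_exact M (m - 1) V) (sub_add_cancel _ 1)).resolve_left
    (not_torNonzero_of_lt hq ⟨i, fun j hj => not_nontrivial_of_surjective (hs j) (hi j hj)⟩
      (fun j => have := hf j; Module.Finite.of_surjective _ (hs j)) hQ (by omega))

end DGMod

/-! ### Suprema of sets of integers -/

theorem intSup_of_forall_notMem {S : Set ℤ} (h : ∀ j, j ∉ S) : intSup S = ⊥ := by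
  simp [intSup, h]

theorem intSup_of_isGreatest {S : Set ℤ} {m : ℤ} (hm : m ∈ S) (h : ∀ j, m < j → j ∉ S) :
    intSup S = ((m : ℝ) : EReal) := by
  refine le_antisymm (iSup₂_le fun j hj => ?_) (le_iSup₂_of_le m hm le_rfl)
  have : j ≤ m := not_lt.1 fun hlt => h j hlt hj
  exact_mod_cast this

theorem exists_isGreatest_of_bound {S : Set ℤ} {m : ℤ} (hm : m ∈ S) {b : ℤ}
    (h : ∀ j, b < j → j ∉ S) : ∃ n ∈ S, ∀ j, n < j → j ∉ S := by
  obtain ⟨n, hn, hmax⟩ := Int.exists_greatest_of_bdd (P := (· ∈ S))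
    ⟨b, fun j hj => not_lt.1 fun hlt => h j hlt hj⟩ ⟨m, hm⟩
  exact ⟨n, hn, fun j hj hS => (hmax j hS).not_gt hj⟩

theorem exists_bound_of_intSup_lt_top {S : Set ℤ} (h : intSup S < ⊤) :
    ∃ b, ∀ j, b < j → j ∉ S := by
  obtain ⟨r, hr, -⟩ := EReal.lt_iff_exists_real_btwn.1 h
  refine ⟨⌈r⌉, fun j hj hS => ?_⟩
  have h1 : ((j : ℝ) : EReal) ≤ r := (le_iSup₂_of_le j hS le_rfl).trans hr.le
  have h2 : (j : ℝ) ≤ r := by exact_mod_cast h1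
  have h3 : r < j := (Int.le_ceil r).trans_lt (by exact_mod_cast hj)
  exact h2.not_gt h3

/-! ### The two formulas for the projective codimension -/

theorem corollary4p7 {k R : Type u} [Field k] [Ring R] [Algebra k R] [DGAlgebra k R]
    [IsSimplyConnectedCochain k R] (M : DGMod k R) (hM : M.IsCompact) :
    ((DGMod.self k R).sup < ⊤ → M.pcd = M.sup - (DGMod.self k R).sup) ∧
    (M.sup < ⊤ → (DGMod.residue k R).IsCompact →
      M.pcd = M.sup + (DGMod.residue k R).pcd) := by
  obtain ⟨⟨i, hi⟩, hf, ⟨b, hb⟩⟩ := hM.isBounded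
  have hacyclic (h : ∀ j, ¬ Nontrivial (M.cohomology j)) : M.sup = ⊥ ∧ M.pcd = ⊥ :=
    ⟨intSup_of_forall_notMem h,
      intSup_of_forall_notMem (DGMod.not_torNonzero_of_acyclic h)⟩
  refine ⟨fun hR => ?_, fun hsup hk => ?_⟩
  · obtain ⟨c, hc⟩ := exists_bound_of_intSup_lt_top hR
    obtain ⟨s, hs, hs'⟩ := exists_isGreatest_of_bound
      (DGMod.self_cohomology_zero (k := k) (R := R)) hc
    have hRs : (DGMod.self k R).sup = ((s : ℝ) : EReal) := intSup_of_isGreatest hs hs'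
    rw [hRs]
    by_cases ht : ∃ j, DGMod.TorNonzero M j
    · obtain ⟨j, hj⟩ := ht
      obtain ⟨p, hp, hp'⟩ := exists_isGreatest_of_bound (S := {j | DGMod.TorNonzero M j}) hj hb
      obtain ⟨h1, h2⟩ := DGMod.cohomology_of_tor hs' hs ⟨i, hi⟩ hf hp'
      have hMs : M.sup = (((p + s : ℤ) : ℝ) : EReal) := intSup_of_isGreatest (h2 hp) h1
      have hMp : M.pcd = ((p : ℝ) : EReal) := intSup_of_isGreatest hp hp'
      rw [hMs, hMp, ← EReal.coe_sub, Int.cast_add, add_sub_cancel_right]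
    -- Without Tor the module is acyclic, and both sides are `-∞`.
    · push Not at ht
      obtain ⟨h1, h2⟩ := hacyclic (DGMod.acyclic_of_tor hi fun j _ => ht j)
      rw [h1, h2, EReal.bot_sub]
  · by_cases hac : ∃ j, Nontrivial (M.cohomology j)
    · obtain ⟨j, hj⟩ := hac
      obtain ⟨c, hc⟩ := exists_bound_of_intSup_lt_top hsup
      obtain ⟨m, hm, hm'⟩ := exists_isGreatest_of_bound (S := {j | Nontrivial (M.cohomology j)})
        hj hc
      have hMs : M.sup = ((m : ℝ) : EReal) := intSup_of_isGreatest hm hm'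
      obtain ⟨d, hd⟩ := hk.isBounded.tor
      by_cases ht : ∃ j, DGMod.TorNonzero (DGMod.residue k R) j
      · obtain ⟨j, hj⟩ := ht
        obtain ⟨q, hq, hq'⟩ := exists_isGreatest_of_bound
          (S := {j | DGMod.TorNonzero (DGMod.residue k R) j}) hj hd
        have hkq : (DGMod.residue k R).pcd = ((q : ℝ) : EReal) := intSup_of_isGreatest hq hq'
        have hMp : M.pcd = (((m + q : ℤ) : ℝ) : EReal) := intSup_of_isGreatest
          (DGMod.torNonzero_of_highest hq' hq ⟨i, hi⟩ hf hm' hm)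
          fun j hj => DGMod.not_torNonzero_of_lt hq' ⟨i, hi⟩ hf hm' hj
        rw [hMs, hMp, hkq, ← EReal.coe_add, Int.cast_add]
      · push Not at ht
        have hkp : (DGMod.residue k R).pcd = ⊥ := intSup_of_forall_notMem ht
        rw [hkp, EReal.add_bot]
        -- If Tor of `k` vanishes in all degrees, every integer bounds it; `j - m - 1` is chosen so
        -- that `m + q < j`. This case cannot occur, since the lowest cohomology of `k` survives in
        -- Tor, but the formula covers it.
        exact intSup_of_forall_notMem fun j =>
          DGMod.not_torNonzero_of_lt (q := j - m - 1) (fun j _ => ht j) ⟨i, hi⟩ hf hm' (by omega)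
    · push Not at hac
      obtain ⟨h1, h2⟩ := hacyclic fun j h => not_subsingleton _ (hac j)
      rw [h1, h2, EReal.bot_add]

end
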